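/- **Setting.** Let $\mathcal S,\mathcal A$ be measurable spaces with countably generated $\sigma$-algebras and $H$ an episode length. An environment is a tuple $\mathcal E=\{(P_h,r_h)\}_{h=1}^H$ of Markov kernels $P_h(\cdot|s,a)$ on $\mathcal S$ and $r_h(\cdot|s,a)$ on $[0,1]$. In each layer, $P_h$ and $r_h$ range over families (jointly measurable in the parameter and $(s,a)$) parametrized by standard Borel spaces $\Theta^P_h$, $\Theta^R_h$ with prior probability measures $\rho^P_h,\rho^R_h$; all of these are independent, i.e. the prior on $\Theta=\prod_h\Theta^P_h\times\prod_h\Theta^R_h$ is the product measure $\rho$. An episode of a stationary policy $\pi=(\pi_h)$ in $\mathcal E$ starts at a fixed $s_1$; in layer $h$ one draws $a_h\sim\pi_h(\cdot|s_h)$ and then, independently, $r_h\sim r_h(\cdot|s_h,a_h)$ and $s_{h+1}\sim P_h(\cdot|s_h,a_h)$. Let $\mathcal E\mapsto\pi^*_{\mathcal E}$ be a measurable choice of a policy that is optimal for $\mathcal E$ (from every layer and state) within a class $\Pi$ of stationary policies. The history of episode $\ell$ is $\mathcal H_{\ell,H}=(s_1,a_1,r_1,\dots,s_H,a_H,r_H,s_{H+1})$,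 and $\mathcal D_\ell=(\mathcal H_{1,H},\dots,\mathcal H_{\ell-1,H})$ is generated by Thompson sampling (TS): in each episode $j$ one samples $\mathcal E_j$ from the posterior given $\mathcal D_j$, independently of the true environment $\mathcal E\sim\rho$, and plays $\pi^j_{\rm TS}=\pi^*_{\mathcal E_j}$ in $\mathcal E$. Let $\mathbb P_\ell=\mathbb P(\cdot|\mathcal D_\ell)$ and let $\mathbb E_\ell$ be its expectation. Let $\varepsilon>0$ and let $\Theta=\bigsqcup_{k=1}^K\Theta_k$ be a measurable layered $\varepsilon$-value partition, $\zeta(\mathcal E)=k\iff\mathcal E\in\Theta_k$. This means: $V^{\mathcal E}_{1,\pi^*_{\mathcal E}}(s_1)-V^{\mathcal E'}_{1,\pi^*_{\mathcal E}}(s_1)\le\varepsilon$ whenever $\zeta(\mathcal E)=\zeta(\mathcal E')$; the partition is formed layer by layer, i.e. there are measurable labels $c_h:\Theta^P_h\times\Theta^R_h\to\mathbb N$ with $\zeta(\mathcal E)=\zeta(\mathcal E')$ iff $c_h(P_h,r_h)=c_h(P_h',r_h')$ for all $h$; and, under $\rho$ conditioned on a cell of positive mass, the layers are independent and, in each layer,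 $P_h$ and $r_h$ are independent. The surrogate environment is $\tilde{\mathcal E}^*_\ell=\mathbb E_\ell[\mathcal E\mid\zeta]$, i.e. it equals $\tilde{\mathcal E}^*_{k,\ell}=\mathbb E_\ell[\mathcal E\mid\mathcal E\in\Theta_k]$ when the true environment lies in $\Theta_k$, and $\bar{\mathcal E}_\ell=\mathbb E_\ell[\mathcal E]$ is the mean environment (means of kernels, for each $(s,a)$). Let $$\mathbb I^{\pi^\ell_{\rm TS}}_\ell(\tilde{\mathcal E}^*_\ell;\mathcal H_{\ell,H})=\mathbb E_{\pi^\ell_{\rm TS}}\Big[D_{\rm KL}\big(\mathbb P_\ell((\tilde{\mathcal E}^*_\ell,\mathcal H_{\ell,H})\in\cdot\,|\,\pi^\ell_{\rm TS})\,\big\|\,\mathbb P_\ell(\tilde{\mathcal E}^*_\ell\in\cdot\,|\,\pi^\ell_{\rm TS})\otimes\mathbb P_\ell(\mathcal H_{\ell,H}\in\cdot\,|\,\pi^\ell_{\rm TS})\big)\Big].$$ **Lemma.** For every $\ell\ge1$ and almost every $\mathcal D_\ell$, $$\mathbb I^{\pi^\ell_{\rm TS}}_\ell(\tilde{\mathcal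 E}^*_\ell;\mathcal H_{\ell,H})=\sum_{h=1}^H\mathbb E_\ell\Big[\mathbb E^{\bar{\mathcal E}_\ell}_{\pi^\ell_{\rm TS}}\Big[D_{\rm KL}\big((P_h^{\tilde{\mathcal E}^*_\ell}\otimes r_h^{\tilde{\mathcal E}^*_\ell})(\cdot|s_h,a_h)\,\big\|\,(P_h^{\bar{\mathcal E}_\ell}\otimes r_h^{\bar{\mathcal E}_\ell})(\cdot|s_h,a_h)\big)\Big]\Big],$$ where the inner expectation is over $(s_h,a_h)$ distributed according to the occupancy measure of $\pi^\ell_{\rm TS}$ in $\bar{\mathcal E}_\ell$, and the outer one over the independent pair $(\pi^\ell_{\rm TS},\tilde{\mathcal E}^*_\ell)$. If instead the histories (in $\mathcal D_\ell$ and in $\mathcal H_{\ell,H}$) do not record the terminal state $s_{H+1}$, the same identity holds with the transition kernels omitted from the term $h=H$, which then is $D_{\rm KL}(r_H^{\tilde{\mathcal E}^*_\ell}(\cdot|s_H,a_H)\|r_H^{\bar{\mathcal E}_\ell}(\cdot|s_H,a_H))$. As a special case, if the rewards are deterministic in the sense that the reward kernels are not random (each $r_h$ is the same kernel for $\rho^R_h$-almost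 every parameter, e.g. a known point mass), then $$\mathbb I^{\pi^\ell_{\rm TS}}_\ell(\tilde{\mathcal E}^*_\ell;\mathcal H_{\ell,H})=\sum_{h=1}^H\mathbb E_\ell\Big[\mathbb E^{\bar{\mathcal E}_\ell}_{\pi^\ell_{\rm TS}}\Big[D_{\rm KL}\big(P_h^{\tilde{\mathcal E}^*_\ell}(\cdot|s_h,a_h)\,\big\|\,P_h^{\bar{\mathcal E}_\ell}(\cdot|s_h,a_h)\big)\Big]\Big],$$ with the term $h=H$ omitted if the terminal state is not recorded. -/

import Mathlib

open MeasureTheory ProbabilityTheory InformationTheory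
open scoped ENNReal

namespace BayesRL

section Environments

variable {S A : Type*} [MeasurableSpace S] [MeasurableSpace A] {H : ℕ}

/-- A finite-horizon environment with `H` layers: Markov transition kernels
`P_h(· | s, a)` and reward kernels `r_h(· | s, a)` on `[0, 1]`.
Layers are numbered `0, …, H - 1`. -/
structure Env (S A : Type*) [MeasurableSpace S] [MeasurableSpace A] (H : ℕ) where
  trans : Fin H → Kernel (S × A) S
  rew : Fin H → Kernel (S × A) unitInterval
  trans_markov : ∀ h, IsMarkovKernel (trans h)
  rew_markov : ∀ h, IsMarkovKernel (rew h)

attribute [instance] Env.trans_markov Env.rew_markov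

/-- The surrogate environment below takes finitely many values, and the mutual information of a
finitely valued random variable is the one for the discrete σ-algebra on its values. -/
instance : MeasurableSpace (Env S A H) := ⊤

/-- A stationary policy: the law of the action depends on the layer and the current state. -/
structure Policy (S A : Type*) [MeasurableSpace S] [MeasurableSpace A] (H : ℕ) where
  act : Fin H → Kernel S A
  act_markov : ∀ h, IsMarkovKernel (act h)

attribute [instance] Policy.act_markov

/-- The value of policy `π` in environment `E` when `k` layers remain to be played. -/
noncomputable def valueToGo (E : Env S A H) (π : Policy S A H) : (k : ℕ) → k ≤ H → S → ℝ
  | 0, _ => fun _ => 0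
  | k + 1, hk => fun s =>
      ∫ a, ((∫ x, (x : ℝ) ∂(E.rew ⟨H - (k + 1), by omega⟩ (s, a)))
        + ∫ s', valueToGo E π k (by omega) s' ∂(E.trans ⟨H - (k + 1), by omega⟩ (s, a)))
        ∂(π.act ⟨H - (k + 1), by omega⟩ s)

/-- The value function `V_{h, π}^E`; the first layer is `h = 0`. -/
noncomputable def value (E : Env S A H) (π : Policy S A H) (h : ℕ) (s : S) : ℝ :=
  valueToGo E π (H - h) (Nat.sub_le H h) s

end Environments

section Trajectories

variable {Z S A : Type*} [MeasurableSpace Z] [MeasurableSpace S] [MeasurableSpace A] {H : ℕ}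

/-- `n` consecutive triples (state, action, reward). -/
abbrev Prefix (S A : Type*) (n : ℕ) : Type _ := Fin n → S × A × unitInterval

/-- A full episode: the triples `(s_h, a_h, r_h)` of all `H` layers, and the terminal state
`s_{H+1}`. -/
abbrev Traj (S A : Type*) (H : ℕ) : Type _ := Prefix S A H × S

theorem measurable_snoc {X : Type*} [MeasurableSpace X] (n : ℕ) :
    Measurable fun p : (Fin n → X) × X => (Fin.snoc p.1 p.2 : Fin (n + 1) → X) := by
  refine measurable_pi_iff.2 fun i => ?_
  refine Fin.lastCases ?_ (fun j => ?_) i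
  · simpa using measurable_snd
  · simp only [Fin.snoc_castSucc]
    exact (measurable_pi_apply j).comp measurable_fst

/-- Append a triple `(s, a, r)` to the past and move to the new state `s'`. -/
def extend {n : ℕ} (q : (Z × (Prefix S A n × S)) × (A × (unitInterval × S))) :
    Prefix S A (n + 1) × S :=
  (Fin.snoc q.1.2.1 (q.1.2.2, q.2.1, q.2.2.1), q.2.2.2)

theorem measurable_extend (n : ℕ) :
    Measurable (extend : (Z × (Prefix S A n × S)) × (A × (unitInterval × S)) → _) := by
  refine Measurable.prodMk ?_ (by fun_prop)
  exact (measurable_snoc n).comp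
    (g := fun p : Prefix S A n × (S × A × unitInterval) => (Fin.snoc p.1 p.2 : Prefix S A (n + 1)))
    (f := fun q : (Z × (Prefix S A n × S)) × (A × (unitInterval × S)) =>
      (q.1.2.1, (q.1.2.2, q.2.1, q.2.2.1))) (by fun_prop)

/-- One layer of interaction.  Given the parameter `z`, the past and the current state `s`:
draw `a ∼ π(· | z, s)`, then independently `r ∼ R(· | z, s, a)` and `s' ∼ P(· | z, s, a)`;
append `(s, a, r)` to the past and move to `s'`. -/
noncomputable def stepKernel (P : Kernel (Z × (S × A)) S) (R : Kernel (Z × (S × A)) unitInterval)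
    (π : Kernel (Z × S) A) (n : ℕ) :
    Kernel (Z × (Prefix S A n × S)) (Prefix S A (n + 1) × S) :=
  (Kernel.id ×ₖ
    (π.comap (fun q : Z × (Prefix S A n × S) => (q.1, q.2.2)) (by fun_prop) ⊗ₖ
      (R ×ₖ P).comap (fun q : (Z × (Prefix S A n × S)) × A => (q.1.1, (q.1.2.2, q.2)))
        (by fun_prop))).map extend

instance (P : Kernel (Z × (S × A)) S) (R : Kernel (Z × (S × A)) unitInterval)
    (π : Kernel (Z × S) A) (n : ℕ) [IsMarkovKernel P] [IsMarkovKernel R] [IsMarkovKernel π] :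
    IsMarkovKernel (stepKernel P R π n) :=
  Kernel.IsMarkovKernel.map _ (measurable_extend n)

/-- The law of the first `n` layers together with the state reached after them, as a kernel in a
parameter `z` on which the environment and the policy may depend. -/
noncomputable def prefixKernel (P : Fin H → Kernel (Z × (S × A)) S)
    (R : Fin H → Kernel (Z × (S × A)) unitInterval) (π : Fin H → Kernel (Z × S) A) (s₁ : S) :
    (n : ℕ) → n ≤ H → Kernel Z (Prefix S A n × S)
  | 0, _ => Kernel.const Z (Measure.dirac (Fin.elim0, s₁))
  | n + 1, hn =>
      Kernel.snd (prefixKernel P R π s₁ n (by omega) ⊗ₖ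
        stepKernel (P ⟨n, hn⟩) (R ⟨n, hn⟩) (π ⟨n, hn⟩) n)

/-- The law of a full episode that starts at `s₁`. -/
noncomputable def trajKernel (P : Fin H → Kernel (Z × (S × A)) S)
    (R : Fin H → Kernel (Z × (S × A)) unitInterval) (π : Fin H → Kernel (Z × S) A) (s₁ : S) :
    Kernel Z (Traj S A H) :=
  prefixKernel P R π s₁ H le_rfl

instance (P : Fin H → Kernel (Z × (S × A)) S) (R : Fin H → Kernel (Z × (S × A)) unitInterval)
    (π : Fin H → Kernel (Z × S) A) (s₁ : S) [∀ h, IsMarkovKernel (P h)]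
    [∀ h, IsMarkovKernel (R h)] [∀ h, IsMarkovKernel (π h)] (n : ℕ) (hn : n ≤ H) :
    IsMarkovKernel (prefixKernel P R π s₁ n hn) := by
  induction n with
  | zero => unfold prefixKernel; infer_instance
  | succ n ih =>
      have := ih (by omega)
      unfold prefixKernel
      infer_instance

instance (P : Fin H → Kernel (Z × (S × A)) S) (R : Fin H → Kernel (Z × (S × A)) unitInterval)
    (π : Fin H → Kernel (Z × S) A) (s₁ : S) [∀ h, IsMarkovKernel (P h)]
    [∀ h, IsMarkovKernel (R h)] [∀ h, IsMarkovKernel (π h)] :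
    IsMarkovKernel (trajKernel P R π s₁) := by
  unfold trajKernel
  infer_instance

end Trajectories

section Models

variable {S A : Type*} [MeasurableSpace S] [MeasurableSpace A] {H : ℕ}

/-- The parameter space `Θ = ∏_h Θ_h^P × ∏_h Θ_h^R` of all environments. -/
abbrev Param {H : ℕ} (ΘP ΘR : Fin H → Type*) : Type _ := (∀ h, ΘP h) × (∀ h, ΘR h)

/-- A Bayesian RL problem: spaces `Θ_h^P`, `Θ_h^R` of transition and of reward kernels of
layer `h`, a prior on each of them, and the initial state. -/
structure Model (S A : Type*) [MeasurableSpace S] [MeasurableSpace A] {H : ℕ}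
    (ΘP ΘR : Fin H → Type*) [∀ h, MeasurableSpace (ΘP h)] [∀ h, MeasurableSpace (ΘR h)] where
  trans : ∀ h, Kernel (ΘP h × (S × A)) S
  rew : ∀ h, Kernel (ΘR h × (S × A)) unitInterval
  priorP : ∀ h, Measure (ΘP h)
  priorR : ∀ h, Measure (ΘR h)
  s₁ : S
  trans_markov : ∀ h, IsMarkovKernel (trans h)
  rew_markov : ∀ h, IsMarkovKernel (rew h)
  priorP_prob : ∀ h, IsProbabilityMeasure (priorP h)
  priorR_prob : ∀ h, IsProbabilityMeasure (priorR h)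

attribute [instance] Model.trans_markov Model.rew_markov Model.priorP_prob Model.priorR_prob

variable {ΘP ΘR : Fin H → Type*} [∀ h, MeasurableSpace (ΘP h)] [∀ h, MeasurableSpace (ΘR h)]

namespace Model

variable (M : Model S A ΘP ΘR)

/-- The prior `ρ = ρ^P ⊗ ρ^R`: all layers, transitions and rewards are independent. -/
noncomputable def prior : Measure (Param ΘP ΘR) :=
  (Measure.pi M.priorP).prod (Measure.pi M.priorR)

instance : IsProbabilityMeasure M.prior := by
  unfold prior
  infer_instance

/-- `(θ, s, a) ↦ P_h^θ(· | s, a)`. -/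
noncomputable def transΘ (h : Fin H) : Kernel (Param ΘP ΘR × (S × A)) S :=
  (M.trans h).comap (fun z => (z.1.1 h, z.2)) (by fun_prop)

/-- `(θ, s, a) ↦ r_h^θ(· | s, a)`. -/
noncomputable def rewΘ (h : Fin H) : Kernel (Param ΘP ΘR × (S × A)) unitInterval :=
  (M.rew h).comap (fun z => (z.1.2 h, z.2)) (by fun_prop)

instance (h : Fin H) : IsMarkovKernel (M.transΘ h) := by
  unfold transΘ
  infer_instance

instance (h : Fin H) : IsMarkovKernel (M.rewΘ h) := by
  unfold rewΘ
  infer_instance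

/-- The environment with parameter `θ`. -/
noncomputable def env (θ : Param ΘP ΘR) : Env S A H where
  trans h := (M.transΘ h).sectR θ
  rew h := (M.rewΘ h).sectR θ
  trans_markov _ := inferInstance
  rew_markov _ := inferInstance

/-- The mean environment under a law `ν` on the environments:
its kernels are `∫ P_h^θ(· | s, a) dν(θ)` and `∫ r_h^θ(· | s, a) dν(θ)`. -/
noncomputable def meanEnv (ν : Measure (Param ΘP ΘR)) [IsProbabilityMeasure ν] : Env S A H where
  trans h := M.transΘ h ∘ₖ (Kernel.const (S × A) ν ×ₖ Kernel.id)
  rew h := M.rewΘ h ∘ₖ (Kernel.const (S × A) ν ×ₖ Kernel.id)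
  trans_markov _ := inferInstance
  rew_markov _ := inferInstance

theorem meanEnv_trans_apply (ν : Measure (Param ΘP ΘR)) [IsProbabilityMeasure ν] (h : Fin H)
    (x : S × A) {B : Set S} (hB : MeasurableSet B) :
    (M.meanEnv ν).trans h x B = ∫⁻ θ, (M.env θ).trans h x B ∂ν := by
  have hm : Measurable fun z => M.transΘ h z B := Kernel.measurable_coe _ hB
  simp only [meanEnv, env, Kernel.sectR_apply]
  rw [Kernel.comp_apply' _ _ _ hB, Kernel.prod_apply, Kernel.const_apply, Kernel.id_apply,
    lintegral_prod _ hm.aemeasurable]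
  refine lintegral_congr fun θ => ?_
  rw [lintegral_dirac' _ (by fun_prop)]

/-- A measurable choice `θ ↦ π*_θ` of a policy in `Pi` that is optimal, within `Pi`, for the
environment `θ` from every layer and every state. -/
structure OptimalSelector (Pi : Set (Policy S A H)) where
  sel : Param ΘP ΘR → Policy S A H
  measurable_sel : ∀ h, Measurable fun q : Param ΘP ΘR × S => (sel q.1).act h q.2
  sel_mem : ∀ θ, sel θ ∈ Pi
  optimal : ∀ θ, ∀ π ∈ Pi, ∀ (h : Fin H) (s : S),
    value (M.env θ) π h s ≤ value (M.env θ) (sel θ) h s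

variable {M} {Pi : Set (Policy S A H)} (σ : M.OptimalSelector Pi)

/-- `(θ, s) ↦ π*_θ(· | s)` at layer `h`. -/
noncomputable def OptimalSelector.kernel (h : Fin H) : Kernel (Param ΘP ΘR × S) A where
  toFun q := (σ.sel q.1).act h q.2
  measurable' := σ.measurable_sel h

instance (h : Fin H) : IsMarkovKernel (σ.kernel h) :=
  ⟨fun q => inferInstanceAs (IsProbabilityMeasure ((σ.sel q.1).act h q.2))⟩

/-- The law of an episode in the environment `θ` under the policy `π*_{θ'}`, as a kernel in
`(θ, θ')`. -/
noncomputable def episode : Kernel (Param ΘP ΘR × Param ΘP ΘR) (Traj S A H) :=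
  trajKernel (fun h => (M.transΘ h).comap (fun z => (z.1.1, z.2)) (by fun_prop))
    (fun h => (M.rewΘ h).comap (fun z => (z.1.1, z.2)) (by fun_prop))
    (fun h => (σ.kernel h).comap (fun z => (z.1.2, z.2)) (by fun_prop)) M.s₁

instance : IsMarkovKernel (episode σ) := by
  unfold episode
  infer_instance

/-- The law of an episode in a fixed environment `E` under the policy `π*_{θ'}`, as a kernel in
`θ'`. -/
noncomputable def episodeIn (E : Env S A H) : Kernel (Param ΘP ΘR) (Traj S A H) :=
  trajKernel (fun h => (E.trans h).prodMkLeft (Param ΘP ΘR))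
    (fun h => (E.rew h).prodMkLeft (Param ΘP ΘR)) σ.kernel M.s₁

/-- The occupancy measure: the law of `(s_h, a_h)` in the environment `E` under `π*_{θ'}`. -/
noncomputable def occupancy (E : Env S A H) (θ' : Param ΘP ΘR) (h : Fin H) : Measure (S × A) :=
  (episodeIn σ E θ').map fun w => ((w.1 h).1, (w.1 h).2.1)

/-- The law of the recorded history `obs (s_1, a_1, r_1, …)` of an episode in the environment `θ`
under `π*_{θ'}`, as a kernel in `(θ, θ')`. -/
noncomputable def record {O : Type*} [MeasurableSpace O] (obs : Traj S A H → O)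
    (hobs : Measurable obs) : Kernel (Param ΘP ΘR × Param ΘP ΘR) O :=
  Kernel.deterministic obs hobs ∘ₖ episode σ

instance {O : Type*} [MeasurableSpace O] (obs : Traj S A H → O) (hobs : Measurable obs) :
    IsMarkovKernel (record σ obs hobs) := by
  unfold record
  infer_instance

section ThompsonSampling

variable [∀ h, StandardBorelSpace (ΘP h)] [∀ h, StandardBorelSpace (ΘR h)]
  [∀ h, Nonempty (ΘP h)] [∀ h, Nonempty (ΘR h)]
  {O : Type*} [MeasurableSpace O] (obs : Traj S A H → O) (hobs : Measurable obs)

/-- Thompson sampling: given the data `D` of the past episodes and the kernel `κ` of their law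
given the true environment `θ`, draw `θ'` from the posterior given `D`, independently of `θ`, and
play `π*_{θ'}` in `θ` for one episode.  This is the law of the record of that episode. -/
noncomputable def nextRecord {X : Type*} [MeasurableSpace X]
    (κ : Kernel (Param ΘP ΘR) X) [IsMarkovKernel κ] : Kernel (Param ΘP ΘR × X) O :=
  Kernel.snd ((posterior κ M.prior).prodMkLeft (Param ΘP ΘR) ⊗ₖ
    (record σ obs hobs).comap (fun q : (Param ΘP ΘR × X) × Param ΘP ΘR => (q.1.1, q.2))
      (by fun_prop))

instance {X : Type*} [MeasurableSpace X] (κ : Kernel (Param ΘP ΘR) X) [IsMarkovKernel κ] :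
    IsMarkovKernel (nextRecord σ obs hobs κ) := by
  unfold nextRecord
  infer_instance

/-- The law of the data of the first `n` episodes of Thompson sampling given the true environment,
bundled with the proof that it is a Markov kernel. -/
noncomputable def dataAux :
    (n : ℕ) → {κ : Kernel (Param ΘP ΘR) (Fin n → O) // IsMarkovKernel κ}
  | 0 => ⟨Kernel.const _ (Measure.dirac Fin.elim0), inferInstance⟩
  | n + 1 =>
      haveI := (dataAux n).2
      ⟨((dataAux n).1 ⊗ₖ nextRecord σ obs hobs (dataAux n).1).map
          (fun p => (Fin.snoc p.1 p.2 : Fin (n + 1) → O)),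
        Kernel.IsMarkovKernel.map _ (measurable_snoc n)⟩

/-- The law of the data `D` of the first `n` episodes given the true environment. -/
noncomputable def data (n : ℕ) : Kernel (Param ΘP ΘR) (Fin n → O) := (dataAux σ obs hobs n).1

instance (n : ℕ) : IsMarkovKernel (data σ obs hobs n) := (dataAux σ obs hobs n).2

/-- The unconditional law of the data of the first `n` episodes. -/
noncomputable def dataLaw (n : ℕ) : Measure (Fin n → O) := M.prior.bind (data σ obs hobs n)

/-- The posterior law `P_ℓ` of the environment given the data of `n = ℓ - 1` episodes. -/
noncomputable def post (n : ℕ) (D : Fin n → O) : Measure (Param ΘP ΘR) :=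
  posterior (data σ obs hobs n) M.prior D

instance (n : ℕ) (D : Fin n → O) : IsProbabilityMeasure (post σ obs hobs n D) := by
  unfold post
  infer_instance

end ThompsonSampling

/-- A layered `ε`-value partition of the environments into the cells `{ζ = k}`, `k < K`. -/
structure IsLayeredValuePartition (ε : ℝ) {K : ℕ} (ζ : Param ΘP ΘR → Fin K) : Prop where
  measurable : Measurable ζ
  value_le : ∀ θ θ', ζ θ = ζ θ' →
    value (M.env θ) (σ.sel θ) 0 M.s₁ - value (M.env θ') (σ.sel θ) 0 M.s₁ ≤ ε
  /-- The cell of an environment amounts to a choice of one cell of `Θ_h^P × Θ_h^R` in each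
  layer `h`. -/
  layered : ∃ c : ∀ h, ΘP h × ΘR h → ℕ, (∀ h, Measurable (c h)) ∧
    ∀ θ θ', ζ θ = ζ θ' ↔ ∀ h, c h (θ.1 h, θ.2 h) = c h (θ'.1 h, θ'.2 h)
  /-- Conditionally on the cell, the layers are independent. -/
  indep_layers : ∀ k, M.prior (ζ ⁻¹' {k}) ≠ 0 →
    iIndepFun (fun h θ => (θ.1 h, θ.2 h)) (M.prior[|ζ ⁻¹' {k}])
  /-- Conditionally on the cell, transition and reward of a layer are independent. -/
  indep_rew : ∀ k, M.prior (ζ ⁻¹' {k}) ≠ 0 →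
    ∀ h, IndepFun (fun θ => θ.1 h) (fun θ => θ.2 h) (M.prior[|ζ ⁻¹' {k}])

open Classical in
/-- The surrogate environment of the cell `k`: the mean environment under the posterior `ν`
conditioned on the cell.  On a cell that is null for `ν` its value plays no role. -/
noncomputable def cellEnv (M : Model S A ΘP ΘR) (ν : Measure (Param ΘP ΘR))
    [IsProbabilityMeasure ν] {K : ℕ} (ζ : Param ΘP ΘR → Fin K) (k : Fin K) : Env S A H :=
  if hk : ν (ζ ⁻¹' {k}) ≠ 0 then
    haveI := cond_isProbabilityMeasure hk
    M.meanEnv (ν[|ζ ⁻¹' {k}])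
  else M.meanEnv ν

/-- The surrogate environment as a random variable: the surrogate of the cell of the true
environment. -/
noncomputable def surrogate (M : Model S A ΘP ΘR) (ν : Measure (Param ΘP ΘR))
    [IsProbabilityMeasure ν] {K : ℕ} (ζ : Param ΘP ΘR → Fin K) (θ : Param ΘP ΘR) : Env S A H :=
  cellEnv M ν ζ (ζ θ)

/-- Given a law `ν` of the true environment `θ` and the policy `π*_{θ'}`, the joint law of the
surrogate environment and of the record of an episode of `π*_{θ'}` in the true environment. -/
noncomputable def jointLaw {O : Type*} [MeasurableSpace O] (obs : Traj S A H → O)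
    (hobs : Measurable obs) (ν : Measure (Param ΘP ΘR)) [IsProbabilityMeasure ν] {K : ℕ}
    (ζ : Param ΘP ΘR → Fin K) (θ' : Param ΘP ΘR) : Measure (Env S A H × O) :=
  (ν ⊗ₘ (record σ obs hobs).sectL θ').map fun p => (surrogate M ν ζ p.1, p.2)

end Model

end Models

/-- The mutual information of two random variables with joint law `J`. -/
noncomputable def mutualInfo {X Y : Type*} [MeasurableSpace X] [MeasurableSpace Y]
    (J : Measure (X × Y)) : ℝ≥0∞ :=
  klDiv J (J.fst.prod J.snd)

namespace Model

variable {S A : Type*} [MeasurableSpace S] [MeasurableSpace A] {H : ℕ}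
  {ΘP ΘR : Fin H → Type*} [∀ h, MeasurableSpace (ΘP h)] [∀ h, MeasurableSpace (ΘR h)]
  {M : Model S A ΘP ΘR} {Pi : Set (Policy S A H)} (σ : M.OptimalSelector Pi)

/-- The mutual information of the surrogate environment and the record of the episode conditional
on the Thompson sampling policy: the true environment `θ` and the sample `θ'` that determines the
policy `π*_{θ'}` are independent with law `ν`. -/
noncomputable def tsMutualInfo {O : Type*} [MeasurableSpace O] (obs : Traj S A H → O)
    (hobs : Measurable obs) (ν : Measure (Param ΘP ΘR)) [IsProbabilityMeasure ν] {K : ℕ}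
    (ζ : Param ΘP ΘR → Fin K) : ℝ≥0∞ :=
  ∫⁻ θ', mutualInfo (jointLaw σ obs hobs ν ζ θ') ∂ν

/-- `E_ℓ E_{π_TS}^{mean MDP} [f(surrogate environment, s_h, a_h)]`: the true environment `θ`, which
determines the surrogate, and the sample `θ'` that determines the policy are independent with
law `ν`, and `(s_h, a_h)` follows the occupancy measure of `π*_{θ'}` in the mean environment. -/
noncomputable def tsExpect (ν : Measure (Param ΘP ΘR)) [IsProbabilityMeasure ν] {K : ℕ}
    (ζ : Param ΘP ΘR → Fin K) (h : Fin H) (f : Env S A H → S × A → ℝ≥0∞) : ℝ≥0∞ :=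
  ∫⁻ θ, ∫⁻ θ', ∫⁻ x, f (surrogate M ν ζ θ) x ∂(occupancy σ (M.meanEnv ν) θ' h) ∂ν ∂ν

end Model

end BayesRL

/-! Fix the data and let `ν` be the posterior. The true parameter `θ` and the Thompson sample `θ'`
are independent with law `ν`, so `θ'` can be frozen and the identity proved for each policy
separately. Everything rests on one property, `CoordIndep`: each single parameter (transition or
reward of one layer) is independent of all the others. It is needed for `ν` and for `ν` conditioned
on each cell of positive mass.

Why the posterior has it: the prior is a product, and the prior conditioned on a cell has the
property by the assumptions on the partition. Data do not destroy it. Split the parameters into one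
coordinate `f θ` and the rest `g θ`. Every draw of an episode (action, reward, next state) has a law
that, given what is already visible, depends only on `f θ` or only on `(g θ, θ')`, so `f θ` and `(g
θ, θ')` stay conditionally independent given the observations (`CondIndepGiven.observe`). The sample
`θ'` depends on `θ` only through the data, so it can be adjoined and later forgotten. No densities
of the likelihood are used; the updates are disintegrations, and uniqueness of disintegrations
transfers the result to almost every posterior (`ae_post_coordIndep`).

Why it suffices: each layer is visited once per episode, so under `CoordIndep` the average of the
episode law over `ν` is the episode law in the mean environment (`lintegral_prefixOf`). Applied
inside a cell, this says that the record given the surrogate is an episode in the surrogate; applied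
to `ν`, that its marginal is an episode in the mean environment. The mutual information is therefore
the average divergence between these two laws (`mutualInfo_jointLaw`), and the chain rule splits it
over layers (`klDiv_prefixKernel`).

The chain rule integrates over the occupancy measure of the surrogate, not of the mean environment.
For a layered partition the layer-`h` kernels of the surrogate are functions of the label of layer
`h`, whereas the law of the past depends on the labels of earlier layers. Labels of different layers
are independent under `ν`, so the past can be averaged separately, which turns its law into that of
the mean environment (`lintegral_occupancy_surrogate`). -/

namespace BayesRL

/-! ### Kullback-Leibler divergence: measurability in a parameter and the conditional form -/

section KullbackLeibler

variable {X Y : Type*} [MeasurableSpace X] [MeasurableSpace Y]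

theorem countablyGenerated_iSup {ι : Type*} [Countable ι] {Z : Type*} {m : ι → MeasurableSpace Z}
    (h : ∀ i, @MeasurableSpace.CountablyGenerated Z (m i)) :
    @MeasurableSpace.CountablyGenerated Z (⨆ i, m i) := by
  choose b hb hm using fun i => (h i).isCountablyGenerated
  refine @MeasurableSpace.CountablyGenerated.mk Z (⨆ i, m i) ⟨⋃ i, b i, Set.countable_iUnion hb, ?_⟩
  rw [← MeasurableSpace.iSup_generateFrom]
  exact iSup_congr hm

/-- A history is a finite product of states, actions and rewards; this makes the space of records
countably generated, as the conditional divergence formula requires. -/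
instance countablyGenerated_pi {ι : Type*} [Countable ι] {Z : ι → Type*}
    [∀ i, MeasurableSpace (Z i)] [∀ i, MeasurableSpace.CountablyGenerated (Z i)] :
    MeasurableSpace.CountablyGenerated (∀ i, Z i) :=
  countablyGenerated_iSup fun i => MeasurableSpace.CountablyGenerated.comap (fun z : ∀ i, Z i => z i)

/-- The Kullback-Leibler divergence is invariant under maps with a measurable left inverse. -/
theorem klDiv_map_of_leftInverse (μ ν : Measure X) [IsFiniteMeasure μ] [IsFiniteMeasure ν]
    {φ : X → Y} {ψ : Y → X} (hφ : Measurable φ) (hψ : Measurable ψ)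
    (h : Function.LeftInverse ψ φ) : klDiv (μ.map φ) (ν.map φ) = klDiv μ ν := by
  refine le_antisymm (klDiv_map_le μ ν hφ) ?_
  have := klDiv_map_le (μ.map φ) (ν.map φ) hψ
  rwa [Measure.map_map hψ hφ, Measure.map_map hψ hφ, h.comp_eq_id, Measure.map_id,
    Measure.map_id] at this

theorem measurable_ofReal_klFun_rnDeriv [MeasurableSpace.CountableOrCountablyGenerated X Y]
    (κ η : Kernel X Y) [IsFiniteKernel κ] [IsFiniteKernel η] :
    Measurable fun p : X × Y => ENNReal.ofReal (klFun (Kernel.rnDeriv κ η p.1 p.2).toReal) :=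
  (measurable_klFun.comp (Kernel.measurable_rnDeriv κ η).ennreal_toReal).ennreal_ofReal

theorem klDiv_eq_ite_lintegral_kernel_rnDeriv [MeasurableSpace.CountableOrCountablyGenerated X Y]
    (κ η : Kernel X Y) [IsFiniteKernel κ] [IsFiniteKernel η] (x : X) [Decidable (κ x ≪ η x)] :
    klDiv (κ x) (η x) = if κ x ≪ η x then
      ∫⁻ y, ENNReal.ofReal (klFun (Kernel.rnDeriv κ η x y).toReal) ∂(η x) else ∞ := by
  rw [klDiv_eq_lintegral_klFun]
  split_ifs with h
  · refine lintegral_congr_ae ?_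
    filter_upwards [Kernel.rnDeriv_eq_rnDeriv_measure (κ := κ) (η := η) (a := x)] with y hy
    rw [hy]
  · rfl

/-- Countable generation provides a density `Kernel.rnDeriv κ η` that is jointly measurable in both
variables. The divergence is an integral of it on the measurable set where `κ x ≪ η x`, and infinite
elsewhere. -/
theorem measurable_klDiv_kernel [MeasurableSpace.CountableOrCountablyGenerated X Y]
    (κ η : Kernel X Y) [IsFiniteKernel κ] [IsFiniteKernel η] :
    Measurable fun x => klDiv (κ x) (η x) := by
  classical
  simp_rw [klDiv_eq_ite_lintegral_kernel_rnDeriv κ η]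
  exact Measurable.ite (Kernel.measurableSet_absolutelyContinuous κ η)
    (measurable_ofReal_klFun_rnDeriv κ η).lintegral_kernel_prod_right' measurable_const

/-- The conditional Kullback-Leibler divergence in integral form. -/
theorem klDiv_compProd_right_eq_lintegral [MeasurableSpace.CountableOrCountablyGenerated X Y]
    (μ : Measure X) [IsFiniteMeasure μ] (κ η : Kernel X Y) [IsMarkovKernel κ] [IsMarkovKernel η] :
    klDiv (μ ⊗ₘ κ) (μ ⊗ₘ η) = ∫⁻ x, klDiv (κ x) (η x) ∂μ := by
  classical
  by_cases hac : ∀ᵐ x ∂μ, κ x ≪ η x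
  · have hac' : μ ⊗ₘ κ ≪ μ ⊗ₘ η := Measure.absolutelyContinuous_compProd_right_iff.2 hac
    rw [klDiv_eq_lintegral_klFun_of_ac hac']
    have hfin : IsFiniteKernel (η.withDensity (Kernel.rnDeriv κ η)) := by
      infer_instance
    -- The fibrewise density is also the density of the joint laws.
    have hd : μ ⊗ₘ κ = (μ ⊗ₘ η).withDensity fun p => Kernel.rnDeriv κ η p.1 p.2 := by
      rw [← Measure.compProd_withDensity (Kernel.measurable_rnDeriv κ η)]
      refine Measure.compProd_congr ?_
      filter_upwards [hac] with x hx
      rw [Kernel.withDensity_rnDeriv_eq hx]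
    have hrn : (μ ⊗ₘ κ).rnDeriv (μ ⊗ₘ η) =ᵐ[μ ⊗ₘ η] fun p => Kernel.rnDeriv κ η p.1 p.2 := by
      rw [hd]
      exact Measure.rnDeriv_withDensity _ (Kernel.measurable_rnDeriv κ η)
    have h1 : ∫⁻ p, ENNReal.ofReal (klFun ((μ ⊗ₘ κ).rnDeriv (μ ⊗ₘ η) p).toReal) ∂(μ ⊗ₘ η)
        = ∫⁻ p, ENNReal.ofReal (klFun (Kernel.rnDeriv κ η p.1 p.2).toReal) ∂(μ ⊗ₘ η) := by
      refine lintegral_congr_ae ?_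
      filter_upwards [hrn] with p hp
      rw [hp]
    rw [h1, Measure.lintegral_compProd (measurable_ofReal_klFun_rnDeriv κ η)]
    refine lintegral_congr_ae ?_
    filter_upwards [hac] with x hx
    rw [klDiv_eq_ite_lintegral_kernel_rnDeriv κ η, if_pos hx]
  -- Both sides are infinite here: a finite integral of the divergences would make them finite,
  -- hence `κ x ≪ η x`, for almost every `x`.
  · have hac' : ¬ μ ⊗ₘ κ ≪ μ ⊗ₘ η :=
      fun h => hac (Measure.absolutelyContinuous_compProd_right_iff.1 h)
    rw [klDiv_of_not_ac hac']
    symm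
    by_contra hne
    refine hac ?_
    filter_upwards [ae_lt_top (measurable_klDiv_kernel κ η) hne] with x hx
    by_contra hx'
    simp [klDiv_of_not_ac hx'] at hx

theorem klDiv_prod_swap {μ₁ ν₁ : Measure X} {μ₂ ν₂ : Measure Y} [IsFiniteMeasure μ₁]
    [IsFiniteMeasure ν₁] [IsFiniteMeasure μ₂] [IsFiniteMeasure ν₂] :
    klDiv (μ₂.prod μ₁) (ν₂.prod ν₁) = klDiv (μ₁.prod μ₂) (ν₁.prod ν₂) := by
  rw [← Measure.prod_swap, ← Measure.prod_swap (μ := ν₁)]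
  exact klDiv_map_of_leftInverse _ _ measurable_swap measurable_swap Prod.swap_leftInverse

theorem klDiv_prod_same_right {μ₁ ν₁ : Measure X} {μ₂ : Measure Y} [IsProbabilityMeasure μ₁]
    [IsProbabilityMeasure ν₁] [IsProbabilityMeasure μ₂] :
    klDiv (μ₁.prod μ₂) (ν₁.prod μ₂) = klDiv μ₁ ν₁ := by
  rw [← Measure.compProd_const, ← Measure.compProd_const, klDiv_compProd_left]

end KullbackLeibler

end BayesRL

/-! ### Episodes as iterated composition products -/

namespace BayesRL

section Trajectories

set_option linter.unusedSectionVars false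

variable {Z S A : Type*} [MeasurableSpace Z] [MeasurableSpace S] [MeasurableSpace A] {H : ℕ}

/-- Append a reward and a new state to a past, a state and an action. -/
def appendStep {n : ℕ} (q : ((Prefix S A n × S) × A) × (unitInterval × S)) :
    Prefix S A (n + 1) × S :=
  (Fin.snoc q.1.1.1 (q.1.1.2, q.1.2, q.2.1), q.2.2)

/-- Append a reward to a past, a state and an action. -/
def appendReward {n : ℕ} (q : ((Prefix S A n × S) × A) × unitInterval) : Prefix S A (n + 1) :=
  Fin.snoc q.1.1.1 (q.1.1.2, q.1.2, q.2)

theorem measurable_appendReward (n : ℕ) :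
    Measurable (appendReward : ((Prefix S A n × S) × A) × unitInterval → _) :=
  (measurable_snoc n).comp
    (g := fun p : Prefix S A n × (S × A × unitInterval) => (Fin.snoc p.1 p.2 : Prefix S A (n + 1)))
    (f := fun q : ((Prefix S A n × S) × A) × unitInterval =>
      (q.1.1.1, (q.1.1.2, q.1.2, q.2))) (by fun_prop)

theorem measurable_appendStep (n : ℕ) :
    Measurable (appendStep : ((Prefix S A n × S) × A) × (unitInterval × S) → _) :=
  ((measurable_appendReward n).comp
    (f := fun q : ((Prefix S A n × S) × A) × (unitInterval × S) => (q.1, q.2.1))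
    (by fun_prop)).prodMk (by fun_prop)

/-- Remove the last triple from a past. -/
def splitReward {n : ℕ} (w : Prefix S A (n + 1)) : ((Prefix S A n × S) × A) × unitInterval :=
  (((Fin.init w, (w (Fin.last n)).1), (w (Fin.last n)).2.1), (w (Fin.last n)).2.2)

theorem measurable_splitReward (n : ℕ) :
    Measurable (splitReward : Prefix S A (n + 1) → _) := by
  unfold splitReward Fin.init
  fun_prop

theorem leftInverse_splitReward (n : ℕ) : Function.LeftInverse
    (splitReward : Prefix S A (n + 1) → _) appendReward := by
  intro q
  simp [splitReward, appendReward]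

/-- Undo a step. -/
def splitStep {n : ℕ} (w : Prefix S A (n + 1) × S) :
    ((Prefix S A n × S) × A) × (unitInterval × S) :=
  ((splitReward w.1).1, ((splitReward w.1).2, w.2))

theorem measurable_splitStep (n : ℕ) :
    Measurable (splitStep : Prefix S A (n + 1) × S → _) := by
  have := measurable_splitReward (S := S) (A := A) n
  exact ((this.comp measurable_fst).fst).prodMk (((this.comp measurable_fst).snd).prodMk measurable_snd)

theorem leftInverse_splitStep (n : ℕ) : Function.LeftInverse
    (splitStep : Prefix S A (n + 1) × S → _) appendStep := by
  intro q
  simp [splitStep, splitReward, appendStep]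

variable (P : Fin H → Kernel (Z × (S × A)) S) (R : Fin H → Kernel (Z × (S × A)) unitInterval)
  (π : Fin H → Kernel (Z × S) A) (s₁ : S)

/-- The law of the action given the past. -/
noncomputable def actKernel (π : Kernel (Z × S) A) (z : Z) (n : ℕ) : Kernel (Prefix S A n × S) A :=
  π.comap (fun p => (z, p.2)) (by fun_prop)

/-- The law of the reward given the past. -/
noncomputable def rewKernel (R : Kernel (Z × (S × A)) unitInterval) (z : Z) (n : ℕ) :
    Kernel ((Prefix S A n × S) × A) unitInterval :=
  R.comap (fun p => (z, (p.1.2, p.2))) (by fun_prop)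

/-- The law of the next state given the past. -/
noncomputable def nextKernel (P : Kernel (Z × (S × A)) S) (z : Z) (n : ℕ) :
    Kernel ((Prefix S A n × S) × A) S :=
  P.comap (fun p => (z, (p.1.2, p.2))) (by fun_prop)

instance (π : Kernel (Z × S) A) [IsMarkovKernel π] (z : Z) (n : ℕ) :
    IsMarkovKernel (actKernel π z n) := by unfold actKernel; infer_instance

instance (R : Kernel (Z × (S × A)) unitInterval) [IsMarkovKernel R] (z : Z) (n : ℕ) :
    IsMarkovKernel (rewKernel R z n) := by unfold rewKernel; infer_instance

instance (P : Kernel (Z × (S × A)) S) [IsMarkovKernel P] (z : Z) (n : ℕ) :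
    IsMarkovKernel (nextKernel P z n) := by unfold nextKernel; infer_instance

variable [∀ h, IsMarkovKernel (P h)] [∀ h, IsMarkovKernel (R h)] [∀ h, IsMarkovKernel (π h)]

/-- For a fixed parameter the recursion becomes past, then action, then reward and next state, which
is the shape the chain rule needs. The repackaging `appendStep` has a measurable left inverse, so it
loses no information. -/
theorem prefixKernel_succ_apply (n : ℕ) (hn : n + 1 ≤ H) (z : Z) :
    prefixKernel P R π s₁ (n + 1) hn z =
      ((prefixKernel P R π s₁ n (by omega) z ⊗ₘ actKernel (π ⟨n, hn⟩) z n) ⊗ₘ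
        (rewKernel (R ⟨n, hn⟩) z n ×ₖ nextKernel (P ⟨n, hn⟩) z n)).map appendStep := by
  refine Measure.ext_of_lintegral _ fun F hF => ?_
  have hx := measurable_extend (Z := Z) (S := S) (A := A) n
  have ha := measurable_appendStep (S := S) (A := A) n
  have hFa : Measurable fun q : ((Prefix S A n × S) × A) × (unitInterval × S) =>
    F (appendStep q) := hF.comp ha
  rw [lintegral_map hF ha, Measure.lintegral_compProd hFa,
    Measure.lintegral_compProd hFa.lintegral_kernel_prod_right']
  rw [prefixKernel, Kernel.snd_apply, lintegral_map hF measurable_snd,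
    Kernel.lintegral_compProd _ _ _ (by fun_prop)]
  refine lintegral_congr fun p => ?_
  rw [stepKernel, Kernel.map_apply _ hx, lintegral_map (by fun_prop) hx,
    Kernel.prod_apply, Kernel.id_apply, Measure.dirac_prod,
    lintegral_map (by fun_prop) (by fun_prop), Kernel.lintegral_compProd _ _ _ (by fun_prop)]
  simp only [Kernel.comap_apply, Kernel.prod_apply, actKernel, rewKernel, nextKernel]
  rfl

theorem lintegral_prefixKernel_succ (n : ℕ) (hn : n + 1 ≤ H) (z : Z)
    {F : Prefix S A (n + 1) × S → ℝ≥0∞} (hF : Measurable F) :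
    ∫⁻ w, F w ∂(prefixKernel P R π s₁ (n + 1) hn z) =
      ∫⁻ p, ∫⁻ a, ∫⁻ r, ∫⁻ s', F (appendStep ((p, a), (r, s')))
        ∂(P ⟨n, hn⟩ (z, (p.2, a))) ∂(R ⟨n, hn⟩ (z, (p.2, a))) ∂(π ⟨n, hn⟩ (z, p.2))
        ∂(prefixKernel P R π s₁ n (by omega) z) := by
  have ha := measurable_appendStep (S := S) (A := A) n
  have hFa : Measurable fun q : ((Prefix S A n × S) × A) × (unitInterval × S) =>
    F (appendStep q) := hF.comp ha
  rw [prefixKernel_succ_apply, lintegral_map hF ha, Measure.lintegral_compProd hFa,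
    Measure.lintegral_compProd hFa.lintegral_kernel_prod_right']
  refine lintegral_congr fun p => lintegral_congr fun a => ?_
  rw [Kernel.prod_apply, lintegral_prod _ (by fun_prop)]
  rfl

theorem map_fst_prefixKernel_succ (n : ℕ) (hn : n + 1 ≤ H) (z : Z) :
    (prefixKernel P R π s₁ (n + 1) hn z).map Prod.fst =
      ((prefixKernel P R π s₁ n (by omega) z ⊗ₘ actKernel (π ⟨n, hn⟩) z n) ⊗ₘ
        rewKernel (R ⟨n, hn⟩) z n).map appendReward := by
  refine Measure.ext_of_lintegral _ fun F hF => ?_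
  have ha := measurable_appendReward (S := S) (A := A) n
  have hFa : Measurable fun q : ((Prefix S A n × S) × A) × unitInterval =>
    F (appendReward q) := hF.comp ha
  rw [lintegral_map hF measurable_fst, lintegral_prefixKernel_succ _ _ _ _ _ _ _ (by fun_prop),
    lintegral_map hF ha, Measure.lintegral_compProd hFa,
    Measure.lintegral_compProd hFa.lintegral_kernel_prod_right']
  refine lintegral_congr fun p => lintegral_congr fun a => lintegral_congr fun r => ?_
  simp [appendStep, appendReward]

theorem prefixKernel_zero_apply (z : Z) :
    prefixKernel P R π s₁ 0 (Nat.zero_le H) z = Measure.dirac (Fin.elim0, s₁) := by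
  rw [prefixKernel, Kernel.const_apply]

/-- The law of the first `n` layers depends only on the kernels of these layers. -/
theorem prefixKernel_congr {Z' : Type*} [MeasurableSpace Z'] {P' : Fin H → Kernel (Z' × (S × A)) S}
    {R' : Fin H → Kernel (Z' × (S × A)) unitInterval} {π' : Fin H → Kernel (Z' × S) A}
    [∀ h, IsMarkovKernel (P' h)] [∀ h, IsMarkovKernel (R' h)] [∀ h, IsMarkovKernel (π' h)]
    (z : Z) (z' : Z') (n : ℕ) (hn : n ≤ H)
    (hP : ∀ h : Fin H, (h : ℕ) < n → ∀ x, P h (z, x) = P' h (z', x))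
    (hR : ∀ h : Fin H, (h : ℕ) < n → ∀ x, R h (z, x) = R' h (z', x))
    (hπ : ∀ h : Fin H, (h : ℕ) < n → ∀ s, π h (z, s) = π' h (z', s)) :
    prefixKernel P R π s₁ n hn z = prefixKernel P' R' π' s₁ n hn z' := by
  induction n with
  | zero => rw [prefixKernel_zero_apply, prefixKernel_zero_apply]
  | succ n ih =>
      refine Measure.ext_of_lintegral _ fun F hF => ?_
      rw [lintegral_prefixKernel_succ _ _ _ _ _ _ _ hF,
        lintegral_prefixKernel_succ _ _ _ _ _ _ _ hF,
        ih (by omega) (fun h hh => hP h (by omega)) (fun h hh => hR h (by omega))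
          (fun h hh => hπ h (by omega))]
      have hlt : ((⟨n, hn⟩ : Fin H) : ℕ) < n + 1 := Nat.lt_succ_self n
      simp_rw [hP _ hlt, hR _ hlt, hπ _ hlt]

/-- The law of `(s_h, a_h)` does not depend on the layers after `h`. -/
theorem lintegral_stateAction_prefixKernel (z : Z) (h : Fin H) {F : S × A → ℝ≥0∞}
    (hF : Measurable F) (n : ℕ) (hn : n ≤ H) (hh : (h : ℕ) < n) :
    ∫⁻ w, F ((w.1 ⟨h, hh⟩).1, (w.1 ⟨h, hh⟩).2.1) ∂(prefixKernel P R π s₁ n hn z) =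
      ∫⁻ p, ∫⁻ a, F (p.2, a) ∂(π h (z, p.2))
        ∂(prefixKernel P R π s₁ (h : ℕ) h.2.le z) := by
  induction n with
  | zero => omega
  | succ n ih =>
      rw [lintegral_prefixKernel_succ _ _ _ _ _ _ _ (by fun_prop)]
      rcases Nat.lt_succ_iff_lt_or_eq.1 hh with hlt | heq
      · rw [← ih (by omega) hlt]
        refine lintegral_congr fun p => ?_
        have : ∀ a r s', (appendStep ((p, a), (r, s'))).1 ⟨h, hh⟩ = p.1 ⟨h, hlt⟩ := by
          intro a r s'
          exact Fin.snoc_castSucc (α := fun _ => S × A × unitInterval) (p.2, a, r) p.1 ⟨h, hlt⟩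
        simp [this]
      · subst heq
        have : ∀ (p : Prefix S A (h : ℕ) × S) a r s',
            (appendStep ((p, a), (r, s'))).1 ⟨h, hh⟩ = (p.2, a, r) := by
          intro p a r s'
          exact Fin.snoc_last (α := fun _ => S × A × unitInterval) (p.2, a, r) p.1
        simp [this]

end Trajectories

end BayesRL

/-! ### Chain rule for the divergence of two episode laws under a common policy -/

namespace BayesRL

section Trajectories

variable {Z S A : Type*} [MeasurableSpace Z] [MeasurableSpace S] [MeasurableSpace A] {H : ℕ}
  (P P' : Fin H → Kernel (Z × (S × A)) S) (R R' : Fin H → Kernel (Z × (S × A)) unitInterval)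
  (π : Fin H → Kernel (Z × S) A) (s₁ : S)
  [∀ h, IsMarkovKernel (P h)] [∀ h, IsMarkovKernel (R h)] [∀ h, IsMarkovKernel (P' h)]
  [∀ h, IsMarkovKernel (R' h)] [∀ h, IsMarkovKernel (π h)]

theorem klDiv_map_fst_prefixKernel_succ (n : ℕ) (hn : n + 1 ≤ H) (z : Z) :
    klDiv ((prefixKernel P R π s₁ (n + 1) hn z).map Prod.fst)
        ((prefixKernel P' R' π s₁ (n + 1) hn z).map Prod.fst) =
      klDiv (prefixKernel P R π s₁ n (by omega) z) (prefixKernel P' R' π s₁ n (by omega) z) +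
        ∫⁻ p, ∫⁻ a, klDiv (R ⟨n, hn⟩ (z, (p.2, a))) (R' ⟨n, hn⟩ (z, (p.2, a)))
          ∂(π ⟨n, hn⟩ (z, p.2)) ∂(prefixKernel P R π s₁ n (by omega) z) := by
  rw [map_fst_prefixKernel_succ, map_fst_prefixKernel_succ,
    klDiv_map_of_leftInverse _ _ (measurable_appendReward n) (measurable_splitReward n)
      (leftInverse_splitReward n),
    klDiv_compProd_eq_add, klDiv_compProd_left, klDiv_compProd_right_eq_lintegral,
    Measure.lintegral_compProd (measurable_klDiv_kernel _ _)]
  rfl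

/-- The action kernel is the same in both environments and contributes nothing; only the reward and
the next state do. Their divergence is averaged under the law of the first environment, which is why
the occupancy measure of the surrogate appears before that of the mean environment. -/
theorem klDiv_prefixKernel_succ [MeasurableSpace.CountablyGenerated S] (n : ℕ)
    (hn : n + 1 ≤ H) (z : Z) :
    klDiv (prefixKernel P R π s₁ (n + 1) hn z) (prefixKernel P' R' π s₁ (n + 1) hn z) =
      klDiv (prefixKernel P R π s₁ n (by omega) z) (prefixKernel P' R' π s₁ n (by omega) z) +
        ∫⁻ p, ∫⁻ a, klDiv ((P ⟨n, hn⟩ (z, (p.2, a))).prod (R ⟨n, hn⟩ (z, (p.2, a))))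
            ((P' ⟨n, hn⟩ (z, (p.2, a))).prod (R' ⟨n, hn⟩ (z, (p.2, a))))
          ∂(π ⟨n, hn⟩ (z, p.2)) ∂(prefixKernel P R π s₁ n (by omega) z) := by
  rw [prefixKernel_succ_apply, prefixKernel_succ_apply,
    klDiv_map_of_leftInverse _ _ (measurable_appendStep n) (measurable_splitStep n)
      (leftInverse_splitStep n),
    klDiv_compProd_eq_add, klDiv_compProd_left, klDiv_compProd_right_eq_lintegral,
    Measure.lintegral_compProd (measurable_klDiv_kernel _ _)]
  congr 1
  refine lintegral_congr fun p => lintegral_congr fun a => ?_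
  rw [Kernel.prod_apply, Kernel.prod_apply, klDiv_prod_swap]
  rfl

theorem klDiv_prefixKernel [MeasurableSpace.CountablyGenerated S] (n : ℕ) (hn : n ≤ H) (z : Z) :
    klDiv (prefixKernel P R π s₁ n hn z) (prefixKernel P' R' π s₁ n hn z) =
      ∑ h : Fin n, ∫⁻ p, ∫⁻ a, klDiv
            ((P (h.castLE hn) (z, (p.2, a))).prod (R (h.castLE hn) (z, (p.2, a))))
            ((P' (h.castLE hn) (z, (p.2, a))).prod (R' (h.castLE hn) (z, (p.2, a))))
          ∂(π (h.castLE hn) (z, p.2)) ∂(prefixKernel P R π s₁ h (h.2.le.trans hn) z) := by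
  induction n with
  | zero => simp [prefixKernel_zero_apply]
  | succ n ih =>
      rw [klDiv_prefixKernel_succ, ih (by omega), Fin.sum_univ_castSucc]
      rfl

end Trajectories

end BayesRL

/-! ### Conditional independence through kernels, and its stability under observations -/

namespace BayesRL

section ConditionalIndependence

variable {X Y V Z U₁ U₂ : Type*} [MeasurableSpace X] [MeasurableSpace Y] [MeasurableSpace V]
  [MeasurableSpace Z] [MeasurableSpace U₁] [MeasurableSpace U₂]

/-- Under the law `μ` of a pair `(x, z)`, the variables `f z` and `g z` are conditionally
independent given `x`. -/
def CondIndepGiven (f : Z → U₁) (g : Z → U₂) (μ : Measure (X × Z)) : Prop :=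
  ∃ (η₁ : Kernel X U₁) (η₂ : Kernel X U₂), IsMarkovKernel η₁ ∧ IsMarkovKernel η₂ ∧
    ∀ F : X × U₁ × U₂ → ℝ≥0∞, Measurable F →
      ∫⁻ p, F (p.1, f p.2, g p.2) ∂μ =
        ∫⁻ p, ∫⁻ u, ∫⁻ v, F (p.1, u, v) ∂(η₂ p.1) ∂(η₁ p.1) ∂μ

variable {f : Z → U₁} {g : Z → U₂} {μ : Measure (X × Z)}

theorem CondIndepGiven.symm (h : CondIndepGiven f g μ) : CondIndepGiven g f μ := by
  obtain ⟨η₁, η₂, h₁, h₂, hF⟩ := h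
  refine ⟨η₂, η₁, h₂, h₁, fun F hFm => ?_⟩
  rw [hF (fun q => F (q.1, q.2.2, q.2.1)) (by fun_prop)]
  refine lintegral_congr fun p => ?_
  rw [lintegral_lintegral_swap]
  exact Measurable.aemeasurable (by unfold Function.uncurry; fun_prop)

/-- The law of `((x, y), z)` where `(x, z)` follows `μ` and `y` is drawn from `κ (z, v x)`. -/
noncomputable def observe (μ : Measure (X × Z)) (κ : Kernel (Z × V) Y) {v : X → V}
    (hv : Measurable v) : Measure ((X × Y) × Z) :=
  (μ ⊗ₘ κ.comap (fun p : X × Z => (p.2, v p.1)) (by fun_prop)).map fun q => ((q.1.1, q.2), q.1.2)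

instance [IsProbabilityMeasure μ] (κ : Kernel (Z × V) Y) [IsMarkovKernel κ] {v : X → V}
    (hv : Measurable v) : IsProbabilityMeasure (observe μ κ hv) := by
  unfold observe
  exact Measure.isProbabilityMeasure_map (by fun_prop)

theorem lintegral_observe [SFinite μ] (κ : Kernel (Z × V) Y) [IsMarkovKernel κ] {v : X → V}
    (hv : Measurable v) {F : (X × Y) × Z → ℝ≥0∞} (hF : Measurable F) :
    ∫⁻ q, F q ∂(observe μ κ hv) = ∫⁻ p, ∫⁻ y, F ((p.1, y), p.2) ∂(κ (p.2, v p.1)) ∂μ := by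
  rw [observe, lintegral_map hF (by fun_prop), Measure.lintegral_compProd (by fun_prop)]
  rfl

/-- An observation whose law depends on `f z` only preserves conditional independence. -/
theorem CondIndepGiven.observe_left [IsProbabilityMeasure μ] [StandardBorelSpace U₁] [Nonempty U₁]
    (h : CondIndepGiven f g μ) (hf : Measurable f)
    (hg : Measurable g) (κ : Kernel (Z × V) Y) [IsMarkovKernel κ]
    {v : X → V} (hv : Measurable v) (κ₁ : Kernel (U₁ × V) Y) [IsMarkovKernel κ₁]
    (hκ : ∀ z w, κ (z, w) = κ₁ (f z, w)) : CondIndepGiven f g (observe μ κ hv) := by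
  obtain ⟨η₁, η₂, h₁, h₂, hμ⟩ := h
  set C : Measure ((X × Y) × U₁) := (observe μ κ hv).map (fun q => (q.1, f q.2)) with hC
  have hCprob : IsProbabilityMeasure C := Measure.isProbabilityMeasure_map (by fun_prop)
  have hfst : C.fst = (observe μ κ hv).map Prod.fst := by
    rw [Measure.fst, hC, Measure.map_map (by fun_prop) (by fun_prop)]
    rfl
  let κ' : Kernel (X × U₁) Y := κ₁.comap (fun q => (q.2, v q.1)) (by fun_prop)
  -- Only the law of `f z` is updated by the observation `y`: it becomes the conditional law of `f
  -- z` given `(x, y)`. The law of `g z` ignores `y`, because `y` is drawn from `f z` and `x` alone.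
  refine ⟨C.condKernel, η₂.comap Prod.fst measurable_fst, inferInstance, inferInstance,
    fun F hF => ?_⟩
  have hG : Measurable fun q : (X × Y) × U₁ => ∫⁻ w, F (q.1, q.2, w) ∂(η₂ q.1.1) :=
    Measurable.lintegral_kernel_prod_right' (κ := η₂.comap (fun q : (X × Y) × U₁ => q.1.1)
      (by fun_prop)) (f := fun r : ((X × Y) × U₁) × U₂ => F (r.1.1, r.1.2, r.2)) (by fun_prop)
  have hF1 : Measurable fun q : X × U₁ × U₂ =>
      ∫⁻ y, F ((q.1, y), q.2.1, q.2.2) ∂(κ' (q.1, q.2.1)) :=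
    Measurable.lintegral_kernel_prod_right' (κ := κ'.comap (fun q : X × U₁ × U₂ => (q.1, q.2.1))
      (by fun_prop)) (f := fun r : (X × U₁ × U₂) × Y => F ((r.1.1, r.2), r.1.2.1, r.1.2.2))
      (by fun_prop)
  have hF2 : Measurable fun q : X × U₁ × U₂ =>
      ∫⁻ y, ∫⁻ w, F ((q.1, y), q.2.1, w) ∂(η₂ q.1) ∂(κ' (q.1, q.2.1)) :=
    Measurable.lintegral_kernel_prod_right' (κ := κ'.comap (fun q : X × U₁ × U₂ => (q.1, q.2.1))
      (by fun_prop)) (f := fun r : (X × U₁ × U₂) × Y =>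
        ∫⁻ w, F ((r.1.1, r.2), r.1.2.1, w) ∂(η₂ r.1.1))
      (hG.comp (f := fun r : (X × U₁ × U₂) × Y => ((r.1.1, r.2), r.1.2.1)) (by fun_prop))
  calc ∫⁻ q, F (q.1, f q.2, g q.2) ∂(observe μ κ hv)
      = ∫⁻ q, (∫⁻ w, F (q.1, f q.2, w) ∂(η₂ q.1.1)) ∂(observe μ κ hv) := by
        rw [lintegral_observe κ hv (F := fun q => F (q.1, f q.2, g q.2)) (by fun_prop),
          lintegral_observe κ hv (F := fun q => ∫⁻ w, F (q.1, f q.2, w) ∂(η₂ q.1.1))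
            (hG.comp (f := fun q : (X × Y) × Z => (q.1, f q.2)) (by fun_prop))]
        simp_rw [hκ]
        -- The hypothesis is used on both sides; on the right `g z` has already been integrated out,
        -- so its integral there is that of a constant.
        refine (hμ _ hF1).trans (Eq.trans ?_ (hμ _ hF2).symm)
        refine lintegral_congr fun p => lintegral_congr fun u => ?_
        simp only [lintegral_const, measure_univ, mul_one]
        rw [lintegral_lintegral_swap]
        exact Measurable.aemeasurable (by unfold Function.uncurry; fun_prop)
    _ = ∫⁻ q, (∫⁻ w, F (q.1, q.2, w) ∂(η₂ q.1.1)) ∂C := by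
        rw [hC, lintegral_map hG (by fun_prop)]
    _ = ∫⁻ x, ∫⁻ u, (∫⁻ w, F (x, u, w) ∂(η₂ x.1)) ∂(C.condKernel x) ∂C.fst := by
        conv_lhs => rw [← C.disintegrate C.condKernel]
        rw [Measure.lintegral_compProd hG]
    _ = _ := by
        rw [hfst, lintegral_map hG.lintegral_kernel_prod_right' measurable_fst]
        rfl

/-- The law of `y` given `(z, v)` depends on `z` only through `f z` or only through `g z`. -/
def FactorsThroughOne (f : Z → U₁) (g : Z → U₂) (κ : Kernel (Z × V) Y) : Prop :=
  (∃ κ₁ : Kernel (U₁ × V) Y, IsMarkovKernel κ₁ ∧ ∀ z w, κ (z, w) = κ₁ (f z, w)) ∨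
    ∃ κ₂ : Kernel (U₂ × V) Y, IsMarkovKernel κ₂ ∧ ∀ z w, κ (z, w) = κ₂ (g z, w)

/-- The roles of `f` and `g` are symmetric, so an observation may inform about either side, as long
as it never mixes them. -/
theorem CondIndepGiven.observe [IsProbabilityMeasure μ] [StandardBorelSpace U₁] [Nonempty U₁]
    [StandardBorelSpace U₂] [Nonempty U₂] (h : CondIndepGiven f g μ) (hf : Measurable f)
    (hg : Measurable g) {κ : Kernel (Z × V) Y} [IsMarkovKernel κ] (hκ : FactorsThroughOne f g κ)
    {v : X → V} (hv : Measurable v) : CondIndepGiven f g (observe μ κ hv) := by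
  obtain ⟨κ₁, _, hκ₁⟩ | ⟨κ₂, _, hκ₂⟩ := hκ
  · exact h.observe_left hf hg κ hv κ₁ hκ₁
  · exact (h.symm.observe_left hg hf κ hv κ₂ hκ₂).symm

/-- Conditioning on `φ x` instead of `x`, where `φ` has a measurable left inverse. -/
theorem CondIndepGiven.map_of_leftInverse (h : CondIndepGiven f g μ) (hf : Measurable f)
    (hg : Measurable g) {φ : X → Y} {ψ : Y → X}
    (hφ : Measurable φ) (hψ : Measurable ψ) (hψφ : Function.LeftInverse ψ φ) :
    CondIndepGiven f g (μ.map fun p => (φ p.1, p.2)) := by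
  obtain ⟨η₁, η₂, h₁, h₂, hμ⟩ := h
  refine ⟨η₁.comap ψ hψ, η₂.comap ψ hψ, inferInstance, inferInstance, fun F hF => ?_⟩
  have hm : Measurable fun p : Y × Z => ∫⁻ u, ∫⁻ w, F (p.1, u, w) ∂(η₂.comap ψ hψ p.1)
      ∂(η₁.comap ψ hψ p.1) := by
    have h1 : Measurable fun q : Y × U₁ => ∫⁻ w, F (q.1, q.2, w) ∂(η₂.comap ψ hψ q.1) :=
      Measurable.lintegral_kernel_prod_right' (κ := η₂.comap (fun q : Y × U₁ => ψ q.1)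
        (by fun_prop)) (f := fun r : (Y × U₁) × U₂ => F (r.1.1, r.1.2, r.2)) (by fun_prop)
    exact (h1.lintegral_kernel_prod_right').comp measurable_fst
  rw [lintegral_map (by fun_prop) (by fun_prop), lintegral_map hm (by fun_prop),
    hμ (fun q => F (φ q.1, q.2.1, q.2.2)) (by fun_prop)]
  refine lintegral_congr fun p => ?_
  simp [hψφ p.1]

/-- Adjoin to `z` a variable that is drawn, given `x`, independently of `z`. -/
theorem CondIndepGiven.adjoin [SFinite μ] (h : CondIndepGiven f g μ) (hf : Measurable f)
    (hg : Measurable g) (τ : Kernel X V) [IsMarkovKernel τ] :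
    CondIndepGiven (fun z : Z × V => f z.1) (fun z : Z × V => (g z.1, z.2))
      ((μ ⊗ₘ τ.comap Prod.fst measurable_fst).map fun q => (q.1.1, (q.1.2, q.2))) := by
  obtain ⟨η₁, η₂, h₁, h₂, hμ⟩ := h
  -- Given `x` the new variable is independent of everything else, so it may be attached to either
  -- side; it is put next to `g`.
  refine ⟨η₁, η₂ ×ₖ τ, h₁, inferInstance, fun F hF => ?_⟩
  have hm : Measurable fun p : X =>
      ∫⁻ u, ∫⁻ w, F (p, u, w) ∂((η₂ ×ₖ τ) p) ∂(η₁ p) := by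
    have h1 : Measurable fun q : X × U₁ => ∫⁻ w, F (q.1, q.2, w) ∂((η₂ ×ₖ τ) q.1) :=
      Measurable.lintegral_kernel_prod_right' (κ := (η₂ ×ₖ τ).comap (fun q : X × U₁ => q.1)
        (by fun_prop)) (f := fun r : (X × U₁) × (U₂ × V) => F (r.1.1, r.1.2, r.2)) (by fun_prop)
    exact h1.lintegral_kernel_prod_right'
  have hm' : Measurable fun p : X × (Z × V) =>
      ∫⁻ u, ∫⁻ w, F (p.1, u, w) ∂((η₂ ×ₖ τ) p.1) ∂(η₁ p.1) := hm.comp measurable_fst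
  have hF1 : Measurable fun q : X × U₁ × U₂ => ∫⁻ v, F (q.1, q.2.1, (q.2.2, v)) ∂(τ q.1) :=
    Measurable.lintegral_kernel_prod_right' (κ := τ.comap (fun q : X × U₁ × U₂ => q.1)
      (by fun_prop)) (f := fun r : (X × U₁ × U₂) × V => F (r.1.1, r.1.2.1, (r.1.2.2, r.2)))
      (by fun_prop)
  rw [lintegral_map (by fun_prop) (by fun_prop), Measure.lintegral_compProd (by fun_prop),
    lintegral_map hm' (by fun_prop),
    Measure.lintegral_compProd (f := fun q : (X × Z) × V =>
      ∫⁻ u, ∫⁻ w, F (q.1.1, u, w) ∂((η₂ ×ₖ τ) q.1.1) ∂(η₁ q.1.1))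
      (hm.comp (by fun_prop))]
  simp only [lintegral_const, measure_univ, mul_one]
  refine (hμ _ hF1).trans ?_
  refine lintegral_congr fun p => lintegral_congr fun u => ?_
  rw [Kernel.prod_apply, lintegral_prod _ (by fun_prop)]

/-- Forget a component of the second variable. -/
theorem CondIndepGiven.forget {ν : Measure (X × (Z × V))}
    (h : CondIndepGiven (fun z : Z × V => f z.1) (fun z : Z × V => (g z.1, z.2)) ν)
    (hf : Measurable f) (hg : Measurable g) :
    CondIndepGiven f g (ν.map fun q => (q.1, q.2.1)) := by
  obtain ⟨η₁, η₂, h₁, h₂, hμ⟩ := h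
  refine ⟨η₁, η₂.fst, h₁, inferInstance, fun F hF => ?_⟩
  have hm : Measurable fun p : X => ∫⁻ u, ∫⁻ w, F (p, u, w) ∂(η₂.fst p) ∂(η₁ p) := by
    have h1 : Measurable fun q : X × U₁ => ∫⁻ w, F (q.1, q.2, w) ∂(η₂.fst q.1) :=
      Measurable.lintegral_kernel_prod_right' (κ := η₂.fst.comap (fun q : X × U₁ => q.1)
        (by fun_prop)) (f := fun r : (X × U₁) × U₂ => F (r.1.1, r.1.2, r.2)) (by fun_prop)
    exact h1.lintegral_kernel_prod_right'
  have hm' : Measurable fun p : X × Z =>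
      ∫⁻ u, ∫⁻ w, F (p.1, u, w) ∂(η₂.fst p.1) ∂(η₁ p.1) := hm.comp measurable_fst
  rw [lintegral_map (by fun_prop) (by fun_prop), lintegral_map hm' (by fun_prop)]
  refine (hμ (fun q => F (q.1, q.2.1, q.2.2.1)) (by fun_prop)).trans ?_
  refine lintegral_congr fun p => lintegral_congr fun u => ?_
  rw [Kernel.fst_apply, lintegral_map (by fun_prop) measurable_fst]

end ConditionalIndependence

end BayesRL

/-! ### An episode as a sequence of observations -/

namespace BayesRL

section EpisodeIndependence

variable {X Y V Z U₁ U₂ S A : Type*} [MeasurableSpace X] [MeasurableSpace Y] [MeasurableSpace V]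
  [MeasurableSpace Z] [MeasurableSpace U₁] [MeasurableSpace U₂] [MeasurableSpace S]
  [MeasurableSpace A] {H : ℕ} {f : Z → U₁} {g : Z → U₂}

theorem measurable_lintegral_observe (κ : Kernel (Z × V) Y) [IsMarkovKernel κ] {v : X → V}
    (hv : Measurable v) {F : (X × Y) × Z → ℝ≥0∞} (hF : Measurable F) :
    Measurable fun p : X × Z => ∫⁻ y, F ((p.1, y), p.2) ∂(κ (p.2, v p.1)) :=
  Measurable.lintegral_kernel_prod_right' (κ := κ.comap (fun p : X × Z => (p.2, v p.1))
    (by fun_prop)) (f := fun q : (X × Z) × Y => F ((q.1.1, q.2), q.1.2)) (by fun_prop)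

/-- The joint law of `(x, y)` and `z`, where `(x, z)` follows `μ` and `y` is drawn from `κ z`. -/
noncomputable def adjoinData (μ : Measure (X × Z)) (κ : Kernel Z Y) : Measure ((X × Y) × Z) :=
  observe μ (κ.prodMkRight Unit) (v := fun _ => ()) measurable_const

instance (μ : Measure (X × Z)) [IsProbabilityMeasure μ] (κ : Kernel Z Y) [IsMarkovKernel κ] :
    IsProbabilityMeasure (adjoinData μ κ) := by unfold adjoinData; infer_instance

theorem lintegral_adjoinData (μ : Measure (X × Z)) [SFinite μ] (κ : Kernel Z Y) [IsMarkovKernel κ]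
    {F : (X × Y) × Z → ℝ≥0∞} (hF : Measurable F) :
    ∫⁻ q, F q ∂(adjoinData μ κ) = ∫⁻ p, ∫⁻ y, F ((p.1, y), p.2) ∂(κ p.2) ∂μ :=
  lintegral_observe _ _ hF

variable (P : Fin H → Kernel (Z × (S × A)) S) (R : Fin H → Kernel (Z × (S × A)) unitInterval)
  (π : Fin H → Kernel (Z × S) A) (s₁ : S) [∀ h, IsMarkovKernel (P h)] [∀ h, IsMarkovKernel (R h)]
  [∀ h, IsMarkovKernel (π h)] (μ : Measure (X × Z)) [IsProbabilityMeasure μ]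

/-- One layer amounts to three successive observations (action, reward, next state), each drawn from
the hidden variable and from components that are already visible, followed by a relabelling. -/
theorem adjoinData_prefixKernel_succ (n : ℕ) (hn : n + 1 ≤ H) :
    adjoinData μ (prefixKernel P R π s₁ (n + 1) hn) =
      (observe (observe (observe (adjoinData μ (prefixKernel P R π s₁ n (by omega)))
        (π ⟨n, hn⟩) (v := fun x => x.2.2) (by fun_prop))
        (R ⟨n, hn⟩) (v := fun x => (x.1.2.2, x.2)) (by fun_prop))
        (P ⟨n, hn⟩) (v := fun x => (x.1.1.2.2, x.1.2)) (by fun_prop)).map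
        fun q => ((q.1.1.1.1.1, appendStep ((q.1.1.1.1.2, q.1.1.1.2), (q.1.1.2, q.1.2))), q.2) := by
  refine Measure.ext_of_lintegral _ fun F hF => ?_
  have ha := measurable_appendStep (S := S) (A := A) n
  have hF0 : Measurable fun q : ((((X × (Prefix S A n × S)) × A) × unitInterval) × S) × Z =>
      F ((q.1.1.1.1.1, appendStep ((q.1.1.1.1.2, q.1.1.1.2), (q.1.1.2, q.1.2))), q.2) := by
    fun_prop
  have hF1 := measurable_lintegral_observe (P ⟨n, hn⟩)
    (v := fun x : ((X × (Prefix S A n × S)) × A) × unitInterval => (x.1.1.2.2, x.1.2))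
    (by fun_prop) hF0
  have hF2 := measurable_lintegral_observe (R ⟨n, hn⟩)
    (v := fun x : (X × (Prefix S A n × S)) × A => (x.1.2.2, x.2)) (by fun_prop) hF1
  have hF3 := measurable_lintegral_observe (π ⟨n, hn⟩)
    (v := fun x : X × (Prefix S A n × S) => x.2.2) (by fun_prop) hF2
  rw [lintegral_map hF (by fun_prop), lintegral_observe _ _ hF0, lintegral_observe _ _ hF1,
    lintegral_observe _ _ hF2, lintegral_adjoinData _ _ hF3, lintegral_adjoinData _ _ hF]
  refine lintegral_congr fun p => ?_
  rw [lintegral_prefixKernel_succ _ _ _ _ _ _ _ (by fun_prop)]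

theorem adjoinData_map_fst_prefixKernel_succ (n : ℕ) (hn : n + 1 ≤ H) :
    adjoinData μ ((prefixKernel P R π s₁ (n + 1) hn).map Prod.fst) =
      (observe (observe (adjoinData μ (prefixKernel P R π s₁ n (by omega)))
        (π ⟨n, hn⟩) (v := fun x => x.2.2) (by fun_prop))
        (R ⟨n, hn⟩) (v := fun x => (x.1.2.2, x.2)) (by fun_prop)).map
        fun q => ((q.1.1.1.1, appendReward ((q.1.1.1.2, q.1.1.2), q.1.2)), q.2) := by
  have : IsMarkovKernel ((prefixKernel P R π s₁ (n + 1) hn).map Prod.fst) :=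
    Kernel.IsMarkovKernel.map _ measurable_fst
  refine Measure.ext_of_lintegral _ fun F hF => ?_
  have ha := measurable_appendReward (S := S) (A := A) n
  have hF1 : Measurable fun q : (((X × (Prefix S A n × S)) × A) × unitInterval) × Z =>
      F ((q.1.1.1.1, appendReward ((q.1.1.1.2, q.1.1.2), q.1.2)), q.2) := by
    fun_prop
  have hF2 := measurable_lintegral_observe (R ⟨n, hn⟩)
    (v := fun x : (X × (Prefix S A n × S)) × A => (x.1.2.2, x.2)) (by fun_prop) hF1
  have hF3 := measurable_lintegral_observe (π ⟨n, hn⟩)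
    (v := fun x : X × (Prefix S A n × S) => x.2.2) (by fun_prop) hF2
  rw [lintegral_map hF (by fun_prop), lintegral_observe _ _ hF1,
    lintegral_observe _ _ hF2, lintegral_adjoinData _ _ hF3, lintegral_adjoinData _ _ hF]
  refine lintegral_congr fun p => ?_
  rw [Kernel.map_apply _ measurable_fst, lintegral_map (by fun_prop) measurable_fst,
    lintegral_prefixKernel_succ _ _ _ _ _ _ _ (by fun_prop)]
  simp [appendStep, appendReward]

variable [StandardBorelSpace U₁] [Nonempty U₁] [StandardBorelSpace U₂] [Nonempty U₂]

theorem CondIndepGiven.adjoinData_const {μ : Measure (X × Z)} [IsProbabilityMeasure μ]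
    (h : CondIndepGiven f g μ) (hf : Measurable f) (hg : Measurable g) {κ : Kernel Z Y}
    [IsMarkovKernel κ] (ν : Measure Y) [IsProbabilityMeasure ν] (hκ : ∀ z, κ z = ν) :
    CondIndepGiven f g (adjoinData μ κ) :=
  h.observe hf hg (Or.inl ⟨Kernel.const _ ν, inferInstance, fun z w => by simp [hκ]⟩) _

/-- Observing the first `n` layers of an episode preserves conditional independence. -/
theorem CondIndepGiven.adjoinData_prefixKernel {μ : Measure (X × Z)} [IsProbabilityMeasure μ]
    (h : CondIndepGiven f g μ) (hf : Measurable f) (hg : Measurable g)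
    (hP : ∀ h, FactorsThroughOne f g (P h)) (hR : ∀ h, FactorsThroughOne f g (R h))
    (hπ : ∀ h, FactorsThroughOne f g (π h)) (n : ℕ) (hn : n ≤ H) :
    CondIndepGiven f g (adjoinData μ (prefixKernel P R π s₁ n hn)) := by
  induction n with
  | zero => exact h.adjoinData_const hf hg _ fun z => prefixKernel_zero_apply P R π s₁ z
  | succ n ih =>
      rw [adjoinData_prefixKernel_succ]
      have ha := measurable_appendStep (S := S) (A := A) n
      have hs : Measurable fun y : X × (Prefix S A (n + 1) × S) => splitStep y.2 :=
        (measurable_splitStep n).comp measurable_snd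
      refine ((((ih (by omega)).observe hf hg (hπ _) _).observe hf hg (hR _) _).observe hf hg
        (hP _) _).map_of_leftInverse hf hg
        (φ := fun x => (x.1.1.1.1, appendStep ((x.1.1.1.2, x.1.1.2), (x.1.2, x.2))))
        (ψ := fun y => ((((y.1, (splitStep y.2).1.1), (splitStep y.2).1.2),
          (splitStep y.2).2.1), (splitStep y.2).2.2)) (by fun_prop)
        ((((measurable_fst.prodMk hs.fst.fst).prodMk hs.fst.snd).prodMk hs.snd.fst).prodMk
          hs.snd.snd) fun x => ?_
      simp [leftInverse_splitStep n _]

/-- Observing the first `n` layers of an episode without the state reached after them preserves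
conditional independence. -/
theorem CondIndepGiven.adjoinData_map_fst_prefixKernel {μ : Measure (X × Z)}
    [IsProbabilityMeasure μ]
    (h : CondIndepGiven f g μ) (hf : Measurable f) (hg : Measurable g)
    (hP : ∀ h, FactorsThroughOne f g (P h)) (hR : ∀ h, FactorsThroughOne f g (R h))
    (hπ : ∀ h, FactorsThroughOne f g (π h)) (n : ℕ) (hn : n ≤ H) :
    CondIndepGiven f g (adjoinData μ ((prefixKernel P R π s₁ n hn).map Prod.fst)) := by
  have hm : IsMarkovKernel ((prefixKernel P R π s₁ n hn).map Prod.fst) :=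
    Kernel.IsMarkovKernel.map _ measurable_fst
  -- Conditioning on fewer observations need not preserve conditional independence, so the final
  -- state cannot simply be projected away. Instead, the last observation is never made.
  cases n with
  | zero =>
      refine h.adjoinData_const hf hg (Measure.dirac Fin.elim0) fun z => ?_
      rw [Kernel.map_apply _ measurable_fst, prefixKernel_zero_apply,
        Measure.map_dirac' measurable_fst]
  | succ n =>
      rw [adjoinData_map_fst_prefixKernel_succ]
      have ha := measurable_appendReward (S := S) (A := A) n
      have hs : Measurable fun y : X × (Prefix S A (n + 1)) => splitReward y.2 :=
        (measurable_splitReward n).comp measurable_snd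
      refine ((((h.adjoinData_prefixKernel P R π s₁ hf hg hP hR hπ n (by omega)).observe hf hg
        (hπ _) _).observe hf hg (hR _) _)).map_of_leftInverse hf hg
        (φ := fun x => (x.1.1.1, appendReward ((x.1.1.2, x.1.2), x.2)))
        (ψ := fun y => (((y.1, (splitReward y.2).1.1), (splitReward y.2).1.2),
          (splitReward y.2).2)) (by fun_prop)
        (((measurable_fst.prodMk hs.fst.fst).prodMk hs.fst.snd).prodMk hs.snd) fun x => ?_
      simp [leftInverse_splitReward n _]

end EpisodeIndependence

end BayesRL

/-! ### The joint law of data and environment under Thompson sampling -/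

namespace BayesRL

section Independence

variable {X Z U₁ U₂ : Type*} [MeasurableSpace X] [MeasurableSpace Z] [MeasurableSpace U₁]
  [MeasurableSpace U₂] {f : Z → U₁} {g : Z → U₂}

theorem lintegral_of_indepFun {ρ : Measure Z} [IsProbabilityMeasure ρ] (h : IndepFun f g ρ)
    (hf : Measurable f) (hg : Measurable g) {F : U₁ × U₂ → ℝ≥0∞} (hF : Measurable F) :
    ∫⁻ z, F (f z, g z) ∂ρ = ∫⁻ z, ∫⁻ z', F (f z', g z) ∂ρ ∂ρ := by
  have h' := (indepFun_iff_map_prod_eq_prod_map_map hf.aemeasurable hg.aemeasurable).1 h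
  have : IsProbabilityMeasure (ρ.map f) := Measure.isProbabilityMeasure_map hf.aemeasurable
  have : IsProbabilityMeasure (ρ.map g) := Measure.isProbabilityMeasure_map hg.aemeasurable
  rw [← lintegral_map (g := fun z => (f z, g z)) hF (hf.prodMk hg), h',
    lintegral_prod_symm' _ hF, lintegral_map (by fun_prop) hg]
  refine lintegral_congr fun z => ?_
  rw [lintegral_map (by fun_prop) hf]

theorem CondIndepGiven.of_indepFun {ρ : Measure Z} [IsProbabilityMeasure ρ] (h : IndepFun f g ρ)
    (hf : Measurable f) (hg : Measurable g) (x : X) :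
    CondIndepGiven f g ((Measure.dirac x).prod ρ) := by
  have : IsProbabilityMeasure (ρ.map f) := Measure.isProbabilityMeasure_map hf.aemeasurable
  have : IsProbabilityMeasure (ρ.map g) := Measure.isProbabilityMeasure_map hg.aemeasurable
  refine ⟨Kernel.const X (ρ.map f), Kernel.const X (ρ.map g), inferInstance, inferInstance,
    fun F hF => ?_⟩
  have h' := (indepFun_iff_map_prod_eq_prod_map_map hf.aemeasurable hg.aemeasurable).1 h
  simp only [Kernel.const_apply]
  have hm : Measurable fun p : X × Z => ∫⁻ u, ∫⁻ w, F (p.1, u, w) ∂(ρ.map g) ∂(ρ.map f) := by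
    refine Measurable.lintegral_prod_right (f := fun (p : X × Z) u =>
      ∫⁻ w, F (p.1, u, w) ∂(ρ.map g)) ?_
    refine Measurable.lintegral_prod_right (f := fun (p : (X × Z) × U₁) w =>
      F (p.1.1, p.2, w)) ?_
    unfold Function.uncurry
    fun_prop
  rw [Measure.dirac_prod, lintegral_map (by fun_prop) (by fun_prop),
    lintegral_map hm (by fun_prop)]
  simp only [lintegral_const, measure_univ, mul_one]
  rw [← lintegral_map (g := fun z => (f z, g z)) (f := fun q => F (x, q.1, q.2)) (by fun_prop)
    (hf.prodMk hg), h', lintegral_prod _ (by fun_prop)]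

end Independence

namespace Model

variable {S A : Type*} [MeasurableSpace S] [MeasurableSpace A] {H : ℕ}
  {ΘP ΘR : Fin H → Type*} [∀ h, MeasurableSpace (ΘP h)] [∀ h, MeasurableSpace (ΘR h)]
  {M : Model S A ΘP ΘR} {Pi : Set (Policy S A H)} (σ : M.OptimalSelector Pi)
  [∀ h, StandardBorelSpace (ΘP h)] [∀ h, StandardBorelSpace (ΘR h)]
  [∀ h, Nonempty (ΘP h)] [∀ h, Nonempty (ΘR h)]
  {O : Type*} [MeasurableSpace O] (obs : Traj S A H → O) (hobs : Measurable obs)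
  {U₁ U₂ : Type*} [MeasurableSpace U₁] [MeasurableSpace U₂]
  (f : Param ΘP ΘR → U₁) (g : Param ΘP ΘR → U₂)

/-- One recorded episode preserves the conditional independence of `f θ` and `(g θ, θ')`. -/
def RecordPreservesIndep : Prop :=
  ∀ (n : ℕ) (μ : Measure ((Fin n → O) × (Param ΘP ΘR × Param ΘP ΘR))) [IsProbabilityMeasure μ],
    CondIndepGiven (fun z => f z.1) (fun z => (g z.1, z.2)) μ →
      CondIndepGiven (fun z => f z.1) (fun z => (g z.1, z.2)) (adjoinData μ (record σ obs hobs))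

/-- The joint law of the data of `n` episodes and of the environment, if the latter follows `ρ`. -/
noncomputable def jointData (ρ : Measure (Param ΘP ΘR)) (n : ℕ) :
    Measure ((Fin n → O) × Param ΘP ΘR) :=
  (ρ ⊗ₘ data σ obs hobs n).map Prod.swap

instance (ρ : Measure (Param ΘP ΘR)) [IsProbabilityMeasure ρ] (n : ℕ) :
    IsProbabilityMeasure (jointData σ obs hobs ρ n) :=
  Measure.isProbabilityMeasure_map (by fun_prop)

theorem lintegral_jointData (ρ : Measure (Param ΘP ΘR)) [IsProbabilityMeasure ρ] (n : ℕ)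
    {F : (Fin n → O) × Param ΘP ΘR → ℝ≥0∞} (hF : Measurable F) :
    ∫⁻ q, F q ∂(jointData σ obs hobs ρ n) = ∫⁻ θ, ∫⁻ D, F (D, θ) ∂(data σ obs hobs n θ) ∂ρ := by
  rw [jointData, lintegral_map hF (by fun_prop), Measure.lintegral_compProd (by fun_prop)]
  rfl

theorem jointData_zero (ρ : Measure (Param ΘP ΘR)) [IsProbabilityMeasure ρ] :
    jointData σ obs hobs ρ 0 = (Measure.dirac Fin.elim0).prod ρ := by
  refine Measure.ext_of_lintegral _ fun F hF => ?_
  rw [lintegral_jointData _ _ _ _ _ hF, Measure.dirac_prod, lintegral_map hF (by fun_prop)]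
  refine lintegral_congr fun θ => ?_
  have : data σ obs hobs 0 θ = Measure.dirac Fin.elim0 := by
    rw [data, dataAux, Kernel.const_apply]
  rw [this, lintegral_dirac' _ (by fun_prop)]

theorem lintegral_nextRecord {X : Type*} [MeasurableSpace X] (κ : Kernel (Param ΘP ΘR) X)
    [IsMarkovKernel κ] (θ : Param ΘP ΘR) (x : X) {F : O → ℝ≥0∞} (hF : Measurable F) :
    ∫⁻ o, F o ∂(nextRecord σ obs hobs κ (θ, x)) =
      ∫⁻ θ', ∫⁻ o, F o ∂(record σ obs hobs (θ, θ')) ∂(posterior κ M.prior x) := by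
  rw [nextRecord, Kernel.snd_apply, lintegral_map hF measurable_snd,
    Kernel.lintegral_compProd _ _ _ (by fun_prop)]
  rfl

/-- A round draws a sample from the posterior, plays an episode, forgets the sample and appends the
record. The posterior is always the one for `M.prior`, even when the environment follows another law
`ρ`: later `ρ` is the prior conditioned on a cell, about which the sampler knows nothing. -/
theorem jointData_succ (ρ : Measure (Param ΘP ΘR)) [IsProbabilityMeasure ρ] (n : ℕ) :
    jointData σ obs hobs ρ (n + 1) =
      ((adjoinData ((jointData σ obs hobs ρ n ⊗ₘ
        (posterior (data σ obs hobs n) M.prior).comap Prod.fst measurable_fst).map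
          fun q => (q.1.1, (q.1.2, q.2))) (record σ obs hobs)).map fun q => (q.1, q.2.1)).map
        fun q => (Fin.snoc q.1.1 q.1.2, q.2) := by
  have hs : Measurable fun q : ((Fin n → O) × O) × Param ΘP ΘR =>
      ((Fin.snoc q.1.1 q.1.2 : Fin (n + 1) → O), q.2) :=
    ((measurable_snoc n).comp measurable_fst).prodMk measurable_snd
  have : IsProbabilityMeasure ((jointData σ obs hobs ρ n ⊗ₘ
        (posterior (data σ obs hobs n) M.prior).comap Prod.fst measurable_fst).map
          fun q => (q.1.1, (q.1.2, q.2))) := Measure.isProbabilityMeasure_map (by fun_prop)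
  refine Measure.ext_of_lintegral _ fun F hF => ?_
  have hF1 : Measurable fun q : ((Fin n → O) × O) × Param ΘP ΘR =>
      F ((Fin.snoc q.1.1 q.1.2 : Fin (n + 1) → O), q.2) := hF.comp hs
  have hF2 : Measurable fun q : ((Fin n → O) × O) × (Param ΘP ΘR × Param ΘP ΘR) =>
      F ((Fin.snoc q.1.1 q.1.2 : Fin (n + 1) → O), q.2.1) :=
    hF1.comp (f := fun q : ((Fin n → O) × O) × (Param ΘP ΘR × Param ΘP ΘR) => (q.1, q.2.1))
      (by fun_prop)
  have hF3 := measurable_lintegral_observe ((record σ obs hobs).prodMkRight Unit)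
    (v := fun _ : Fin n → O => ()) measurable_const hF2
  simp only [Kernel.prodMkRight_apply] at hF3
  have hF4 : Measurable fun q : ((Fin n → O) × Param ΘP ΘR) × Param ΘP ΘR =>
      ∫⁻ o, F ((Fin.snoc q.1.1 o : Fin (n + 1) → O), q.1.2) ∂(record σ obs hobs (q.1.2, q.2)) :=
    hF3.comp (f := fun q : ((Fin n → O) × Param ΘP ΘR) × Param ΘP ΘR => (q.1.1, (q.1.2, q.2)))
      (by fun_prop)
  have hF5 := hF4.lintegral_kernel_prod_right' (κ :=
    (posterior (data σ obs hobs n) M.prior).comap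
      (Prod.fst : (Fin n → O) × Param ΘP ΘR → Fin n → O) measurable_fst)
  rw [lintegral_map hF hs, lintegral_map hF1 (by fun_prop), lintegral_adjoinData _ _ hF2,
    lintegral_map hF3 (by fun_prop), Measure.lintegral_compProd hF4,
    lintegral_jointData _ _ _ _ _ hF5, lintegral_jointData _ _ _ _ _ hF]
  refine lintegral_congr fun θ => ?_
  have hd : data σ obs hobs (n + 1) =
      (data σ obs hobs n ⊗ₖ nextRecord σ obs hobs (data σ obs hobs n)).map
          (fun p => (Fin.snoc p.1 p.2 : Fin (n + 1) → O)) := rfl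
  have hF6 : Measurable fun q : (Fin n → O) × O =>
      F ((Fin.snoc q.1 q.2 : Fin (n + 1) → O), θ) :=
    hF1.comp (f := fun q : (Fin n → O) × O => (q, θ)) (by fun_prop)
  rw [hd, Kernel.map_apply _ (measurable_snoc n), lintegral_map (by fun_prop) (measurable_snoc n),
    Kernel.lintegral_compProd _ _ _ hF6]
  refine lintegral_congr fun D => ?_
  exact lintegral_nextRecord σ obs hobs _ θ D (F := fun o => F ((Fin.snoc D o : Fin (n + 1) → O), θ))
    (hF6.comp measurable_prodMk_left)

variable {f g} in
-- Induction over episodes. The law of the Thompson sample is a function of the past data, so it can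
-- be adjoined on the side of `g` before the episode and dropped afterwards without coupling `f` and
-- `g`.
theorem condIndepGiven_jointData (ρ : Measure (Param ΘP ΘR)) [IsProbabilityMeasure ρ]
    (h : IndepFun f g ρ) (hf : Measurable f) (hg : Measurable g)
    (hrec : RecordPreservesIndep σ obs hobs f g) (n : ℕ) :
    CondIndepGiven f g (jointData σ obs hobs ρ n) := by
  induction n with
  | zero =>
      rw [jointData_zero]
      exact CondIndepGiven.of_indepFun h hf hg _
  | succ n ih =>
      rw [jointData_succ]
      have : IsProbabilityMeasure ((jointData σ obs hobs ρ n ⊗ₘ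
        (posterior (data σ obs hobs n) M.prior).comap Prod.fst measurable_fst).map
          fun q => (q.1.1, (q.1.2, q.2))) := Measure.isProbabilityMeasure_map (by fun_prop)
      refine ((hrec n _ (ih.adjoin hf hg _)).forget hf hg).map_of_leftInverse hf hg
        (φ := fun p : (Fin n → O) × O => (Fin.snoc p.1 p.2 : Fin (n + 1) → O))
        (ψ := fun w => (Fin.init w, w (Fin.last n))) (measurable_snoc n) ?_ fun p => ?_
      · unfold Fin.init
        fun_prop
      · simp

end Model

end BayesRL

/-! ### From joint laws to almost every posterior -/

namespace BayesRL

theorem indepFun_of_map_eq_prod {Z U₁ U₂ : Type*} [MeasurableSpace Z] [MeasurableSpace U₁]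
    [MeasurableSpace U₂] {f : Z → U₁} {g : Z → U₂} {ν : Measure Z} [IsFiniteMeasure ν]
    (hf : Measurable f) (hg : Measurable g) {m₁ : Measure U₁} {m₂ : Measure U₂}
    [IsProbabilityMeasure m₁] [IsProbabilityMeasure m₂]
    (h : ν.map (fun z => (f z, g z)) = m₁.prod m₂) : IndepFun f g ν := by
  have h1 : ν.map f = m₁ := by
    have := congrArg Measure.fst h
    rwa [Measure.fst_map_prodMk hg, Measure.fst_prod] at this
  have h2 : ν.map g = m₂ := by
    have := congrArg Measure.snd h
    rwa [Measure.snd_map_prodMk hf, Measure.snd_prod] at this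
  rw [indepFun_iff_map_prod_eq_prod_map_map hf.aemeasurable hg.aemeasurable, h, h1, h2]

namespace Model

variable {S A : Type*} [MeasurableSpace S] [MeasurableSpace A] {H : ℕ}
  {ΘP ΘR : Fin H → Type*} [∀ h, MeasurableSpace (ΘP h)] [∀ h, MeasurableSpace (ΘR h)]
  {M : Model S A ΘP ΘR} {Pi : Set (Policy S A H)} (σ : M.OptimalSelector Pi)
  [∀ h, StandardBorelSpace (ΘP h)] [∀ h, StandardBorelSpace (ΘR h)]
  [∀ h, Nonempty (ΘP h)] [∀ h, Nonempty (ΘR h)]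
  {O : Type*} [MeasurableSpace O] (obs : Traj S A H → O) (hobs : Measurable obs)
  {U₁ U₂ : Type*} [MeasurableSpace U₁] [MeasurableSpace U₂]
  {f : Param ΘP ΘR → U₁} {g : Param ΘP ΘR → U₂}

theorem lintegral_dataLaw_post (n : ℕ) {G : (Fin n → O) × Param ΘP ΘR → ℝ≥0∞}
    (hG : Measurable G) :
    ∫⁻ D, ∫⁻ θ, G (D, θ) ∂(post σ obs hobs n D) ∂(dataLaw σ obs hobs n) =
      ∫⁻ q, G q ∂(jointData σ obs hobs M.prior n) := by
  rw [jointData, ← compProd_posterior_eq_map_swap, Measure.lintegral_compProd hG]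
  rfl

instance (n : ℕ) : IsProbabilityMeasure (dataLaw σ obs hobs n) := by
  unfold dataLaw
  infer_instance

/-- Averaged over the data, the posterior is the prior; a set that is null for the prior is
therefore null for almost every posterior. -/
theorem ae_post_of_ae_prior (n : ℕ) {p : Param ΘP ΘR → Prop} (h : ∀ᵐ θ ∂M.prior, p θ) :
    ∀ᵐ D ∂(dataLaw σ obs hobs n), ∀ᵐ θ ∂(post σ obs hobs n D), p θ := by
  have : (posterior (data σ obs hobs n) M.prior) ∘ₘ (dataLaw σ obs hobs n) = M.prior :=
    posterior_comp_self
  rw [← this] at h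
  exact Measure.ae_ae_of_ae_comp h

/-- Conditioning on `C` commutes with updating, since the law of the data given the environment is
the same kernel under the prior and under the conditioned prior. This links posteriors restricted to
a cell with `jointData` started inside the cell. -/
theorem lintegral_dataLaw_post_restrict (n : ℕ) {C : Set (Param ΘP ΘR)} (hC : MeasurableSet C)
    (hC0 : M.prior C ≠ 0) {G : (Fin n → O) × Param ΘP ΘR → ℝ≥0∞} (hG : Measurable G) :
    ∫⁻ D, ∫⁻ θ in C, G (D, θ) ∂(post σ obs hobs n D) ∂(dataLaw σ obs hobs n) =
      M.prior C * ∫⁻ q, G q ∂(jointData σ obs hobs (M.prior[|C]) n) := by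
  have := cond_isProbabilityMeasure hC0
  have hGC : Measurable fun q : (Fin n → O) × Param ΘP ΘR => G q * C.indicator 1 q.2 :=
    hG.mul ((measurable_one.indicator hC).comp measurable_snd)
  have h1 := lintegral_dataLaw_post σ obs hobs n hGC
  have h2 : ∀ (ν : Measure (Param ΘP ΘR)) (F : Param ΘP ΘR → ℝ≥0∞),
      ∫⁻ θ, F θ * C.indicator 1 θ ∂ν = ∫⁻ θ in C, F θ ∂ν := by
    intro ν F
    rw [← lintegral_indicator hC]
    refine lintegral_congr fun θ => ?_
    by_cases hθ : θ ∈ C <;> simp [hθ]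
  rw [lintegral_jointData _ _ _ _ _ hGC] at h1
  simp_rw [h2] at h1
  rw [h1, lintegral_jointData _ _ _ _ _ hG, ProbabilityTheory.cond, lintegral_smul_measure, smul_eq_mul, ← mul_assoc,
    ENNReal.mul_inv_cancel hC0 (measure_ne_top _ _), one_mul, ← h2]
  refine lintegral_congr fun θ => ?_
  rw [lintegral_mul_const _ (by fun_prop)]

/-- If `f θ` and `g θ` are independent under the prior conditioned on `C`, they are so under
almost every posterior conditioned on `C`. -/
theorem ae_post_cond_indepFun [StandardBorelSpace U₁] [StandardBorelSpace U₂] (n : ℕ)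
    {C : Set (Param ΘP ΘR)}
    (hC : MeasurableSet C) (hC0 : M.prior C ≠ 0) (hf : Measurable f) (hg : Measurable g)
    (h : IndepFun f g (M.prior[|C])) (hrec : RecordPreservesIndep σ obs hobs f g) :
    ∀ᵐ D ∂(dataLaw σ obs hobs n), post σ obs hobs n D C ≠ 0 →
      IndepFun f g ((post σ obs hobs n D)[|C]) := by
  have := cond_isProbabilityMeasure hC0
  obtain ⟨η₁, η₂, h₁, h₂, hF⟩ :=
    condIndepGiven_jointData σ obs hobs (M.prior[|C]) h hf hg hrec n
  let ψ : Kernel (Fin n → O) (Param ΘP ΘR) :=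
    Kernel.restrict (posterior (data σ obs hobs n) M.prior) hC
  have hψ : ∀ D, ψ D = (post σ obs hobs n D).restrict C := fun D => Kernel.restrict_apply _ hC D
  -- Both kernels are kept unnormalised, with mass equal to the posterior mass of `C`, so that data
  -- giving `C` no mass need no special treatment. They have the same joint law with the data and
  -- hence agree almost everywhere.
  let K₁ : Kernel (Fin n → O) (U₁ × U₂) := ψ.map fun θ => (f θ, g θ)
  let K₂ : Kernel (Fin n → O) (U₁ × U₂) :=
    (ψ ⊗ₖ (η₁ ×ₖ η₂).comap Prod.fst measurable_fst).snd
  have hK₂ : ∀ D, K₂ D = post σ obs hobs n D C • (η₁ D).prod (η₂ D) := by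
    intro D
    refine Measure.ext_of_lintegral _ fun F hF => ?_
    rw [Kernel.snd_apply, lintegral_map hF measurable_snd,
      Kernel.lintegral_compProd _ _ _ (by fun_prop), lintegral_smul_measure]
    simp [hψ, Kernel.prod_apply, mul_comm]
  have hK : K₁ =ᵐ[dataLaw σ obs hobs n] K₂ := by
    refine Kernel.ae_eq_of_compProd_eq (Measure.ext_of_lintegral _ fun F hFm => ?_)
    have hm : Measurable fun D : Fin n → O => ∫⁻ u, ∫⁻ v, F (D, u, v) ∂(η₂ D) ∂(η₁ D) := by
      have h1 : Measurable fun q : (Fin n → O) × U₁ => ∫⁻ w, F (q.1, q.2, w) ∂(η₂ q.1) :=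
        Measurable.lintegral_kernel_prod_right'
          (κ := η₂.comap (fun q : (Fin n → O) × U₁ => q.1)
          (by fun_prop)) (f := fun r : ((Fin n → O) × U₁) × U₂ => F (r.1.1, r.1.2, r.2))
          (by fun_prop)
      exact h1.lintegral_kernel_prod_right'
    rw [Measure.lintegral_compProd hFm, Measure.lintegral_compProd hFm]
    have e1 : ∀ D, ∫⁻ q, F (D, q) ∂(K₁ D) =
        ∫⁻ θ in C, F (D, f θ, g θ) ∂(post σ obs hobs n D) := by
      intro D
      rw [Kernel.map_apply _ (by fun_prop), lintegral_map (by fun_prop) (by fun_prop), hψ]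
    have e2 : ∀ D, ∫⁻ q, F (D, q) ∂(K₂ D) =
        ∫⁻ θ in C, (∫⁻ u, ∫⁻ v, F (D, u, v) ∂(η₂ D) ∂(η₁ D)) ∂(post σ obs hobs n D) := by
      intro D
      rw [hK₂, lintegral_smul_measure, lintegral_prod _ (by fun_prop)]
      simp [mul_comm]
    simp_rw [e1, e2]
    rw [lintegral_dataLaw_post_restrict σ obs hobs n hC hC0
        (G := fun q => F (q.1, f q.2, g q.2)) (by fun_prop),
      lintegral_dataLaw_post_restrict σ obs hobs n hC hC0
        (G := fun q => ∫⁻ u, ∫⁻ v, F (q.1, u, v) ∂(η₂ q.1) ∂(η₁ q.1))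
        (hm.comp measurable_fst), hF F hFm]
  filter_upwards [hK] with D hD hD0
  have hp := cond_isProbabilityMeasure hD0
  refine indepFun_of_map_eq_prod hf hg (m₁ := η₁ D) (m₂ := η₂ D) ?_
  rw [ProbabilityTheory.cond, Measure.map_smul, ← hψ, ← Kernel.map_apply _ (by fun_prop)]
  change _ • K₁ D = _
  rw [hD, hK₂, smul_smul, ENNReal.inv_mul_cancel hD0 (measure_ne_top _ _), one_smul]

end Model

end BayesRL

/-! ### Independence of each parameter from all the others -/

namespace BayesRL

/-- Together the two hypotheses make the law of the triple the product of its three marginals, which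
can then be regrouped. -/
theorem indepFun_prodMk_of_indepFun_prodMk {Z U₁ U₂ U₃ : Type*} [MeasurableSpace Z]
    [MeasurableSpace U₁] [MeasurableSpace U₂] [MeasurableSpace U₃] {ρ : Measure Z}
    [IsProbabilityMeasure ρ] {x : Z → U₁} {y : Z → U₂} {w : Z → U₃} (hx : Measurable x)
    (hy : Measurable y) (hw : Measurable w) (hxy : IndepFun x y ρ)
    (hxyw : IndepFun (fun z => (x z, y z)) w ρ) : IndepFun x (fun z => (y z, w z)) ρ := by
  have : IsProbabilityMeasure (ρ.map x) := Measure.isProbabilityMeasure_map hx.aemeasurable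
  have : IsProbabilityMeasure (ρ.map y) := Measure.isProbabilityMeasure_map hy.aemeasurable
  have : IsProbabilityMeasure (ρ.map w) := Measure.isProbabilityMeasure_map hw.aemeasurable
  refine indepFun_of_map_eq_prod hx (hy.prodMk hw) (m₁ := ρ.map x)
    (m₂ := (ρ.map y).prod (ρ.map w)) ?_
  have h1 := (indepFun_iff_map_prod_eq_prod_map_map hx.aemeasurable hy.aemeasurable).1 hxy
  have h2 := (indepFun_iff_map_prod_eq_prod_map_map (hx.prodMk hy).aemeasurable
    hw.aemeasurable).1 hxyw
  rw [h1] at h2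
  refine Measure.ext_of_lintegral _ fun F hF => ?_
  have h3 := congrArg (fun m => ∫⁻ q, F (q.1.1, (q.1.2, q.2)) ∂m) h2
  rw [lintegral_map (by fun_prop) (by fun_prop), lintegral_prod _ (by fun_prop),
    lintegral_prod _ (Measurable.aemeasurable (Measurable.lintegral_prod_right
      (f := fun (q : U₁ × U₂) (r : U₃) => F (q.1, (q.2, r))) (by
        unfold Function.uncurry; fun_prop)))] at h3
  rw [lintegral_map hF (by fun_prop), h3, lintegral_prod _ (by fun_prop)]
  refine lintegral_congr fun u => ?_
  rw [lintegral_prod _ (by fun_prop)]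

theorem indepFun_comp_of_indepFun_map {Z Z' U₁ U₂ : Type*} [MeasurableSpace Z] [MeasurableSpace Z']
    [MeasurableSpace U₁] [MeasurableSpace U₂] {ρ : Measure Z} {φ : Z → Z'} {f : Z' → U₁}
    {g : Z' → U₂} (hφ : Measurable φ) (hf : Measurable f) (hg : Measurable g)
    (h : IndepFun f g (ρ.map φ)) : IndepFun (f ∘ φ) (g ∘ φ) ρ := by
  rw [indepFun_iff_measure_inter_preimage_eq_mul] at h ⊢
  intro s t hs ht
  have := h s t hs ht
  rwa [Measure.map_apply hφ ((hf hs).inter (hg ht)), Measure.map_apply hφ (hf hs),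
    Measure.map_apply hφ (hg ht)] at this

/-- Overwriting coordinate `h` by a constant leaves a function of the remaining coordinates. This
encodes "all other coordinates" inside the full product space, without a smaller index set. -/
theorem indepFun_eval_update {H : ℕ} {X : Fin H → Type*} [∀ h, MeasurableSpace (X h)]
    (m : ∀ h, Measure (X h)) [∀ h, IsProbabilityMeasure (m h)] (h : Fin H) (x₀ : X h) :
    IndepFun (fun x : ∀ h, X h => x h) (fun x => Function.update x h x₀) (Measure.pi m) := by
  have h1 : iIndepFun (fun h (x : ∀ h, X h) => x h) (Measure.pi m) :=
    iIndepFun_pi (X := fun _ x => x) fun h => aemeasurable_id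
  have h2 := h1.indepFun_finset {h} {h}ᶜ disjoint_compl_right (fun i => by fun_prop)
  classical
  let Φ : (∀ j : (({h}ᶜ : Finset (Fin H))), X j) → ∀ j, X j := fun q j =>
    if hj : j = h then hj ▸ x₀ else q ⟨j, by simpa using hj⟩
  have hΦ : Measurable Φ := by
    refine measurable_pi_iff.2 fun j => ?_
    by_cases hj : j = h
    · simp only [Φ, hj, dite_true]; exact measurable_const
    · simp only [Φ, hj, dite_false]; fun_prop
  have hev : Measurable fun w : ∀ j : ({h} : Finset (Fin H)), X j =>
      w ⟨h, Finset.mem_singleton_self h⟩ :=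
    measurable_pi_apply (⟨h, Finset.mem_singleton_self h⟩ : ({h} : Finset (Fin H)))
  have h3 := h2.comp (φ := fun w : ∀ j : ({h} : Finset (Fin H)), X j =>
      w ⟨h, Finset.mem_singleton_self h⟩) hev hΦ
  have h4 : (Φ ∘ fun (x : ∀ h, X h) (j : (({h}ᶜ : Finset (Fin H)))) => x j) =
      fun x => Function.update x h x₀ := by
    funext x j
    by_cases hj : j = h
    · subst hj; simp [Φ]
    · simp [Φ, hj]
  rwa [h4] at h3

namespace Model

variable {S A : Type*} [MeasurableSpace S] [MeasurableSpace A] {H : ℕ}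
  {ΘP ΘR : Fin H → Type*} [∀ h, MeasurableSpace (ΘP h)] [∀ h, MeasurableSpace (ΘR h)]
  {M : Model S A ΘP ΘR} {Pi : Set (Policy S A H)} (σ : M.OptimalSelector Pi)

section Coordinates

set_option linter.unusedSectionVars false

variable [∀ h, Nonempty (ΘP h)] [∀ h, Nonempty (ΘR h)]

/-- Forget the transition parameter of layer `h`. -/
noncomputable def resetP (h : Fin H) (θ : Param ΘP ΘR) : Param ΘP ΘR :=
  (Function.update θ.1 h (Classical.arbitrary _), θ.2)

/-- Forget the reward parameter of layer `h`. -/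
noncomputable def resetR (h : Fin H) (θ : Param ΘP ΘR) : Param ΘP ΘR :=
  (θ.1, Function.update θ.2 h (Classical.arbitrary _))

theorem measurable_resetP (h : Fin H) : Measurable (resetP (ΘP := ΘP) (ΘR := ΘR) h) :=
  (measurable_update_left.comp measurable_fst).prodMk measurable_snd

theorem measurable_resetR (h : Fin H) : Measurable (resetR (ΘP := ΘP) (ΘR := ΘR) h) :=
  measurable_fst.prodMk (measurable_update_left.comp measurable_snd)

/-- Every parameter is independent of all the others. -/
structure CoordIndep (ν : Measure (Param ΘP ΘR)) : Prop where
  indepP : ∀ h, IndepFun (fun θ : Param ΘP ΘR => θ.1 h) (resetP h) ν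
  indepR : ∀ h, IndepFun (fun θ : Param ΘP ΘR => θ.2 h) (resetR h) ν

/-- All parameters of the layers other than `h`. -/
def otherLayers (h : Fin H) (θ : Param ΘP ΘR) :
    ∀ j : (({h}ᶜ : Finset (Fin H))), ΘP j × ΘR j := fun j => (θ.1 j, θ.2 j)

theorem measurable_otherLayers (h : Fin H) :
    Measurable (otherLayers (ΘP := ΘP) (ΘR := ΘR) h) := by
  unfold otherLayers
  fun_prop

/-- Within layer `h` transition and reward are independent, and the pair is independent of the other
layers; so each of the two is independent of its partner together with the other layers. The reset
parameter is a measurable function `Φ` of the latter. -/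
theorem CoordIndep.of_layers {ν : Measure (Param ΘP ΘR)} [IsProbabilityMeasure ν]
    (h₁ : iIndepFun (fun h (θ : Param ΘP ΘR) => (θ.1 h, θ.2 h)) ν)
    (h₂ : ∀ h, IndepFun (fun θ : Param ΘP ΘR => θ.1 h) (fun θ => θ.2 h) ν) : CoordIndep ν := by
  have hl : ∀ h, IndepFun (fun θ : Param ΘP ΘR => (θ.1 h, θ.2 h)) (otherLayers h) ν := by
    intro h
    have := h₁.indepFun_finset {h} {h}ᶜ disjoint_compl_right (fun i => by fun_prop)
    exact this.comp (φ := fun w : ∀ j : ({h} : Finset (Fin H)), ΘP j × ΘR j =>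
      w ⟨h, Finset.mem_singleton_self h⟩) (ψ := id) (measurable_pi_apply _) measurable_id
  refine ⟨fun h => ?_, fun h => ?_⟩
  · have h3 := indepFun_prodMk_of_indepFun_prodMk (by fun_prop) (by fun_prop)
      (measurable_otherLayers h) (h₂ h) (hl h)
    classical
    let Φ : ΘR h × (∀ j : (({h}ᶜ : Finset (Fin H))), ΘP j × ΘR j) → Param ΘP ΘR := fun q =>
      (fun j => if hj : j = h then Classical.arbitrary _ else
        (q.2 ⟨j, by simpa using hj⟩).1,
        fun j => if hj : j = h then hj ▸ q.1 else (q.2 ⟨j, by simpa using hj⟩).2)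
    have hΦ : Measurable Φ := by
      refine (measurable_pi_iff.2 fun j => ?_).prodMk (measurable_pi_iff.2 fun j => ?_)
      · by_cases hj : j = h
        · simp only [hj, dite_true]; exact measurable_const
        · simp only [hj, dite_false]; fun_prop
      · by_cases hj : j = h
        · subst hj; simp only [dite_true]; exact measurable_fst
        · simp only [hj, dite_false]; fun_prop
    have h4 := h3.comp measurable_id hΦ
    have h5 : Φ ∘ (fun θ : Param ΘP ΘR => (θ.2 h, otherLayers h θ)) = resetP h := by
      funext θ
      refine Prod.ext (funext fun j => ?_) (funext fun j => ?_)
      · by_cases hj : j = h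
        · subst hj; simp [Φ, resetP]
        · simp [Φ, resetP, hj, otherLayers]
      · by_cases hj : j = h
        · subst hj; simp [Φ, resetP]
        · simp [Φ, resetP, hj, otherLayers]
    rwa [h5] at h4
  · have hl' := (hl h).comp measurable_swap measurable_id
    have h3 := indepFun_prodMk_of_indepFun_prodMk (by fun_prop) (by fun_prop)
      (measurable_otherLayers h) (h₂ h).symm hl'
    classical
    let Φ : ΘP h × (∀ j : (({h}ᶜ : Finset (Fin H))), ΘP j × ΘR j) → Param ΘP ΘR := fun q =>
      (fun j => if hj : j = h then hj ▸ q.1 else (q.2 ⟨j, by simpa using hj⟩).1,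
        fun j => if hj : j = h then Classical.arbitrary _ else
        (q.2 ⟨j, by simpa using hj⟩).2)
    have hΦ : Measurable Φ := by
      refine (measurable_pi_iff.2 fun j => ?_).prodMk (measurable_pi_iff.2 fun j => ?_)
      · by_cases hj : j = h
        · subst hj; simp only [dite_true]; exact measurable_fst
        · simp only [hj, dite_false]; fun_prop
      · by_cases hj : j = h
        · simp only [hj, dite_true]; exact measurable_const
        · simp only [hj, dite_false]; fun_prop
    have h4 := h3.comp measurable_id hΦ
    have h5 : Φ ∘ (fun θ : Param ΘP ΘR => (θ.1 h, otherLayers h θ)) = resetR h := by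
      funext θ
      refine Prod.ext (funext fun j => ?_) (funext fun j => ?_)
      · by_cases hj : j = h
        · subst hj; simp [Φ, resetR]
        · simp [Φ, resetR, hj, otherLayers]
      · by_cases hj : j = h
        · subst hj; simp [Φ, resetR]
        · simp [Φ, resetR, hj, otherLayers]
    rwa [h5] at h4

/-- The parameters are independent under the prior. -/
theorem coordIndep_prior : CoordIndep M.prior := by
  refine ⟨fun h => ?_, fun h => ?_⟩
  · refine indepFun_prodMk_of_indepFun_prodMk (y := fun θ : Param ΘP ΘR =>
      Function.update θ.1 h (Classical.arbitrary _)) (w := Prod.snd) (by fun_prop)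
      (measurable_update_left.comp measurable_fst) measurable_snd ?_ ?_
    · have h1 := indepFun_eval_update M.priorP h (Classical.arbitrary _)
      have h2 : Measure.pi M.priorP = M.prior.map Prod.fst := by
        rw [prior, Measure.map_fst_prod]; simp
      rw [h2] at h1
      exact indepFun_comp_of_indepFun_map measurable_fst (measurable_pi_apply h)
        measurable_update_left h1
    · have : IndepFun (fun θ : Param ΘP ΘR => θ.1) (fun θ => θ.2) M.prior :=
        indepFun_prod (X := id) (Y := id) measurable_id measurable_id
      exact this.comp (φ := fun x => (x h, Function.update x h (Classical.arbitrary _))) (ψ := id)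
        ((measurable_pi_apply h).prodMk measurable_update_left) measurable_id
  · have h3 : IndepFun (fun θ : Param ΘP ΘR => θ.2 h)
        (fun θ => (Function.update θ.2 h (Classical.arbitrary _), θ.1)) M.prior := by
      refine indepFun_prodMk_of_indepFun_prodMk (by fun_prop)
        (measurable_update_left.comp measurable_snd) measurable_fst ?_ ?_
      · have h1 := indepFun_eval_update M.priorR h (Classical.arbitrary _)
        have h2 : Measure.pi M.priorR = M.prior.map Prod.snd := by
          rw [prior, Measure.map_snd_prod]; simp
        rw [h2] at h1
        exact indepFun_comp_of_indepFun_map measurable_snd (measurable_pi_apply h)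
          measurable_update_left h1
      · have : IndepFun (fun θ : Param ΘP ΘR => θ.2) (fun θ => θ.1) M.prior :=
          (indepFun_prod (X := id) (Y := id) measurable_id measurable_id).symm
        exact this.comp (φ := fun x => (x h, Function.update x h (Classical.arbitrary _)))
          (ψ := id) ((measurable_pi_apply h).prodMk measurable_update_left) measurable_id
    exact h3.comp measurable_id measurable_swap

end Coordinates

end Model

end BayesRL

/-! ### Each draw of an episode reads one side of the split -/

namespace BayesRL

namespace Model

variable {S A : Type*} [MeasurableSpace S] [MeasurableSpace A] {H : ℕ}
  {ΘP ΘR : Fin H → Type*} [∀ h, MeasurableSpace (ΘP h)] [∀ h, MeasurableSpace (ΘR h)]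
  {M : Model S A ΘP ΘR} {Pi : Set (Policy S A H)} (σ : M.OptimalSelector Pi)

section Record

variable {U₁ U₂ : Type*} [MeasurableSpace U₁] [MeasurableSpace U₂]
  {f : Param ΘP ΘR → U₁} {g : Param ΘP ΘR → U₂}

theorem factorsThroughOne_comap_fst {V Y W : Type*} [MeasurableSpace V] [MeasurableSpace Y]
    [MeasurableSpace W] {κ : Kernel (Param ΘP ΘR × V) Y} (h : FactorsThroughOne f g κ) :
    FactorsThroughOne (fun z : Param ΘP ΘR × W => f z.1) (fun z => (g z.1, z.2))
      (κ.comap (fun z : (Param ΘP ΘR × W) × V => (z.1.1, z.2)) (by fun_prop)) := by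
  obtain ⟨κ₁, _, hκ⟩ | ⟨κ₂, _, hκ⟩ := h
  · exact Or.inl ⟨κ₁, inferInstance, fun z w => hκ _ _⟩
  · exact Or.inr ⟨κ₂.comap (fun q : (U₂ × W) × V => (q.1.1, q.2)) (by fun_prop), inferInstance,
      fun z w => hκ _ _⟩

/-- The policy reads the Thompson sample only, and that sample sits on the side of `g`. -/
theorem factorsThroughOne_selector (h : Fin H) :
    FactorsThroughOne (fun z : Param ΘP ΘR × Param ΘP ΘR => f z.1) (fun z => (g z.1, z.2))
      ((σ.kernel h).comap (fun z : (Param ΘP ΘR × Param ΘP ΘR) × S => (z.1.2, z.2))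
        (by fun_prop)) :=
  Or.inr ⟨(σ.kernel h).comap (fun q : (U₂ × Param ΘP ΘR) × S => (q.1.2, q.2)) (by fun_prop),
    inferInstance, fun _ _ => rfl⟩

theorem record_id : record σ id measurable_id = episode σ := by
  rw [record, Kernel.deterministic_comp_eq_map, Kernel.map_id]

theorem record_fst : record σ Prod.fst measurable_fst = (episode σ).map Prod.fst := by
  rw [record, Kernel.deterministic_comp_eq_map]

variable [∀ h, StandardBorelSpace (ΘP h)] [∀ h, StandardBorelSpace (ΘR h)]
  [∀ h, Nonempty (ΘP h)] [∀ h, Nonempty (ΘR h)]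
  [StandardBorelSpace U₁] [Nonempty U₁] [StandardBorelSpace U₂] [Nonempty U₂]

theorem recordPreservesIndep_id (hf : Measurable f) (hg : Measurable g)
    (hP : ∀ h, FactorsThroughOne f g (M.transΘ h)) (hR : ∀ h, FactorsThroughOne f g (M.rewΘ h)) :
    RecordPreservesIndep σ id measurable_id f g := by
  intro n μ _ h
  rw [record_id]
  exact h.adjoinData_prefixKernel _ _ _ _ (by fun_prop) (by fun_prop)
    (fun j => factorsThroughOne_comap_fst (hP j)) (fun j => factorsThroughOne_comap_fst (hR j))
    (fun j => factorsThroughOne_selector σ j) H le_rfl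

theorem recordPreservesIndep_fst (hf : Measurable f) (hg : Measurable g)
    (hP : ∀ h, FactorsThroughOne f g (M.transΘ h)) (hR : ∀ h, FactorsThroughOne f g (M.rewΘ h)) :
    RecordPreservesIndep σ Prod.fst measurable_fst f g := by
  intro n μ _ h
  rw [record_fst]
  exact h.adjoinData_map_fst_prefixKernel _ _ _ _ (by fun_prop) (by fun_prop)
    (fun j => factorsThroughOne_comap_fst (hP j)) (fun j => factorsThroughOne_comap_fst (hR j))
    (fun j => factorsThroughOne_selector σ j) H le_rfl

end Record

section Coordinates

set_option linter.unusedSectionVars false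

variable [∀ h, Nonempty (ΘP h)] [∀ h, Nonempty (ΘR h)]

/-- The transition of layer `h` reads the singled-out coordinate; every other transition reads a
coordinate that the reset leaves unchanged. -/
theorem factorsThroughOne_transΘ_coordP (h j : Fin H) :
    FactorsThroughOne (fun θ : Param ΘP ΘR => θ.1 h) (resetP h) (M.transΘ j) := by
  by_cases hj : j = h
  · subst hj
    exact Or.inl ⟨M.trans j, inferInstance, fun _ _ => rfl⟩
  · refine Or.inr ⟨M.transΘ j, inferInstance, fun z w => ?_⟩
    simp [transΘ, resetP, Kernel.comap_apply, hj]

theorem factorsThroughOne_rewΘ_coordP (h j : Fin H) :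
    FactorsThroughOne (fun θ : Param ΘP ΘR => θ.1 h) (resetP h) (M.rewΘ j) :=
  Or.inr ⟨M.rewΘ j, inferInstance, fun _ _ => rfl⟩

theorem factorsThroughOne_transΘ_coordR (h j : Fin H) :
    FactorsThroughOne (fun θ : Param ΘP ΘR => θ.2 h) (resetR h) (M.transΘ j) :=
  Or.inr ⟨M.transΘ j, inferInstance, fun _ _ => rfl⟩

theorem factorsThroughOne_rewΘ_coordR (h j : Fin H) :
    FactorsThroughOne (fun θ : Param ΘP ΘR => θ.2 h) (resetR h) (M.rewΘ j) := by
  by_cases hj : j = h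
  · subst hj
    exact Or.inl ⟨M.rew j, inferInstance, fun _ _ => rfl⟩
  · refine Or.inr ⟨M.rewΘ j, inferInstance, fun z w => ?_⟩
    simp [rewΘ, resetR, Kernel.comap_apply, hj]

/-- Every recorded episode preserves the independence of each parameter of all the others. -/
def RecordPreservesCoordIndep [∀ h, StandardBorelSpace (ΘP h)] [∀ h, StandardBorelSpace (ΘR h)]
    {O : Type*} [MeasurableSpace O] (obs : Traj S A H → O)
    (hobs : Measurable obs) : Prop :=
  (∀ h, RecordPreservesIndep σ obs hobs (fun θ : Param ΘP ΘR => θ.1 h) (resetP h)) ∧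
    ∀ h, RecordPreservesIndep σ obs hobs (fun θ : Param ΘP ΘR => θ.2 h) (resetR h)

variable [∀ h, StandardBorelSpace (ΘP h)] [∀ h, StandardBorelSpace (ΘR h)]

theorem recordPreservesCoordIndep_id : RecordPreservesCoordIndep σ id measurable_id :=
  ⟨fun h => recordPreservesIndep_id σ (by fun_prop) (measurable_resetP h)
      (factorsThroughOne_transΘ_coordP h) (factorsThroughOne_rewΘ_coordP h),
    fun h => recordPreservesIndep_id σ (by fun_prop) (measurable_resetR h)
      (factorsThroughOne_transΘ_coordR h) (factorsThroughOne_rewΘ_coordR h)⟩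

theorem recordPreservesCoordIndep_fst : RecordPreservesCoordIndep σ Prod.fst measurable_fst :=
  ⟨fun h => recordPreservesIndep_fst σ (by fun_prop) (measurable_resetP h)
      (factorsThroughOne_transΘ_coordP h) (factorsThroughOne_rewΘ_coordP h),
    fun h => recordPreservesIndep_fst σ (by fun_prop) (measurable_resetR h)
      (factorsThroughOne_transΘ_coordR h) (factorsThroughOne_rewΘ_coordR h)⟩

variable {O : Type*} [MeasurableSpace O] (obs : Traj S A H → O) (hobs : Measurable obs)

theorem ae_post_cond_coordIndep (hrec : RecordPreservesCoordIndep σ obs hobs) (n : ℕ)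
    {C : Set (Param ΘP ΘR)} (hC : MeasurableSet C)
    (h : M.prior C ≠ 0 → CoordIndep (M.prior[|C])) :
    ∀ᵐ D ∂(dataLaw σ obs hobs n), post σ obs hobs n D C ≠ 0 →
      CoordIndep ((post σ obs hobs n D)[|C]) := by
  -- For a prior-null set the claim is vacuous: almost every posterior gives it mass zero.
  by_cases hC0 : M.prior C = 0
  · have : ∀ᵐ θ ∂M.prior, θ ∉ C := measure_eq_zero_iff_ae_notMem.1 hC0
    filter_upwards [ae_post_of_ae_prior σ obs hobs n this] with D hD hD0
    exact absurd (measure_eq_zero_iff_ae_notMem.2 hD) hD0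
  · have h1 := ae_all_iff.2 fun j => ae_post_cond_indepFun σ obs hobs n hC hC0 (by fun_prop)
      (measurable_resetP j) ((h hC0).indepP j) (hrec.1 j)
    have h2 := ae_all_iff.2 fun j => ae_post_cond_indepFun σ obs hobs n hC hC0 (by fun_prop)
      (measurable_resetR j) ((h hC0).indepR j) (hrec.2 j)
    filter_upwards [h1, h2] with D hD1 hD2 hD0
    exact ⟨fun j => hD1 j hD0, fun j => hD2 j hD0⟩

/-- The parameters are independent under almost every posterior, and also after conditioning on a
cell of a layered value partition. -/
theorem ae_post_coordIndep (hrec : RecordPreservesCoordIndep σ obs hobs) {ε : ℝ} {K : ℕ}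
    {ζ : Param ΘP ΘR → Fin K} (hζ : IsLayeredValuePartition σ ε ζ) (n : ℕ) :
    ∀ᵐ D ∂(dataLaw σ obs hobs n), CoordIndep (post σ obs hobs n D) ∧
      ∀ k, post σ obs hobs n D (ζ ⁻¹' {k}) ≠ 0 →
        CoordIndep ((post σ obs hobs n D)[|ζ ⁻¹' {k}]) := by
  -- The unconditioned posterior is the case where the cell is the whole space.
  have h1 := ae_post_cond_coordIndep σ obs hobs hrec n MeasurableSet.univ fun _ => by
    rw [cond_univ]; exact coordIndep_prior
  have h2 := ae_all_iff.2 fun k => ae_post_cond_coordIndep σ obs hobs hrec n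
    (hζ.measurable (measurableSet_singleton k)) fun hk => by
      have := cond_isProbabilityMeasure hk
      exact CoordIndep.of_layers (hζ.indep_layers k hk) (hζ.indep_rew k hk)
  filter_upwards [h1, h2] with D hD1 hD2
  refine ⟨?_, hD2⟩
  have := hD1 (by simp)
  rwa [cond_univ] at this

end Coordinates

end Model

end BayesRL

/-! ### Averaging episodes over independent parameters gives the mean environment -/

namespace BayesRL

namespace Model

variable {S A : Type*} [MeasurableSpace S] [MeasurableSpace A] {H : ℕ}
  {ΘP ΘR : Fin H → Type*} [∀ h, MeasurableSpace (ΘP h)] [∀ h, MeasurableSpace (ΘR h)]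
  {M : Model S A ΘP ΘR} {Pi : Set (Policy S A H)} (σ : M.OptimalSelector Pi)

section Resampling

/-- Replace the transition parameter of layer `h` in `θ` by the one in `t`. -/
def replaceP (h : Fin H) (θ t : Param ΘP ΘR) : Param ΘP ΘR := (Function.update θ.1 h (t.1 h), θ.2)

/-- Replace the reward parameter of layer `h` in `θ` by the one in `t`. -/
def replaceR (h : Fin H) (θ t : Param ΘP ΘR) : Param ΘP ΘR := (θ.1, Function.update θ.2 h (t.2 h))

variable [∀ h, Nonempty (ΘP h)] [∀ h, Nonempty (ΘR h)] {ν : Measure (Param ΘP ΘR)}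
  [IsProbabilityMeasure ν]

/-- A parameter that is independent of the rest can be resampled from an independent copy without
changing the law. -/
theorem CoordIndep.lintegral_replaceP (hν : CoordIndep ν) (h : Fin H) {Ψ : Param ΘP ΘR → ℝ≥0∞}
    (hΨ : Measurable Ψ) : ∫⁻ θ, Ψ θ ∂ν = ∫⁻ θ, ∫⁻ t, Ψ (replaceP h θ t) ∂ν ∂ν := by
  have hm : Measurable fun q : ΘP h × Param ΘP ΘR => (Function.update q.2.1 h q.1, q.2.2) :=
    (measurable_update'.comp (f := fun q : ΘP h × Param ΘP ΘR => (q.2.1, q.1))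
      (by fun_prop)).prodMk (by fun_prop)
  have := lintegral_of_indepFun (hν.indepP h) (by fun_prop) (measurable_resetP h) (hΨ.comp hm)
  simpa [resetP, replaceP] using this

theorem CoordIndep.lintegral_replaceR (hν : CoordIndep ν) (h : Fin H) {Ψ : Param ΘP ΘR → ℝ≥0∞}
    (hΨ : Measurable Ψ) : ∫⁻ θ, Ψ θ ∂ν = ∫⁻ θ, ∫⁻ t, Ψ (replaceR h θ t) ∂ν ∂ν := by
  have hm : Measurable fun q : ΘR h × Param ΘP ΘR => (q.2.1, Function.update q.2.2 h q.1) :=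
    Measurable.prodMk (by fun_prop) (measurable_update'.comp
      (f := fun q : ΘR h × Param ΘP ΘR => (q.2.2, q.1)) (by fun_prop))
  have := lintegral_of_indepFun (hν.indepR h) (by fun_prop) (measurable_resetR h) (hΨ.comp hm)
  simpa [resetR, replaceR] using this

end Resampling

/-- The mean of a family of kernels. -/
noncomputable def meanKernel {V Y : Type*} [MeasurableSpace V] [MeasurableSpace Y]
    (ν : Measure (Param ΘP ΘR)) (T : Kernel (Param ΘP ΘR × V) Y) : Kernel V Y :=
  T ∘ₖ (Kernel.const V ν ×ₖ Kernel.id)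

theorem lintegral_meanKernel {V Y : Type*} [MeasurableSpace V] [MeasurableSpace Y]
    (ν : Measure (Param ΘP ΘR)) [IsProbabilityMeasure ν] (T : Kernel (Param ΘP ΘR × V) Y)
    [IsMarkovKernel T] (v : V) {F : Y → ℝ≥0∞} (hF : Measurable F) :
    ∫⁻ y, F y ∂(meanKernel ν T v) = ∫⁻ θ, ∫⁻ y, F y ∂(T (θ, v)) ∂ν := by
  rw [meanKernel, Kernel.lintegral_comp _ _ _ hF, Kernel.prod_apply, Kernel.const_apply,
    Kernel.id_apply, lintegral_prod _ (hF.lintegral_kernel).aemeasurable]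
  refine lintegral_congr fun θ => ?_
  exact lintegral_dirac' (f := fun w => ∫⁻ y, F y ∂(T (θ, w))) v
    ((hF.lintegral_kernel (κ := T)).comp measurable_prodMk_left)

/-- Here `u θ t` resamples one coordinate. The kernel `κ` does not see that coordinate and `T` sees
nothing else, so after resampling the integral over `t` passes through `κ` and averages `T` alone.
-/
theorem lintegral_kernel_eq_meanKernel {W V Y : Type*} [MeasurableSpace W] [MeasurableSpace V]
    [MeasurableSpace Y] {ν : Measure (Param ΘP ΘR)} [IsProbabilityMeasure ν]
    {u : Param ΘP ΘR → Param ΘP ΘR → Param ΘP ΘR}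
    (hu : ∀ {Ψ : Param ΘP ΘR → ℝ≥0∞}, Measurable Ψ →
      ∫⁻ θ, Ψ θ ∂ν = ∫⁻ θ, ∫⁻ t, Ψ (u θ t) ∂ν ∂ν)
    (κ : Kernel (Param ΘP ΘR) W) [IsMarkovKernel κ] (hκ : ∀ θ t, κ (u θ t) = κ θ)
    (T : Kernel (Param ΘP ΘR × V) Y) [IsMarkovKernel T] (hT : ∀ θ t v, T (u θ t, v) = T (t, v))
    {v : W → V} (hv : Measurable v) {F : W × Y → ℝ≥0∞} (hF : Measurable F) :
    ∫⁻ θ, ∫⁻ w, ∫⁻ y, F (w, y) ∂(T (θ, v w)) ∂(κ θ) ∂ν =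
      ∫⁻ θ, ∫⁻ w, ∫⁻ y, F (w, y) ∂(meanKernel ν T (v w)) ∂(κ θ) ∂ν := by
  have hG : Measurable fun q : Param ΘP ΘR × W => ∫⁻ y, F (q.2, y) ∂(T (q.1, v q.2)) :=
    Measurable.lintegral_kernel_prod_right' (κ := T.comap (fun q : Param ΘP ΘR × W => (q.1, v q.2))
      (by fun_prop)) (f := fun r : (Param ΘP ΘR × W) × Y => F (r.1.2, r.2)) (by fun_prop)
  rw [hu hG.lintegral_kernel_prod_right']
  refine lintegral_congr fun θ => ?_
  simp_rw [hκ, hT]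
  rw [lintegral_lintegral_swap hG.aemeasurable]
  refine lintegral_congr fun w => ?_
  rw [lintegral_meanKernel _ _ _ (by fun_prop)]

/-- The law of the first `n` layers in the environment `θ` under `π*_{θ'}`. -/
noncomputable def prefixOf (n : ℕ) (hn : n ≤ H) :
    Kernel (Param ΘP ΘR × Param ΘP ΘR) (Prefix S A n × S) :=
  prefixKernel (fun h => (M.transΘ h).comap (fun z => (z.1.1, z.2)) (by fun_prop))
    (fun h => (M.rewΘ h).comap (fun z => (z.1.1, z.2)) (by fun_prop))
    (fun h => (σ.kernel h).comap (fun z => (z.1.2, z.2)) (by fun_prop)) M.s₁ n hn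

instance (n : ℕ) (hn : n ≤ H) : IsMarkovKernel (prefixOf σ n hn) := by
  unfold prefixOf
  infer_instance

/-- The law of the first `n` layers in the environment `E` under `π*_{θ'}`. -/
noncomputable def prefixIn (E : Env S A H) (n : ℕ) (hn : n ≤ H) :
    Kernel (Param ΘP ΘR) (Prefix S A n × S) :=
  prefixKernel (fun h => (E.trans h).prodMkLeft (Param ΘP ΘR))
    (fun h => (E.rew h).prodMkLeft (Param ΘP ΘR)) σ.kernel M.s₁ n hn

/-- Layers are numbered from `0`, so a prefix of length `h` uses only layers with index strictly
below `h`. -/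
theorem prefixOf_replaceP (θ t θ' : Param ΘP ΘR) (h : Fin H) :
    prefixOf σ h h.2.le (replaceP h θ t, θ') = prefixOf σ h h.2.le (θ, θ') := by
  refine prefixKernel_congr _ _ _ _ _ _ _ _ (fun j hj x => ?_) (fun j hj x => rfl)
    (fun j hj x => rfl)
  have : j ≠ h := fun hjh => by subst hjh; exact lt_irrefl _ hj
  simp [transΘ, replaceP, Kernel.comap_apply, this]

theorem prefixOf_replaceR (θ t θ' : Param ΘP ΘR) (h : Fin H) :
    prefixOf σ h h.2.le (replaceR h θ t, θ') = prefixOf σ h h.2.le (θ, θ') := by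
  refine prefixKernel_congr _ _ _ _ _ _ _ _ (fun j hj x => rfl) (fun j hj x => ?_)
    (fun j hj x => rfl)
  have : j ≠ h := fun hjh => by subst hjh; exact lt_irrefl _ hj
  simp [rewΘ, replaceR, Kernel.comap_apply, this]

variable [∀ h, Nonempty (ΘP h)] [∀ h, Nonempty (ΘR h)] {ν : Measure (Param ΘP ΘR)}
  [IsProbabilityMeasure ν]

/-- If the parameters are independent under `ν`, then the mean over `ν` of the law of an episode
is its law in the mean environment. -/
theorem lintegral_prefixOf (hν : CoordIndep ν) (θ' : Param ΘP ΘR) (n : ℕ) (hn : n ≤ H)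
    {F : Prefix S A n × S → ℝ≥0∞} (hF : Measurable F) :
    ∫⁻ θ, ∫⁻ w, F w ∂(prefixOf σ n hn (θ, θ')) ∂ν =
      ∫⁻ w, F w ∂(prefixIn σ (M.meanEnv ν) n hn θ') := by
  induction n with
  | zero => simp [prefixOf, prefixIn, prefixKernel_zero_apply]
  | succ n ih =>
      let h : Fin H := ⟨n, hn⟩
      have ha := measurable_appendStep (S := S) (A := A) n
      -- `κ₁` stops before the reward of layer `h` and sees neither parameter of that layer; `κ₂`
      -- includes the reward but not the transition. Hence the transition is averaged first, against
      -- `κ₂`, and then the reward, against `κ₁`. What remains is an integral over the shorter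
      -- prefix, left to the induction hypothesis.
      let κ₁ : Kernel (Param ΘP ΘR) ((Prefix S A n × S) × A) :=
        (prefixOf σ n (by omega)).comap (fun θ => (θ, θ')) (by fun_prop) ⊗ₖ
          (σ.kernel h).comap (fun q : Param ΘP ΘR × (Prefix S A n × S) => (θ', q.2.2))
            (by fun_prop)
      let κ₂ : Kernel (Param ΘP ΘR) (((Prefix S A n × S) × A) × unitInterval) :=
        κ₁ ⊗ₖ (M.rewΘ h).comap
          (fun q : Param ΘP ΘR × ((Prefix S A n × S) × A) => (q.1, (q.2.1.2, q.2.2)))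
          (by fun_prop)
      have hκ₁ : ∀ θ {G : (Prefix S A n × S) × A → ℝ≥0∞}, Measurable G →
          ∫⁻ w, G w ∂(κ₁ θ) = ∫⁻ p, ∫⁻ a, G (p, a) ∂(σ.kernel h (θ', p.2))
            ∂(prefixOf σ n (by omega) (θ, θ')) := by
        intro θ G hG
        rw [Kernel.lintegral_compProd _ _ _ hG]
        rfl
      have hκ₂ : ∀ θ {G : ((Prefix S A n × S) × A) × unitInterval → ℝ≥0∞}, Measurable G →
          ∫⁻ w, G w ∂(κ₂ θ) = ∫⁻ p, ∫⁻ r, G (p, r) ∂(M.rewΘ h (θ, (p.1.2, p.2))) ∂(κ₁ θ) := by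
        intro θ G hG
        rw [Kernel.lintegral_compProd _ _ _ hG]
        rfl
      have hinv₁ : ∀ θ t, κ₁ (replaceR h θ t) = κ₁ θ := by
        intro θ t
        refine Measure.ext_of_lintegral _ fun G hG => ?_
        rw [hκ₁ _ hG, hκ₁ _ hG, prefixOf_replaceR σ θ t θ' h]
      have hinv₁' : ∀ θ t, κ₁ (replaceP h θ t) = κ₁ θ := by
        intro θ t
        refine Measure.ext_of_lintegral _ fun G hG => ?_
        rw [hκ₁ _ hG, hκ₁ _ hG, prefixOf_replaceP σ θ t θ' h]
      have hinv₂ : ∀ θ t, κ₂ (replaceP h θ t) = κ₂ θ := by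
        intro θ t
        refine Measure.ext_of_lintegral _ fun G hG => ?_
        rw [hκ₂ _ hG, hκ₂ _ hG, hinv₁']
        rfl
      have hF' : Measurable fun q : (((Prefix S A n × S) × A) × unitInterval) × S =>
          F (appendStep (q.1.1, (q.1.2, q.2))) := by fun_prop
      have hG2 : Measurable fun q : ((Prefix S A n × S) × A) × unitInterval =>
          ∫⁻ s', F (appendStep (q.1, (q.2, s'))) ∂(meanKernel ν (M.transΘ h) (q.1.1.2, q.1.2)) := by
        have : IsMarkovKernel (meanKernel ν (M.transΘ h)) := by unfold meanKernel; infer_instance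
        exact Measurable.lintegral_kernel_prod_right' (κ := (meanKernel ν (M.transΘ h)).comap
          (fun q : ((Prefix S A n × S) × A) × unitInterval => (q.1.1.2, q.1.2)) (by fun_prop)) hF'
      have hG1 : Measurable fun q : (Prefix S A n × S) × A =>
          ∫⁻ r, ∫⁻ s', F (appendStep (q, (r, s'))) ∂(meanKernel ν (M.transΘ h) (q.1.2, q.2))
            ∂(meanKernel ν (M.rewΘ h) (q.1.2, q.2)) := by
        have : IsMarkovKernel (meanKernel ν (M.rewΘ h)) := by unfold meanKernel; infer_instance
        exact Measurable.lintegral_kernel_prod_right' (κ := (meanKernel ν (M.rewΘ h)).comap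
          (fun q : (Prefix S A n × S) × A => (q.1.2, q.2)) (by fun_prop)) hG2
      have hG0 : Measurable fun p : Prefix S A n × S => ∫⁻ a, ∫⁻ r, ∫⁻ s',
          F (appendStep ((p, a), (r, s'))) ∂(meanKernel ν (M.transΘ h) (p.2, a))
            ∂(meanKernel ν (M.rewΘ h) (p.2, a)) ∂(σ.kernel h (θ', p.2)) :=
        Measurable.lintegral_kernel_prod_right' (κ := (σ.kernel h).comap
          (fun p : Prefix S A n × S => (θ', p.2)) (by fun_prop)) hG1
      calc ∫⁻ θ, ∫⁻ w, F w ∂(prefixOf σ (n + 1) hn (θ, θ')) ∂ν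
          = ∫⁻ θ, ∫⁻ w, ∫⁻ s', F (appendStep (w.1, (w.2, s')))
              ∂(M.transΘ h (θ, (w.1.1.2, w.1.2))) ∂(κ₂ θ) ∂ν := by
            refine lintegral_congr fun θ => ?_
            have hm2 : Measurable fun q : ((Prefix S A n × S) × A) × unitInterval =>
                ∫⁻ s', F (appendStep (q.1, (q.2, s'))) ∂(M.transΘ h (θ, (q.1.1.2, q.1.2))) :=
              Measurable.lintegral_kernel_prod_right' (κ := (M.transΘ h).comap
                (fun q : ((Prefix S A n × S) × A) × unitInterval => (θ, (q.1.1.2, q.1.2)))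
                (by fun_prop)) hF'
            have hm1 : Measurable fun q : (Prefix S A n × S) × A =>
                ∫⁻ r, ∫⁻ s', F (appendStep (q, (r, s'))) ∂(M.transΘ h (θ, (q.1.2, q.2)))
                  ∂(M.rewΘ h (θ, (q.1.2, q.2))) :=
              Measurable.lintegral_kernel_prod_right' (κ := (M.rewΘ h).comap
                (fun q : (Prefix S A n × S) × A => (θ, (q.1.2, q.2))) (by fun_prop)) hm2
            rw [hκ₂ θ hm2, hκ₁ θ hm1, prefixOf, lintegral_prefixKernel_succ _ _ _ _ _ _ _ hF]
            rfl
        _ = ∫⁻ θ, ∫⁻ w, ∫⁻ s', F (appendStep (w.1, (w.2, s')))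
              ∂(meanKernel ν (M.transΘ h) (w.1.1.2, w.1.2)) ∂(κ₂ θ) ∂ν :=
            lintegral_kernel_eq_meanKernel (hν.lintegral_replaceP h) κ₂ hinv₂ (M.transΘ h)
              (fun θ t v => by simp [transΘ, replaceP, Kernel.comap_apply])
              (v := fun w => (w.1.1.2, w.1.2)) (by fun_prop) hF'
        _ = ∫⁻ θ, ∫⁻ w, ∫⁻ r, ∫⁻ s', F (appendStep (w, (r, s')))
              ∂(meanKernel ν (M.transΘ h) (w.1.2, w.2)) ∂(M.rewΘ h (θ, (w.1.2, w.2)))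
              ∂(κ₁ θ) ∂ν := by
            refine lintegral_congr fun θ => ?_
            rw [hκ₂ θ hG2]
        _ = ∫⁻ θ, ∫⁻ w, ∫⁻ r, ∫⁻ s', F (appendStep (w, (r, s')))
              ∂(meanKernel ν (M.transΘ h) (w.1.2, w.2)) ∂(meanKernel ν (M.rewΘ h) (w.1.2, w.2))
              ∂(κ₁ θ) ∂ν :=
            lintegral_kernel_eq_meanKernel (hν.lintegral_replaceR h) κ₁ hinv₁ (M.rewΘ h)
              (fun θ t v => by simp [rewΘ, replaceR, Kernel.comap_apply])
              (v := fun w => (w.1.2, w.2)) (by fun_prop) hG2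
        _ = ∫⁻ θ, ∫⁻ p, ∫⁻ a, ∫⁻ r, ∫⁻ s', F (appendStep ((p, a), (r, s')))
              ∂(meanKernel ν (M.transΘ h) (p.2, a)) ∂(meanKernel ν (M.rewΘ h) (p.2, a))
              ∂(σ.kernel h (θ', p.2)) ∂(prefixOf σ n (by omega) (θ, θ')) ∂ν := by
            refine lintegral_congr fun θ => ?_
            rw [hκ₁ θ hG1]
        _ = _ := by
            rw [ih (by omega) hG0, prefixIn, prefixIn,
              lintegral_prefixKernel_succ _ _ _ _ _ _ _ hF]
            rfl

end Model

end BayesRL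

/-! ### Cells of the partition, the surrogate, and exchange of occupancy measures -/

namespace BayesRL

namespace Model

variable {S A : Type*} [MeasurableSpace S] [MeasurableSpace A] {H : ℕ}
  {ΘP ΘR : Fin H → Type*} [∀ h, MeasurableSpace (ΘP h)] [∀ h, MeasurableSpace (ΘR h)]
  {M : Model S A ΘP ΘR} {Pi : Set (Policy S A H)} (σ : M.OptimalSelector Pi)

/-- Replace the parameters of layer `h` in `θ` by those in `t`. -/
def replaceLayer (h : Fin H) (θ t : Param ΘP ΘR) : Param ΘP ΘR :=
  (Function.update θ.1 h (t.1 h), Function.update θ.2 h (t.2 h))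

theorem measurable_replaceLayer (h : Fin H) :
    Measurable fun q : Param ΘP ΘR × Param ΘP ΘR => replaceLayer h q.1 q.2 :=
  (measurable_update'.comp (f := fun q : Param ΘP ΘR × Param ΘP ΘR => (q.1.1, q.2.1 h))
    (by fun_prop)).prodMk (measurable_update'.comp
      (f := fun q : Param ΘP ΘR × Param ΘP ΘR => (q.1.2, q.2.2 h)) (by fun_prop))

theorem measurable_replaceP (h : Fin H) :
    Measurable fun q : Param ΘP ΘR × Param ΘP ΘR => replaceP h q.1 q.2 :=
  (measurable_update'.comp (f := fun q : Param ΘP ΘR × Param ΘP ΘR => (q.1.1, q.2.1 h))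
    (by fun_prop)).prodMk (by fun_prop)

section Layer

variable [∀ h, Nonempty (ΘP h)] [∀ h, Nonempty (ΘR h)] {ν : Measure (Param ΘP ΘR)}
  [IsProbabilityMeasure ν]

theorem CoordIndep.lintegral_replaceLayer (hν : CoordIndep ν) (h : Fin H)
    {Ψ : Param ΘP ΘR → ℝ≥0∞} (hΨ : Measurable Ψ) :
    ∫⁻ θ, Ψ θ ∂ν = ∫⁻ θ, ∫⁻ t, Ψ (replaceLayer h θ t) ∂ν ∂ν := by
  have hP := measurable_replaceP (ΘP := ΘP) (ΘR := ΘR) h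
  have hL := measurable_replaceLayer (ΘP := ΘP) (ΘR := ΘR) h
  have hm : Measurable fun θ => ∫⁻ t, Ψ (replaceP h θ t) ∂ν :=
    Measurable.lintegral_prod_right' (f := fun q : Param ΘP ΘR × Param ΘP ΘR =>
      Ψ (replaceP h q.1 q.2)) (by fun_prop)
  rw [hν.lintegral_replaceP h hΨ, hν.lintegral_replaceR h hm]
  refine lintegral_congr fun θ => ?_
  -- The left side uses separate copies for the transition and the reward. On the right the single
  -- copy is split in two by resampling its transition.
  rw [hν.lintegral_replaceP h (Ψ := fun t => Ψ (replaceLayer h θ t))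
    (hΨ.comp (hL.comp measurable_prodMk_left))]
  refine lintegral_congr fun s => lintegral_congr fun t => ?_
  simp [replaceP, replaceR, replaceLayer]

variable {c : ∀ h, ΘP h × ΘR h → ℕ} {K : ℕ} {ζ : Param ΘP ΘR → Fin K}

/-- The law of the parameters of layer `h`, conditionally on the cell, depends only on the label
of layer `h`. -/
theorem CoordIndep.lintegral_cond_cell (hν : CoordIndep ν) (hc : ∀ h, Measurable (c h))
    (hζ : Measurable ζ)
    (hcζ : ∀ θ θ', ζ θ = ζ θ' ↔ ∀ h, c h (θ.1 h, θ.2 h) = c h (θ'.1 h, θ'.2 h)) (h : Fin H)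
    (θ₀ : Param ΘP ΘR) (h₀ : ν (ζ ⁻¹' {ζ θ₀}) ≠ 0) {Ψ : Param ΘP ΘR → ℝ≥0∞} (hΨ : Measurable Ψ)
    (hΨL : ∀ θ t, Ψ (replaceLayer h θ t) = Ψ t) :
    ∫⁻ θ, Ψ θ ∂(ν[|ζ ⁻¹' {ζ θ₀}]) =
      ∫⁻ θ, Ψ θ ∂(ν[|{θ | c h (θ.1 h, θ.2 h) = c h (θ₀.1 h, θ₀.2 h)}]) := by
  set C : Set (Param ΘP ΘR) := {θ | c h (θ.1 h, θ.2 h) = c h (θ₀.1 h, θ₀.2 h)} with hCdef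
  set B : Set (Param ΘP ΘR) := {θ | ∀ j, j ≠ h → c j (θ.1 j, θ.2 j) = c j (θ₀.1 j, θ₀.2 j)}
  have hC : MeasurableSet C :=
    ((hc h).comp (by fun_prop : Measurable fun θ : Param ΘP ΘR => (θ.1 h, θ.2 h)))
      (measurableSet_singleton _)
  have hB : MeasurableSet B := by
    have : B = ⋂ j, ⋂ _ : j ≠ h, {θ | c j (θ.1 j, θ.2 j) = c j (θ₀.1 j, θ₀.2 j)} := by
      ext θ; simp [B]
    rw [this]
    exact MeasurableSet.iInter fun j => MeasurableSet.iInter fun _ =>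
      ((hc j).comp (by fun_prop : Measurable fun θ : Param ΘP ΘR => (θ.1 j, θ.2 j)))
        (measurableSet_singleton _)
  have hZ : MeasurableSet (ζ ⁻¹' {ζ θ₀}) := hζ (measurableSet_singleton _)
  -- This is where layeredness enters: after resampling layer `h`, membership in the cell is a
  -- condition `B` on the other layers of `θ` and a condition `C` on layer `h` of `t`. The factor `ν
  -- B` then cancels on normalisation.
  have hind : ∀ θ t, (ζ ⁻¹' {ζ θ₀}).indicator (1 : Param ΘP ΘR → ℝ≥0∞) (replaceLayer h θ t) =
      B.indicator 1 θ * C.indicator 1 t := by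
    intro θ t
    have : replaceLayer h θ t ∈ ζ ⁻¹' {ζ θ₀} ↔ θ ∈ B ∧ t ∈ C := by
      rw [Set.mem_preimage, Set.mem_singleton_iff, hcζ]
      constructor
      · intro hj
        refine ⟨fun j hjh => ?_, ?_⟩
        · simpa [replaceLayer, hjh] using hj j
        · rw [hCdef, Set.mem_ofPred_eq]; simpa [replaceLayer] using hj h
      · rintro ⟨h1, h2⟩ j
        by_cases hjh : j = h
        · subst hjh; rw [hCdef, Set.mem_ofPred_eq] at h2; simpa [replaceLayer] using h2
        · simpa [replaceLayer, hjh] using h1 j hjh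
    by_cases h1 : θ ∈ B <;> by_cases h2 : t ∈ C <;> simp [Set.indicator, this, h1, h2]
  have key : ∀ Φ : Param ΘP ΘR → ℝ≥0∞, Measurable Φ → (∀ θ t, Φ (replaceLayer h θ t) = Φ t) →
      ∫⁻ θ in ζ ⁻¹' {ζ θ₀}, Φ θ ∂ν = ν B * ∫⁻ θ in C, Φ θ ∂ν := by
    intro Φ hΦ hΦL
    have e : ∀ (D : Set (Param ΘP ΘR)), MeasurableSet D →
        ∫⁻ θ in D, Φ θ ∂ν = ∫⁻ θ, D.indicator 1 θ * Φ θ ∂ν := by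
      intro D hD
      rw [← lintegral_indicator hD]
      refine lintegral_congr fun θ => ?_
      by_cases hθ : θ ∈ D <;> simp [hθ]
    rw [e _ hZ, e _ hC, hν.lintegral_replaceLayer h
      (Ψ := fun θ => (ζ ⁻¹' {ζ θ₀}).indicator 1 θ * Φ θ) ((measurable_one.indicator hZ).mul hΦ)]
    simp_rw [hind, hΦL, mul_assoc]
    have hm : Measurable fun t => C.indicator 1 t * Φ t := (measurable_one.indicator hC).mul hΦ
    simp_rw [lintegral_const_mul _ hm]
    rw [lintegral_mul_const _ (measurable_one.indicator hB), lintegral_indicator_one hB]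
  have h1 := key 1 measurable_one fun _ _ => rfl
  simp only [Pi.one_apply, lintegral_one, Measure.restrict_apply MeasurableSet.univ,
    Set.univ_inter] at h1
  have hB0 : ν B ≠ 0 := fun h0 => h₀ (by rw [h1, h0, zero_mul])
  rw [ProbabilityTheory.cond, ProbabilityTheory.cond, lintegral_smul_measure,
    lintegral_smul_measure, key Ψ hΨ hΨL, h1, smul_eq_mul, smul_eq_mul,
    ENNReal.mul_inv (Or.inl hB0) (Or.inl (measure_ne_top _ _)), mul_comm (ν B)⁻¹, mul_assoc,
    ← mul_assoc (ν B)⁻¹, ENNReal.inv_mul_cancel hB0 (measure_ne_top _ _), one_mul]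

end Layer

theorem meanEnv_trans (ν : Measure (Param ΘP ΘR)) [IsProbabilityMeasure ν] (h : Fin H) :
    (M.meanEnv ν).trans h = meanKernel ν (M.transΘ h) := rfl

theorem meanEnv_rew (ν : Measure (Param ΘP ΘR)) [IsProbabilityMeasure ν] (h : Fin H) :
    (M.meanEnv ν).rew h = meanKernel ν (M.rewΘ h) := rfl

theorem lintegral_occupancy (E : Env S A H) (θ' : Param ΘP ΘR) (h : Fin H) {G : S × A → ℝ≥0∞}
    (hG : Measurable G) :
    ∫⁻ x, G x ∂(occupancy σ E θ' h) =
      ∫⁻ p, ∫⁻ a, G (p.2, a) ∂(σ.kernel h (θ', p.2)) ∂(prefixIn σ E h h.2.le θ') := by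
  rw [occupancy, lintegral_map hG (by fun_prop)]
  exact lintegral_stateAction_prefixKernel _ _ _ _ _ h hG H le_rfl h.2

section Cell

variable {ν : Measure (Param ΘP ΘR)} [IsProbabilityMeasure ν] {K : ℕ} {ζ : Param ΘP ΘR → Fin K}

theorem cellEnv_of_ne_zero {k : Fin K} (hk : ν (ζ ⁻¹' {k}) ≠ 0)
    [IsProbabilityMeasure (ν[|ζ ⁻¹' {k}])] :
    cellEnv M ν ζ k = M.meanEnv (ν[|ζ ⁻¹' {k}]) := by
  rw [cellEnv, dif_pos hk]

theorem lintegral_comp_label {ν : Measure (Param ΘP ΘR)} (hζ : Measurable ζ) (G : Fin K → ℝ≥0∞) :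
    ∫⁻ θ, G (ζ θ) ∂ν = ∑ k, ν (ζ ⁻¹' {k}) * G k := by
  rw [← lintegral_map (f := G) (by fun_prop) hζ, lintegral_fintype]
  refine Finset.sum_congr rfl fun k _ => ?_
  rw [Measure.map_apply hζ (measurableSet_singleton k), mul_comm]

theorem lintegral_eq_sum_cell (hζ : Measurable ζ) (Ψ : Param ΘP ΘR → ℝ≥0∞) :
    ∫⁻ θ, Ψ θ ∂ν = ∑ k, ν (ζ ⁻¹' {k}) * ∫⁻ θ, Ψ θ ∂(ν[|ζ ⁻¹' {k}]) := by
  conv_lhs => rw [← sum_meas_smul_cond_fiber hζ ν]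
  rw [lintegral_finsetSum_measure]
  simp

theorem ae_cell_ne_zero (ν : Measure (Param ΘP ΘR)) [IsProbabilityMeasure ν] :
    ∀ᵐ θ ∂ν, ν (ζ ⁻¹' {ζ θ}) ≠ 0 := by
  have : ∀ k, ∀ᵐ θ ∂ν, ν (ζ ⁻¹' {k}) = 0 → θ ∉ ζ ⁻¹' {k} := by
    intro k
    by_cases hk : ν (ζ ⁻¹' {k}) = 0
    · filter_upwards [measure_eq_zero_iff_ae_notMem.1 hk] with θ hθ _ using hθ
    · exact Filter.Eventually.of_forall fun θ h => absurd h hk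
  filter_upwards [ae_all_iff.2 this] with θ hθ h0
  exact hθ _ h0 rfl

variable [∀ h, Nonempty (ΘP h)] [∀ h, Nonempty (ΘR h)] {c : ∀ h, ΘP h × ΘR h → ℕ}

/-- The layer-`h` kernels of a mean environment depend only on the law of the layer-`h` parameters,
and within a cell this law is determined by the label of layer `h`. Null cells are excluded because
the surrogate has a default value there. -/
theorem surrogate_layer_congr (hν : CoordIndep ν) (hc : ∀ h, Measurable (c h)) (hζ : Measurable ζ)
    (hcζ : ∀ θ θ', ζ θ = ζ θ' ↔ ∀ h, c h (θ.1 h, θ.2 h) = c h (θ'.1 h, θ'.2 h)) (h : Fin H)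
    {θ t : Param ΘP ΘR} (hθ : ν (ζ ⁻¹' {ζ θ}) ≠ 0) (ht : ν (ζ ⁻¹' {ζ t}) ≠ 0)
    (hct : c h (θ.1 h, θ.2 h) = c h (t.1 h, t.2 h)) :
    (surrogate M ν ζ θ).trans h = (surrogate M ν ζ t).trans h ∧
      (surrogate M ν ζ θ).rew h = (surrogate M ν ζ t).rew h := by
  have := cond_isProbabilityMeasure hθ
  have := cond_isProbabilityMeasure ht
  have key : ∀ Ψ : Param ΘP ΘR → ℝ≥0∞, Measurable Ψ →
      (∀ θ t, Ψ (replaceLayer h θ t) = Ψ t) →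
      ∫⁻ θ, Ψ θ ∂(ν[|ζ ⁻¹' {ζ θ}]) = ∫⁻ θ, Ψ θ ∂(ν[|ζ ⁻¹' {ζ t}]) := by
    intro Ψ hΨ hΨL
    rw [hν.lintegral_cond_cell hc hζ hcζ h θ hθ hΨ hΨL,
      hν.lintegral_cond_cell hc hζ hcζ h t ht hΨ hΨL, hct]
  rw [surrogate, surrogate, cellEnv_of_ne_zero hθ, cellEnv_of_ne_zero ht]
  refine ⟨Kernel.ext fun x => Measure.ext_of_lintegral _ fun F hF => ?_,
    Kernel.ext fun x => Measure.ext_of_lintegral _ fun F hF => ?_⟩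
  · rw [meanEnv_trans, meanEnv_trans, lintegral_meanKernel _ _ _ hF, lintegral_meanKernel _ _ _ hF]
    refine key _ ((hF.lintegral_kernel (κ := M.transΘ h)).comp measurable_prodMk_right)
      fun θ t => ?_
    simp [transΘ, Kernel.comap_apply, replaceLayer]
  · rw [meanEnv_rew, meanEnv_rew, lintegral_meanKernel _ _ _ hF, lintegral_meanKernel _ _ _ hF]
    refine key _ ((hF.lintegral_kernel (κ := M.rewΘ h)).comp measurable_prodMk_right)
      fun θ t => ?_
    simp [rewΘ, Kernel.comap_apply, replaceLayer]

/-- The mean over the cells of the law of an episode in the surrogate environment is its law in the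
mean environment. -/
theorem lintegral_prefixIn_surrogate (hν : CoordIndep ν) (hζ : Measurable ζ)
    (hcell : ∀ k, ν (ζ ⁻¹' {k}) ≠ 0 → CoordIndep (ν[|ζ ⁻¹' {k}])) (θ' : Param ΘP ΘR) (n : ℕ)
    (hn : n ≤ H) {F : Prefix S A n × S → ℝ≥0∞} (hF : Measurable F) :
    ∫⁻ θ, ∫⁻ w, F w ∂(prefixIn σ (surrogate M ν ζ θ) n hn θ') ∂ν =
      ∫⁻ w, F w ∂(prefixIn σ (M.meanEnv ν) n hn θ') := by
  -- Tower property: the mean environment averages episodes over `ν`, which is done cell by cell,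
  -- and within a cell the average is an episode in its surrogate.
  rw [← lintegral_prefixOf σ hν θ' n hn hF,
    lintegral_eq_sum_cell hζ fun θ => ∫⁻ w, F w ∂(prefixOf σ n hn (θ, θ'))]
  refine (lintegral_comp_label (ν := ν) hζ fun k => ∫⁻ w, F w ∂(prefixIn σ (cellEnv M ν ζ k) n hn θ')).trans
    (Finset.sum_congr rfl fun k _ => ?_)
  by_cases hk : ν (ζ ⁻¹' {k}) = 0
  · simp [hk]
  · have := cond_isProbabilityMeasure hk
    rw [cellEnv_of_ne_zero hk, lintegral_prefixOf σ (hcell k hk) θ' n hn hF]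

/-- The occupancy measure of the surrogate environment may be replaced by the one of the mean
environment: the parameters of a layer are independent of those of the preceding layers. -/
theorem lintegral_occupancy_surrogate (hν : CoordIndep ν) (hc : ∀ h, Measurable (c h))
    (hζ : Measurable ζ)
    (hcζ : ∀ θ θ', ζ θ = ζ θ' ↔ ∀ h, c h (θ.1 h, θ.2 h) = c h (θ'.1 h, θ'.2 h))
    (hcell : ∀ k, ν (ζ ⁻¹' {k}) ≠ 0 → CoordIndep (ν[|ζ ⁻¹' {k}])) (θ' : Param ΘP ΘR) (h : Fin H)
    {f : Env S A H → S × A → ℝ≥0∞} (hf : ∀ E, Measurable (f E))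
    (hfc : ∀ E E' : Env S A H, E.trans h = E'.trans h → E.rew h = E'.rew h → f E = f E') :
    ∫⁻ θ, ∫⁻ x, f (surrogate M ν ζ θ) x ∂(occupancy σ (surrogate M ν ζ θ) θ' h) ∂ν =
      ∫⁻ θ, ∫⁻ x, f (surrogate M ν ζ θ) x ∂(occupancy σ (M.meanEnv ν) θ' h) ∂ν := by
  have hL := measurable_replaceLayer (ΘP := ΘP) (ΘR := ΘR) h
  have hΦ : ∀ E, Measurable fun p : Prefix S A h × S =>
      ∫⁻ a, f E (p.2, a) ∂(σ.kernel h (θ', p.2)) := fun E =>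
    Measurable.lintegral_kernel_prod_right' (κ := (σ.kernel h).comap
      (fun p : Prefix S A h × S => (θ', p.2)) (by fun_prop))
      (f := fun q : (Prefix S A h × S) × A => f E (q.1.2, q.2)) ((hf E).comp (by fun_prop))
  -- The resampled parameter again has law `ν`, so it almost surely avoids the null cells, where the
  -- surrogate is only a default.
  have hgood : ∀ᵐ θ ∂ν, ∀ᵐ t ∂ν, ν (ζ ⁻¹' {ζ (replaceLayer h θ t)}) ≠ 0 := by
    let b : Fin K → ℝ≥0∞ := fun k => if ν (ζ ⁻¹' {k}) = 0 then 1 else 0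
    have hb : Measurable fun θ => b (ζ θ) := (Measurable.of_discrete (f := b)).comp hζ
    have h1 : ∫⁻ θ, b (ζ θ) ∂ν = 0 := by
      rw [lintegral_eq_zero_iff hb]
      filter_upwards [ae_cell_ne_zero (ζ := ζ) ν] with θ hθ
      simp [b, hθ]
    have hbL : Measurable fun q : Param ΘP ΘR × Param ΘP ΘR => b (ζ (replaceLayer h q.1 q.2)) :=
      hb.comp hL
    rw [hν.lintegral_replaceLayer h hb, lintegral_eq_zero_iff hbL.lintegral_prod_right'] at h1
    filter_upwards [h1] with θ hθ
    have h2 := (lintegral_eq_zero_iff (hbL.comp measurable_prodMk_left)).1 hθ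
    filter_upwards [h2] with t ht h0
    simp [b, h0] at ht
  -- `G` separates two roles of the cell: `k` governs the law of the past, `l` the integrand at
  -- layer `h`.
  let G : Fin K → Fin K → ℝ≥0∞ := fun k l => ∫⁻ p, ∫⁻ a, f (cellEnv M ν ζ l) (p.2, a)
    ∂(σ.kernel h (θ', p.2)) ∂(prefixIn σ (cellEnv M ν ζ k) h h.2.le θ')
  have hG : Measurable fun q : Param ΘP ΘR × Param ΘP ΘR => G (ζ q.1) (ζ q.2) :=
    (Measurable.of_discrete (f := fun q : Fin K × Fin K => G q.1 q.2)).comp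
      (f := fun q : Param ΘP ΘR × Param ΘP ΘR => (ζ q.1, ζ q.2)) (by fun_prop)
  have hGd : Measurable fun θ : Param ΘP ΘR => G (ζ θ) (ζ θ) :=
    hG.comp (f := fun θ : Param ΘP ΘR => (θ, θ)) (by fun_prop)
  simp_rw [lintegral_occupancy σ _ θ' h (hf _)]
  calc ∫⁻ θ, ∫⁻ p, ∫⁻ a, f (surrogate M ν ζ θ) (p.2, a) ∂(σ.kernel h (θ', p.2))
        ∂(prefixIn σ (surrogate M ν ζ θ) h h.2.le θ') ∂ν
      = ∫⁻ θ, G (ζ θ) (ζ θ) ∂ν := rfl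
    _ = ∫⁻ θ, ∫⁻ t, G (ζ (replaceLayer h θ t)) (ζ (replaceLayer h θ t)) ∂ν ∂ν :=
        hν.lintegral_replaceLayer h hGd
    -- After resampling, the surrogate agrees with that of `t` in layer `h` and with that of `θ` in
    -- all earlier layers, so the two roles decouple.
    _ = ∫⁻ θ, ∫⁻ t, G (ζ θ) (ζ t) ∂ν ∂ν := by
        refine lintegral_congr_ae ?_
        filter_upwards [hgood, ae_cell_ne_zero (ζ := ζ) ν] with θ hθ1 hθ2
        refine lintegral_congr_ae ?_
        filter_upwards [hθ1, ae_cell_ne_zero (ζ := ζ) ν] with t ht1 ht2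
        have e1 := surrogate_layer_congr (M := M) hν hc hζ hcζ h ht1 ht2
          (by simp [replaceLayer])
        have e2 : prefixIn σ (surrogate M ν ζ (replaceLayer h θ t)) h h.2.le θ' =
            prefixIn σ (surrogate M ν ζ θ) h h.2.le θ' := by
          have e3 : ∀ j : Fin H, (j : ℕ) < h →
              (surrogate M ν ζ (replaceLayer h θ t)).trans j = (surrogate M ν ζ θ).trans j ∧
              (surrogate M ν ζ (replaceLayer h θ t)).rew j = (surrogate M ν ζ θ).rew j := by
            intro j hj
            have hne : j ≠ h := fun hjh => by subst hjh; exact lt_irrefl _ hj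
            exact surrogate_layer_congr hν hc hζ hcζ j ht1 hθ2 (by simp [replaceLayer, hne])
          refine prefixKernel_congr _ _ _ _ _ _ _ _ (fun j hj x => ?_) (fun j hj x => ?_)
            fun j hj x => rfl
          · simp [Kernel.prodMkLeft_apply, (e3 j hj).1]
          · simp [Kernel.prodMkLeft_apply, (e3 j hj).2]
        have e4 := hfc _ _ e1.1 e1.2
        change ∫⁻ p, ∫⁻ a, f (surrogate M ν ζ (replaceLayer h θ t)) (p.2, a)
          ∂(σ.kernel h (θ', p.2))
          ∂(prefixIn σ (surrogate M ν ζ (replaceLayer h θ t)) h h.2.le θ') = _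
        rw [e2, e4]
        rfl
    _ = ∫⁻ t, ∫⁻ θ, G (ζ θ) (ζ t) ∂ν ∂ν := lintegral_lintegral_swap hG.aemeasurable
    _ = _ := by
        refine lintegral_congr fun t => ?_
        exact lintegral_prefixIn_surrogate σ hν hζ hcell θ' h h.2.le (hΦ _)

end Cell

end Model

end BayesRL

/-! ### Mutual information as an averaged divergence, and its chain rule -/

namespace BayesRL

section Trajectories

variable {Z S A : Type*} [MeasurableSpace Z] [MeasurableSpace S] [MeasurableSpace A] {H : ℕ}

/-- The first `H - 1` layers obey the full chain rule, states included, since the state in which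
layer `H - 1` is played is recorded with it. Only the draw of the terminal state is missing, and `h
+ 1 < H` singles out the layers before the last. -/
theorem klDiv_map_fst_prefixKernel [MeasurableSpace.CountablyGenerated S]
    (P P' : Fin H → Kernel (Z × (S × A)) S) (R R' : Fin H → Kernel (Z × (S × A)) unitInterval)
    (π : Fin H → Kernel (Z × S) A) (s₁ : S)
    [∀ h, IsMarkovKernel (P h)] [∀ h, IsMarkovKernel (R h)] [∀ h, IsMarkovKernel (P' h)]
    [∀ h, IsMarkovKernel (R' h)] [∀ h, IsMarkovKernel (π h)] (z : Z) :
    klDiv ((prefixKernel P R π s₁ H le_rfl z).map Prod.fst)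
        ((prefixKernel P' R' π s₁ H le_rfl z).map Prod.fst) =
      ∑ h : Fin H, ∫⁻ p, ∫⁻ a, (if (h : ℕ) + 1 < H then klDiv
            ((P h (z, (p.2, a))).prod (R h (z, (p.2, a))))
            ((P' h (z, (p.2, a))).prod (R' h (z, (p.2, a))))
            else klDiv (R h (z, (p.2, a))) (R' h (z, (p.2, a))))
          ∂(π h (z, p.2)) ∂(prefixKernel P R π s₁ h h.2.le z) := by
  cases H with
  | zero => simp [prefixKernel_zero_apply]
  | succ n =>
      rw [klDiv_map_fst_prefixKernel_succ, klDiv_prefixKernel, Fin.sum_univ_castSucc]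
      congr 1
      · refine Finset.sum_congr rfl fun h _ => ?_
        have : (h.castSucc : ℕ) + 1 < n + 1 := by simp
        simp_rw [if_pos this]
        rfl
      · have : ¬ ((Fin.last n : Fin (n + 1)) : ℕ) + 1 < n + 1 := by simp
        simp_rw [if_neg this]
        rfl

end Trajectories

namespace Model

variable {S A : Type*} [MeasurableSpace S] [MeasurableSpace A] {H : ℕ}
  {ΘP ΘR : Fin H → Type*} [∀ h, MeasurableSpace (ΘP h)] [∀ h, MeasurableSpace (ΘR h)]
  {M : Model S A ΘP ΘR} {Pi : Set (Policy S A H)} (σ : M.OptimalSelector Pi)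

theorem measurable_klDiv_transition_reward [MeasurableSpace.CountablyGenerated S]
    (E E' : Env S A H) (h : Fin H) : Measurable fun x : S × A =>
      klDiv ((E.trans h x).prod (E.rew h x)) ((E'.trans h x).prod (E'.rew h x)) := by
  have := measurable_klDiv_kernel (E.trans h ×ₖ E.rew h) (E'.trans h ×ₖ E'.rew h)
  simpa only [Kernel.prod_apply] using this

theorem klDiv_episodeIn [MeasurableSpace.CountablyGenerated S]
    (E E' : Env S A H) (θ' : Param ΘP ΘR) :
    klDiv (episodeIn σ E θ') (episodeIn σ E' θ') = ∑ h : Fin H,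
      ∫⁻ x, klDiv ((E.trans h x).prod (E.rew h x)) ((E'.trans h x).prod (E'.rew h x))
        ∂(occupancy σ E θ' h) := by
  simp_rw [lintegral_occupancy σ _ θ' _ (measurable_klDiv_transition_reward E E' _)]
  exact klDiv_prefixKernel _ _ _ _ _ _ H le_rfl θ'

theorem measurable_klDiv_record_fst [MeasurableSpace.CountablyGenerated S]
    (E E' : Env S A H) (h : Fin H) : Measurable fun x : S × A =>
      if (h : ℕ) + 1 < H then
        klDiv ((E.trans h x).prod (E.rew h x)) ((E'.trans h x).prod (E'.rew h x))
      else klDiv (E.rew h x) (E'.rew h x) := by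
  split_ifs
  · exact measurable_klDiv_transition_reward E E' h
  · exact measurable_klDiv_kernel _ _

theorem klDiv_map_fst_episodeIn [MeasurableSpace.CountablyGenerated S]
    (E E' : Env S A H) (θ' : Param ΘP ΘR) :
    klDiv ((episodeIn σ E θ').map Prod.fst) ((episodeIn σ E' θ').map Prod.fst) = ∑ h : Fin H,
      ∫⁻ x, (if (h : ℕ) + 1 < H then
        klDiv ((E.trans h x).prod (E.rew h x)) ((E'.trans h x).prod (E'.rew h x))
        else klDiv (E.rew h x) (E'.rew h x)) ∂(occupancy σ E θ' h) := by
  simp_rw [lintegral_occupancy σ _ θ' _ (measurable_klDiv_record_fst E E' _)]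
  exact klDiv_map_fst_prefixKernel _ _ _ _ _ _ θ'

instance (E : Env S A H) : IsMarkovKernel (episodeIn σ E) := by
  unfold episodeIn
  infer_instance

theorem measurable_surrogate {ν : Measure (Param ΘP ΘR)} [IsProbabilityMeasure ν] {K : ℕ}
    {ζ : Param ΘP ΘR → Fin K} (hζ : Measurable ζ) : Measurable (surrogate M ν ζ) :=
  (Measurable.of_discrete (f := cellEnv M ν ζ)).comp hζ

section MutualInformation

variable [∀ h, Nonempty (ΘP h)] [∀ h, Nonempty (ΘR h)] {ν : Measure (Param ΘP ΘR)}
  [IsProbabilityMeasure ν] {K : ℕ} {ζ : Param ΘP ΘR → Fin K} {c : ∀ h, ΘP h × ΘR h → ℕ}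
  {O : Type*} [MeasurableSpace O] {obs : Traj S A H → O} (hobs : Measurable obs)

theorem lintegral_record (hν : CoordIndep ν) (θ' : Param ΘP ΘR) {F : O → ℝ≥0∞}
    (hF : Measurable F) :
    ∫⁻ θ, ∫⁻ o, F o ∂(record σ obs hobs (θ, θ')) ∂ν =
      ∫⁻ o, F o ∂((episodeIn σ (M.meanEnv ν) θ').map obs) := by
  rw [lintegral_map hF hobs]
  refine Eq.trans ?_ (lintegral_prefixOf σ hν θ' H le_rfl (hF.comp hobs))
  refine lintegral_congr fun θ => ?_
  rw [record, Kernel.deterministic_comp_eq_map, Kernel.map_apply _ hobs, lintegral_map hF hobs]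
  rfl

/-- The law of the record in an environment `E`, as a kernel in `E`. -/
noncomputable def recordIn (θ' : Param ΘP ΘR) (obs : Traj S A H → O) : Kernel (Env S A H) O where
  toFun E := (episodeIn σ E θ').map obs
  measurable' := measurable_from_top

/-- Within a cell, the record averaged over the conditioned posterior is an episode in the mean of
that cell. So the surrogate acts as input of a channel whose output is an episode in the surrogate,
with an episode in the mean environment as output marginal. Cells with equal surrogates cause no
trouble, as the channel depends on the environment only. -/
theorem mutualInfo_jointLaw [MeasurableSpace.CountablyGenerated O] (hν : CoordIndep ν)
    (hζ : Measurable ζ)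
    (hcell : ∀ k, ν (ζ ⁻¹' {k}) ≠ 0 → CoordIndep (ν[|ζ ⁻¹' {k}])) (θ' : Param ΘP ΘR) :
    mutualInfo (jointLaw σ obs hobs ν ζ θ') =
      ∫⁻ θ, klDiv ((episodeIn σ (surrogate M ν ζ θ) θ').map obs)
        ((episodeIn σ (M.meanEnv ν) θ').map obs) ∂ν := by
  have hs := measurable_surrogate (M := M) (ν := ν) hζ
  have hκ : IsMarkovKernel (recordIn σ θ' obs) :=
    ⟨fun E => Measure.isProbabilityMeasure_map hobs.aemeasurable⟩
  have hL : IsProbabilityMeasure ((episodeIn σ (M.meanEnv ν) θ').map obs) :=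
    Measure.isProbabilityMeasure_map hobs.aemeasurable
  have hm : IsProbabilityMeasure (ν.map (surrogate M ν ζ)) :=
    Measure.isProbabilityMeasure_map hs.aemeasurable
  have hJ : jointLaw σ obs hobs ν ζ θ' = ν.map (surrogate M ν ζ) ⊗ₘ recordIn σ θ' obs := by
    refine Measure.ext_of_lintegral _ fun F hF => ?_
    rw [jointLaw, lintegral_map hF (by fun_prop), Measure.lintegral_compProd (by fun_prop),
      Measure.lintegral_compProd hF, lintegral_map measurable_from_top hs,
      lintegral_eq_sum_cell hζ]
    refine Eq.trans ?_ (lintegral_comp_label (ν := ν) hζ fun k =>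
      ∫⁻ o, F (cellEnv M ν ζ k, o) ∂(recordIn σ θ' obs (cellEnv M ν ζ k))).symm
    refine Finset.sum_congr rfl fun k _ => ?_
    by_cases hk : ν (ζ ⁻¹' {k}) = 0
    · simp [hk]
    · have := cond_isProbabilityMeasure hk
      congr 1
      have hFk : Measurable fun o => F (cellEnv M ν ζ k, o) := hF.comp measurable_prodMk_left
      have h1 := lintegral_record σ hobs (hcell k hk) θ' hFk
      rw [← cellEnv_of_ne_zero hk] at h1
      refine Eq.trans (lintegral_congr_ae ?_) h1
      have h2 : ∀ᵐ θ ∂(ν[|ζ ⁻¹' {k}]), θ ∈ ζ ⁻¹' {k} :=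
        ae_cond_mem (hζ (measurableSet_singleton k))
      filter_upwards [h2] with θ hθ
      have : surrogate M ν ζ θ = cellEnv M ν ζ k := by rw [surrogate, hθ]
      simp only [this]
      rfl
  have hfst : (jointLaw σ obs hobs ν ζ θ').fst = ν.map (surrogate M ν ζ) := by
    rw [hJ, Measure.fst_compProd]
  have hsnd : (jointLaw σ obs hobs ν ζ θ').snd = (episodeIn σ (M.meanEnv ν) θ').map obs := by
    refine Measure.ext_of_lintegral _ fun F hF => ?_
    rw [hJ, Measure.snd, lintegral_map hF measurable_snd, Measure.lintegral_compProd (by fun_prop),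
      lintegral_map measurable_from_top hs, lintegral_map hF hobs]
    refine Eq.trans ?_
      (lintegral_prefixIn_surrogate σ hν hζ hcell θ' H le_rfl (hF.comp hobs))
    refine lintegral_congr fun θ => ?_
    exact lintegral_map hF hobs
  rw [mutualInfo, hfst, hsnd, hJ, ← Measure.compProd_const, klDiv_compProd_right_eq_lintegral,
    lintegral_map measurable_from_top hs]
  rfl

/-- The chain rule for the information on the surrogate environment in a recorded episode. -/
theorem tsMutualInfo_eq_sum [MeasurableSpace.CountablyGenerated O] (hν : CoordIndep ν)
    (hc : ∀ h, Measurable (c h)) (hζ : Measurable ζ)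
    (hcζ : ∀ θ θ', ζ θ = ζ θ' ↔ ∀ h, c h (θ.1 h, θ.2 h) = c h (θ'.1 h, θ'.2 h))
    (hcell : ∀ k, ν (ζ ⁻¹' {k}) ≠ 0 → CoordIndep (ν[|ζ ⁻¹' {k}]))
    {f : Fin H → Env S A H → S × A → ℝ≥0∞} (hf : ∀ h E, Measurable (f h E))
    (hfc : ∀ h (E E' : Env S A H), E.trans h = E'.trans h → E.rew h = E'.rew h → f h E = f h E')
    (hKL : ∀ E θ', klDiv ((episodeIn σ E θ').map obs) ((episodeIn σ (M.meanEnv ν) θ').map obs) =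
      ∑ h, ∫⁻ x, f h E x ∂(occupancy σ E θ' h)) :
    tsMutualInfo σ obs hobs ν ζ = ∑ h, tsExpect σ ν ζ h (f h) := by
  have hocc : ∀ (E : Env S A H) (h : Fin H) (G : S × A → ℝ≥0∞), Measurable G →
      Measurable fun θ' => ∫⁻ x, G x ∂(occupancy σ E θ' h) := by
    intro E h G hG
    have hm : Measurable fun w : Traj S A H => ((w.1 h).1, (w.1 h).2.1) := by fun_prop
    have := hG.lintegral_kernel (κ := (episodeIn σ E).map fun w => ((w.1 h).1, (w.1 h).2.1))
    simpa only [occupancy, Kernel.map_apply _ hm] using this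
  have hlab : ∀ G : Fin K → ℝ≥0∞, Measurable fun θ => G (ζ θ) := fun G =>
    (Measurable.of_discrete (f := G)).comp hζ
  -- Writing the average over `θ` as a finite sum over cells makes measurability in `θ'` evident and
  -- replaces the exchange of the two outer integrals by an exchange of sum and integral.
  have h1 : ∀ θ', mutualInfo (jointLaw σ obs hobs ν ζ θ') = ∑ h, ∑ k, ν (ζ ⁻¹' {k}) *
      ∫⁻ x, f h (cellEnv M ν ζ k) x ∂(occupancy σ (M.meanEnv ν) θ' h) := by
    intro θ'
    rw [mutualInfo_jointLaw σ hobs hν hζ hcell θ']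
    simp_rw [hKL]
    have hmeas : ∀ h, Measurable fun θ =>
        ∫⁻ x, f h (surrogate M ν ζ θ) x ∂(occupancy σ (surrogate M ν ζ θ) θ' h) := fun h =>
      hlab fun k => ∫⁻ x, f h (cellEnv M ν ζ k) x ∂(occupancy σ (cellEnv M ν ζ k) θ' h)
    rw [lintegral_finsetSum _ fun h _ => hmeas h]
    refine Finset.sum_congr rfl fun h _ => ?_
    rw [lintegral_occupancy_surrogate σ hν hc hζ hcζ hcell θ' h (hf h) (hfc h)]
    exact lintegral_comp_label hζ fun k =>
      ∫⁻ x, f h (cellEnv M ν ζ k) x ∂(occupancy σ (M.meanEnv ν) θ' h)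
  have h2 : ∀ h k, Measurable fun θ' => ν (ζ ⁻¹' {k}) *
      ∫⁻ x, f h (cellEnv M ν ζ k) x ∂(occupancy σ (M.meanEnv ν) θ' h) := fun h k =>
    (hocc _ _ _ (hf _ _)).const_mul _
  rw [tsMutualInfo]
  simp_rw [h1]
  rw [lintegral_finsetSum _ fun h _ => Finset.measurable_sum _ fun k _ => h2 h k]
  refine Finset.sum_congr rfl fun h _ => ?_
  rw [lintegral_finsetSum _ fun k _ => h2 h k, tsExpect]
  simp_rw [lintegral_const_mul _ (hocc _ _ _ (hf _ _))]
  exact (lintegral_comp_label hζ fun k => ∫⁻ θ', ∫⁻ x, f h (cellEnv M ν ζ k) x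
    ∂(occupancy σ (M.meanEnv ν) θ' h) ∂ν).symm

theorem tsMutualInfo_id [MeasurableSpace.CountablyGenerated S]
    [MeasurableSpace.CountablyGenerated A] (hν : CoordIndep ν) (hc : ∀ h, Measurable (c h))
    (hζ : Measurable ζ)
    (hcζ : ∀ θ θ', ζ θ = ζ θ' ↔ ∀ h, c h (θ.1 h, θ.2 h) = c h (θ'.1 h, θ'.2 h))
    (hcell : ∀ k, ν (ζ ⁻¹' {k}) ≠ 0 → CoordIndep (ν[|ζ ⁻¹' {k}])) :
    tsMutualInfo σ id measurable_id ν ζ = ∑ h : Fin H, tsExpect σ ν ζ h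
      (fun E x => klDiv ((E.trans h x).prod (E.rew h x))
        (((M.meanEnv ν).trans h x).prod ((M.meanEnv ν).rew h x))) := by
  refine tsMutualInfo_eq_sum σ measurable_id hν hc hζ hcζ hcell
    (fun h E => measurable_klDiv_transition_reward E _ h) (fun h E E' h1 h2 => by rw [h1, h2])
    fun E θ' => ?_
  rw [Measure.map_id, Measure.map_id, klDiv_episodeIn]

theorem tsMutualInfo_fst [MeasurableSpace.CountablyGenerated S]
    [MeasurableSpace.CountablyGenerated A] (hν : CoordIndep ν) (hc : ∀ h, Measurable (c h))
    (hζ : Measurable ζ)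
    (hcζ : ∀ θ θ', ζ θ = ζ θ' ↔ ∀ h, c h (θ.1 h, θ.2 h) = c h (θ'.1 h, θ'.2 h))
    (hcell : ∀ k, ν (ζ ⁻¹' {k}) ≠ 0 → CoordIndep (ν[|ζ ⁻¹' {k}])) :
    tsMutualInfo σ Prod.fst measurable_fst ν ζ = ∑ h : Fin H, tsExpect σ ν ζ h
      (fun E x => if (h : ℕ) + 1 < H then
        klDiv ((E.trans h x).prod (E.rew h x))
          (((M.meanEnv ν).trans h x).prod ((M.meanEnv ν).rew h x))
        else klDiv (E.rew h x) ((M.meanEnv ν).rew h x)) :=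
  tsMutualInfo_eq_sum σ measurable_fst hν hc hζ hcζ hcell
    (fun h E => measurable_klDiv_record_fst E _ h) (fun h E E' h1 h2 => by rw [h1, h2])
    fun E θ' => klDiv_map_fst_episodeIn σ E _ θ'

end MutualInformation

/-! ### Reward kernels that are not random -/

section DeterministicRewards

variable {ν : Measure (Param ΘP ΘR)} [IsProbabilityMeasure ν] {K : ℕ} {ζ : Param ΘP ΘR → Fin K}
  {g : Fin H → Kernel (S × A) unitInterval}

theorem ae_prior_rewΘ_eq (hg : ∀ h, ∀ᵐ t ∂(M.priorR h), ∀ x, M.rew h (t, x) = g h x) :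
    ∀ᵐ θ ∂M.prior, ∀ h x, M.rewΘ h (θ, x) = g h x := by
  refine ae_all_iff.2 fun h => ?_
  have h1 : M.prior.map (fun θ => θ.2 h) = M.priorR h := by
    have : (fun θ : Param ΘP ΘR => θ.2 h) = Function.eval h ∘ Prod.snd := rfl
    rw [this, ← Measure.map_map (measurable_pi_apply h) measurable_snd, prior,
      Measure.map_snd_prod, measure_univ, one_smul, (measurePreserving_eval M.priorR h).map_eq]
  have h2 := hg h
  rw [← h1] at h2
  exact ae_of_ae_map (by fun_prop) h2

theorem meanEnv_rew_eq (hg : ∀ᵐ θ ∂ν, ∀ h x, M.rewΘ h (θ, x) = g h x) (h : Fin H) (x : S × A) :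
    (M.meanEnv ν).rew h x = g h x := by
  refine Measure.ext_of_lintegral _ fun F hF => ?_
  rw [meanEnv_rew, lintegral_meanKernel _ _ _ hF]
  calc ∫⁻ θ, ∫⁻ y, F y ∂(M.rewΘ h (θ, x)) ∂ν = ∫⁻ _, ∫⁻ y, F y ∂(g h x) ∂ν := by
        refine lintegral_congr_ae ?_
        filter_upwards [hg] with θ hθ
        rw [hθ]
    _ = _ := by simp

/-- Averaging an almost surely constant kernel returns that kernel, whether or not one conditions on
a cell; the default value on a null cell is an average as well. -/
theorem surrogate_rew_eq (hg : ∀ᵐ θ ∂ν, ∀ h x, M.rewΘ h (θ, x) = g h x) (h : Fin H) (x : S × A)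
    (θ : Param ΘP ΘR) : (surrogate M ν ζ θ).rew h x = (M.meanEnv ν).rew h x := by
  rw [surrogate, meanEnv_rew_eq hg]
  by_cases hk : ν (ζ ⁻¹' {ζ θ}) = 0
  · rw [cellEnv, dif_neg (by simpa using hk), meanEnv_rew_eq hg]
  · have := cond_isProbabilityMeasure hk
    rw [cellEnv_of_ne_zero hk, meanEnv_rew_eq (cond_absolutelyContinuous.ae_le hg)]

theorem tsExpect_congr (h : Fin H) {f f' : Env S A H → S × A → ℝ≥0∞}
    (hff : ∀ θ x, f (surrogate M ν ζ θ) x = f' (surrogate M ν ζ θ) x) :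
    tsExpect σ ν ζ h f = tsExpect σ ν ζ h f' := by
  simp_rw [tsExpect, hff]

end DeterministicRewards

end Model

end BayesRL

/-! ### The information identity -/

theorem mainTheorem7 {S A : Type*} [MeasurableSpace S] [MeasurableSpace A]
    [MeasurableSpace.CountablyGenerated S] [MeasurableSpace.CountablyGenerated A] {H : ℕ}
    {ΘP ΘR : Fin H → Type*} [∀ h, MeasurableSpace (ΘP h)] [∀ h, MeasurableSpace (ΘR h)]
    [∀ h, StandardBorelSpace (ΘP h)] [∀ h, StandardBorelSpace (ΘR h)]
    [∀ h, Nonempty (ΘP h)] [∀ h, Nonempty (ΘR h)]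
    (M : BayesRL.Model S A ΘP ΘR) (Pi : Set (BayesRL.Policy S A H))
    (σ : M.OptimalSelector Pi) (ε : ℝ) (_hε : 0 < ε) {K : ℕ}
    (ζ : BayesRL.Param ΘP ΘR → Fin K)
    (_hζ : BayesRL.Model.IsLayeredValuePartition σ ε ζ) (n : ℕ) :
    -- the history of an episode records the terminal state
    (∀ᵐ D ∂(BayesRL.Model.dataLaw σ id measurable_id n),
      BayesRL.Model.tsMutualInfo σ id measurable_id
          (BayesRL.Model.post σ id measurable_id n D) ζ
        = ∑ h : Fin H, BayesRL.Model.tsExpect σ (BayesRL.Model.post σ id measurable_id n D) ζ h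
            (fun E x => klDiv ((E.trans h x).prod (E.rew h x))
              (((M.meanEnv (BayesRL.Model.post σ id measurable_id n D)).trans h x).prod
                ((M.meanEnv (BayesRL.Model.post σ id measurable_id n D)).rew h x)))) ∧
    -- the history of an episode ends with the last reward
    (∀ᵐ D ∂(BayesRL.Model.dataLaw σ Prod.fst measurable_fst n),
      BayesRL.Model.tsMutualInfo σ Prod.fst measurable_fst
          (BayesRL.Model.post σ Prod.fst measurable_fst n D) ζ
        = ∑ h : Fin H,
            BayesRL.Model.tsExpect σ (BayesRL.Model.post σ Prod.fst measurable_fst n D) ζ h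
            (fun E x => if (h : ℕ) + 1 < H then
              klDiv ((E.trans h x).prod (E.rew h x))
                (((M.meanEnv (BayesRL.Model.post σ Prod.fst measurable_fst n D)).trans h x).prod
                  ((M.meanEnv (BayesRL.Model.post σ Prod.fst measurable_fst n D)).rew h x))
              else klDiv (E.rew h x)
                ((M.meanEnv (BayesRL.Model.post σ Prod.fst measurable_fst n D)).rew h x))) ∧
    -- the special case of deterministic rewards, for both kinds of histories
    ((∃ g : Fin H → ProbabilityTheory.Kernel (S × A) unitInterval,
        ∀ h, ∀ᵐ t ∂(M.priorR h), ∀ x, M.rew h (t, x) = g h x) →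
      (∀ᵐ D ∂(BayesRL.Model.dataLaw σ id measurable_id n),
        BayesRL.Model.tsMutualInfo σ id measurable_id
            (BayesRL.Model.post σ id measurable_id n D) ζ
          = ∑ h : Fin H,
              BayesRL.Model.tsExpect σ (BayesRL.Model.post σ id measurable_id n D) ζ h
              (fun E x => klDiv (E.trans h x)
                ((M.meanEnv (BayesRL.Model.post σ id measurable_id n D)).trans h x))) ∧
      (∀ᵐ D ∂(BayesRL.Model.dataLaw σ Prod.fst measurable_fst n),
        BayesRL.Model.tsMutualInfo σ Prod.fst measurable_fst
            (BayesRL.Model.post σ Prod.fst measurable_fst n D) ζ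
          = ∑ h : Fin H,
              BayesRL.Model.tsExpect σ (BayesRL.Model.post σ Prod.fst measurable_fst n D) ζ h
              (fun E x => if (h : ℕ) + 1 < H then
                klDiv (E.trans h x)
                  ((M.meanEnv (BayesRL.Model.post σ Prod.fst measurable_fst n D)).trans h x)
                else 0))) := by
  have hid := BayesRL.Model.ae_post_coordIndep σ id measurable_id
    (BayesRL.Model.recordPreservesCoordIndep_id σ) _hζ n
  have hfst := BayesRL.Model.ae_post_coordIndep σ Prod.fst measurable_fst
    (BayesRL.Model.recordPreservesCoordIndep_fst σ) _hζ n
  have hζm := _hζ.measurable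
  obtain ⟨c, hc, hcζ⟩ := _hζ.layered
  have h1 := hid.mono fun D hD =>
    BayesRL.Model.tsMutualInfo_id σ hD.1 hc hζm hcζ hD.2
  have h2 := hfst.mono fun D hD =>
    BayesRL.Model.tsMutualInfo_fst σ hD.1 hc hζm hcζ hD.2
  refine ⟨h1, h2, ?_⟩
  rintro ⟨g, hg⟩
  have hg' := BayesRL.Model.ae_prior_rewΘ_eq hg
  refine ⟨?_, ?_⟩
  · filter_upwards [h1, BayesRL.Model.ae_post_of_ae_prior σ id measurable_id n hg'] with D hD hgD
    rw [hD]
    refine Finset.sum_congr rfl fun h _ => BayesRL.Model.tsExpect_congr σ h fun θ x => ?_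
    -- The two product laws share their reward factor, which drops out of the divergence.
    rw [BayesRL.Model.surrogate_rew_eq hgD, BayesRL.klDiv_prod_same_right]
  · filter_upwards [h2, BayesRL.Model.ae_post_of_ae_prior σ Prod.fst measurable_fst n hg']
      with D hD hgD
    rw [hD]
    refine Finset.sum_congr rfl fun h _ => BayesRL.Model.tsExpect_congr σ h fun θ x => ?_
    -- In the last layer only the common reward law is left, so its term vanishes.
    rw [BayesRL.Model.surrogate_rew_eq hgD, BayesRL.klDiv_prod_same_right, klDiv_self]
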